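/- **Conventions.** $\mathsf{Top}_*$ is the closed symmetric monoidal category of based compactly generated (weak Hausdorff) spaces with smash product $\wedge$, unit $S^0$ and mapping spaces $\mathrm{Map}(X,Y)$. A *symmetric monoidal $\mathsf{Top}_*$-category* is a symmetric monoidal category $(\mathcal C,\barwedge,S)$ that is enriched, tensored ($X\otimes C$) and cotensored ($\mathrm{Map}_{\mathcal C}(X,C)$) over $\mathsf{Top}_*$, together with a natural transformation $$d\colon (X\wedge Y)\otimes(C\barwedge D)\to (X\otimes C)\barwedge(Y\otimes D)$$ that is compatible with the associativity, (right) unit and symmetry isomorphisms of $\mathsf{Top}_*$ and $\mathcal C$. Then $d$ and the evaluation maps give by adjunction a dual map $$d^\vee\colon \mathrm{Map}_{\mathcal C}(X,C)\barwedge \mathrm{Map}_{\mathcal C}(Y,D)\to \mathrm{Map}_{\mathcal C}(X\wedge Y,C\barwedge D).$$ Assume that $\mathcal C$ has all (small) limits. An *operad* $P$ in $\mathcal C$ is a functor from nonempty finite sets and bijections to $\mathcal C$ with a unit $S\to P(1)$ and natural partial compositions $\circ_a\colon P(A)\barwedge P(B)\to P(A\cup_a B)$ for $a\in A$, where $A\cup_aB=(A\setminus\{a\})\amalg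 B$, that satisfy the usual two associativity axioms (sequential and parallel) and the left and right unit axioms. A *cooperad* is the dual notion, with cocompositions $Q(A\cup_aB)\to Q(A)\barwedge Q(B)$ and a counit $Q(1)\to S$. An operad (cooperad) is *reduced* if its unit (counit) is an isomorphism. For a nonempty finite set $A$, let $\mathsf T(A)$ be the poset of isomorphism classes of rooted trees with a root edge, with leaves labelled bijectively by $A$ and in which no vertex has exactly one incoming edge; $T\le T'$ if $T$ is obtained from $T'$ by collapsing internal edges. For a vertex $v$ let $i(v)$ be its set of incoming edges. Let $w(T)$ be the space of assignments of lengths in $[0,1]$ to the edges of $T$ such that the distance from the root to each leaf is $1$, let $w_0(T)\subseteq w(T)$ be the subspace where the root edge or some leaf edge has length $0$, and let $\overline w(T)=w(T)/w_0(T)$ (with a disjoint basepoint added if $w_0(T)=\emptyset$). This is a functor $\mathsf T(A)\to\mathsf{Top}_*$, where collapsed edges get length $0$. For trees $T\in\mathsf T(A)$, $U\in\mathsf T(B)$ and $a\in A$ let $T\cup_aU\in\mathsf T(A\cup_aB)$ be the tree obtained by identifying the root edge of $U$ with the leaf edge $a$ of $T$. There is a map $\overline w(T\cup_aU)\to\overline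 w(T)\wedge\overline w(U)$ which sends a weighting $x$ to $t\wedge u$, where $t$ agrees with $x$ on the edges of $T$ other than the leaf edge $a$, and $x$ on the edges of $U$ equals $u$ scaled by the length for $t$ of the leaf edge $a$. **Statement.** Let $Q$ be a reduced cooperad in such a $\mathcal C$. For $T\in\mathsf T(A)$ put $Q_A(T)=\barwedge_{v}Q(i(v))$, the product over the vertices $v$ of $T$. 1. For each nonempty finite set $A$, there is exactly one functor $Q_A\colon\mathsf T(A)\to\mathcal C$ with these objects whose maps $Q_A(T/e)\to Q_A(T)$, for internal edges $e$ from $u$ to $v$, are given by the cocomposition $Q(i(u)\cup_v i(v))\to Q(i(u))\barwedge Q(i(v))$ and the identity on the other factors. 2. The objects $$\Omega(Q)(A)=\int_{T\in\mathsf T(A)}\mathrm{Map}_{\mathcal C}(\overline w(T),Q_A(T))$$ carry exactly one operad structure, the cobar construction $\Omega(Q)$, such that, for the projections $\pi_T\colon\Omega(Q)(A)\to \mathrm{Map}_{\mathcal C}(\overline w(T),Q_A(T))$: - bijections $A\to A'$ act by relabelling the leaves of trees; - $\pi_{T\cup_aU}\circ(\circ_a)$ is the composite of $\pi_T\barwedge\pi_U$,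 of $d^\vee\colon \mathrm{Map}_{\mathcal C}(\overline w(T),Q_A(T))\barwedge\mathrm{Map}_{\mathcal C}(\overline w(U),Q_B(U))\to\mathrm{Map}_{\mathcal C}(\overline w(T)\wedge\overline w(U),Q_A(T)\barwedge Q_B(U))$ and of the map induced by $\overline w(T\cup_aU)\to\overline w(T)\wedge\overline w(U)$ and $Q_A(T)\barwedge Q_B(U)\cong Q_{A\cup_aB}(T\cup_aU)$; - $\pi_V\circ(\circ_a)$ is the zero map (the basepoint of the mapping space) if $V\in\mathsf T(A\cup_aB)$ is not of the form $T\cup_aU$; - the unit $S\to\Omega(Q)(1)$ followed by $\pi_T$, for the unique tree $T$ with one leaf, is the canonical map $S\to\mathrm{Map}_{\mathcal C}(S^0,S)\cong\mathrm{Map}_{\mathcal C}(\overline w(T),Q_1(T))$. With this structure $\Omega(Q)$ is a reduced operad in $\mathcal C$. -/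

import Mathlib

open CategoryTheory MonoidalCategory Limits Topology

namespace CobarOperad

/-! ### Compactly generated weak Hausdorff spaces -/

/-- The family of all compact Hausdorff spaces. The `CH`-generated spaces are the spaces whose
topology is determined by all continuous maps from compact Hausdorff spaces. -/
abbrev CH (K : CompHaus.{0}) : Type := K

instance (K : CompHaus.{0}) : CompactSpace (CH K) := K.is_compact

instance (K : CompHaus.{0}) : T2Space (CH K) := K.is_hausdorff

theorem regularSpace_of_compact (X : Type) [TopologicalSpace X] [CompactSpace X] [T2Space X] :
    RegularSpace X := inferInstance

theorem locallyCompactSpace_of_compact (X : Type) [TopologicalSpace X] [CompactSpace X]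
    [T2Space X] : LocallyCompactSpace X := inferInstance

instance (K : CompHaus.{0}) : RegularSpace (CH K) := regularSpace_of_compact _

instance (K : CompHaus.{0}) : LocallyCompactSpace (CH K) := locallyCompactSpace_of_compact _

instance (K L : CompHaus.{0}) : IsGeneratedBy CH (CH K × CH L) :=
  inferInstanceAs (IsGeneratedBy CH (CH (CompHaus.of (K × L))))

/-- A space is weak Hausdorff if continuous images of compact Hausdorff spaces in it are closed. -/
class WeakHausdorff (X : Type) [TopologicalSpace X] : Prop where
  isClosed_range (K : CompHaus.{0}) (f : C(CH K, X)) : IsClosed (Set.range f)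

section WeakHausdorff

variable {X Y Z : Type} [TopologicalSpace X] [TopologicalSpace Y] [TopologicalSpace Z]

theorem isClosed_point [WeakHausdorff X] (x : X) : IsClosed ({x} : Set X) := by
  have := WeakHausdorff.isClosed_range (CompHaus.of Unit) (ContinuousMap.const _ x)
  convert this
  ext y
  simp [eq_comm]

theorem isClosed_image [WeakHausdorff X] (K : CompHaus.{0}) (f : C(CH K, X)) (S : Set (CH K))
    (hS : IsClosed S) : IsClosed (f '' S) := by
  have : CompactSpace S := isCompact_iff_compactSpace.mp hS.isCompact
  have := WeakHausdorff.isClosed_range (CompHaus.of S)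
    (f.comp ⟨Subtype.val, continuous_subtype_val⟩)
  convert this
  ext y
  exact ⟨fun ⟨k, hk, h⟩ => ⟨⟨k, hk⟩, h⟩, fun ⟨k, h⟩ => ⟨k.1, k.2, h⟩⟩

theorem isClosed_eqLocus [WeakHausdorff X] (K : CompHaus.{0}) (f g : C(CH K, X)) :
    IsClosed {k | f k = g k} := by
  rw [← isOpen_compl_iff, isOpen_iff_forall_mem_open]
  intro k hk
  have hU : IsOpen (f ⁻¹' {g k}ᶜ) := (isClosed_point (g k)).isOpen_compl.preimage f.continuous
  obtain ⟨S, hS, hSc, hSU⟩ := exists_mem_nhds_isClosed_subset (hU.mem_nhds (by simpa using hk))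
  refine ⟨interior S ∩ g ⁻¹' (f '' S)ᶜ, ?_, ?_, ?_, ?_⟩
  · rintro l ⟨hl, hl'⟩ (h : f l = g l)
    exact hl' ⟨l, interior_subset hl, h⟩
  · exact isOpen_interior.inter
      ((isClosed_image K f S hSc).isOpen_compl.preimage g.continuous)
  · exact mem_interior_iff_mem_nhds.mpr hS
  · rintro ⟨l, hl, h⟩
    exact hSU hl h

theorem WeakHausdorff.of_eqLocus [IsGeneratedBy CH X]
    (h : ∀ (K : CompHaus.{0}) (f g : C(CH K, X)), IsClosed {k | f k = g k}) :
    WeakHausdorff X := by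
  refine ⟨fun K f => ?_⟩
  rw [IsGeneratedBy.isClosed_iff CH]
  intro L g
  have hE := h (CompHaus.of (L × K)) ⟨fun p => g p.1, by fun_prop⟩ ⟨fun p => f p.2, by fun_prop⟩
  have := (isClosedMap_fst_of_compactSpace (X := CH L) (Y := CH K)) _ hE
  convert this
  ext l
  simp [eq_comm]

instance (priority := 100) WeakHausdorff.of_t2 [T2Space X] : WeakHausdorff X :=
  ⟨fun _ f => (isCompact_range f.continuous).isClosed⟩

instance (priority := 100) isGeneratedBy_of_compact [CompactSpace X] [T2Space X] :
    IsGeneratedBy CH X :=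
  inferInstanceAs (IsGeneratedBy CH (CH (CompHaus.of X)))

instance [WeakHausdorff X] : WeakHausdorff (WithGeneratedByTopology CH X) :=
  .of_eqLocus fun K f g => isClosed_eqLocus K
    (⟨_, WithGeneratedByTopology.continuous_equiv.comp f.continuous⟩ : C(CH K, X))
    ⟨_, WithGeneratedByTopology.continuous_equiv.comp g.continuous⟩

/-- The product of two spaces, with the compactly generated topology. -/
abbrev KProd (X Y : Type) [TopologicalSpace X] [TopologicalSpace Y] : Type :=
  WithGeneratedByTopology CH (X × Y)

instance [WeakHausdorff X] [WeakHausdorff Y] : WeakHausdorff (KProd X Y) := by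
  refine .of_eqLocus fun K f g => ?_
  have hc : ∀ f : C(CH K, KProd X Y), Continuous fun k => WithGeneratedByTopology.equiv (f k) :=
    fun f => WithGeneratedByTopology.continuous_equiv.comp f.continuous
  have h1 := isClosed_eqLocus K (⟨_, continuous_fst.comp (hc f)⟩ : C(CH K, X))
    ⟨_, continuous_fst.comp (hc g)⟩
  have h2 := isClosed_eqLocus K (⟨_, continuous_snd.comp (hc f)⟩ : C(CH K, Y))
    ⟨_, continuous_snd.comp (hc g)⟩
  convert h1.inter h2
  exact Set.ext fun k => Prod.ext_iff

theorem ContinuousGeneratedBy.prodMk {f : X → Y} {g : X → Z}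
    (hf : ContinuousGeneratedBy CH f) (hg : ContinuousGeneratedBy CH g) :
    ContinuousGeneratedBy CH fun x => (f x, g x) :=
  fun _ φ => (hf φ).prodMk (hg φ)

theorem continuous_iff_kcont [IsGeneratedBy CH X] {f : X → Y} :
    Continuous f ↔ ContinuousGeneratedBy CH f :=
  IsGeneratedBy.continuous_iff CH f

/-- In the compactly generated setting a product of a quotient map with a space is a quotient map:
the adjunction between products and mapping spaces. -/
theorem kcont_of_quotient_right [IsGeneratedBy CH X] {q : X → Y} (hq : IsQuotientMap q)
    {T : Type} [TopologicalSpace T] {h : Z × Y → T}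
    (hh : ContinuousGeneratedBy CH fun p : Z × X => h (p.1, q p.2)) :
    ContinuousGeneratedBy CH h := by
  let F := ContinuousMapGeneratedBy.curryEquiv (X := CH) ⟨_, hh⟩
  have hF : Continuous F := continuous_iff_kcont.mpr F.prop
  have hs : ∀ y : Y, ContinuousGeneratedBy CH fun z => h (z, y) := fun y => by
    obtain ⟨x, rfl⟩ := hq.surjective y
    exact (F x).prop
  let G : Y → ContinuousMapGeneratedBy CH Z T := fun y => ⟨_, hs y⟩
  have hG : Continuous G := by
    rw [hq.continuous_iff]
    exact hF
  exact (ContinuousMapGeneratedBy.curryEquiv.symm ⟨G, hG.continuousGeneratedBy⟩).prop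

theorem kcont_of_quotient_left [IsGeneratedBy CH X] {q : X → Y} (hq : IsQuotientMap q)
    {T : Type} [TopologicalSpace T] {h : Y × Z → T}
    (hh : ContinuousGeneratedBy CH fun p : X × Z => h (q p.1, p.2)) :
    ContinuousGeneratedBy CH h := by
  have h1 : ContinuousGeneratedBy CH fun p : Z × Y => h (p.2, p.1) :=
    kcont_of_quotient_right hq (hh.comp (continuous_swap.continuousGeneratedBy))
  exact h1.comp (f := Prod.swap) continuous_swap.continuousGeneratedBy

/-- The equivalence relation that identifies all points of `S` with each other. -/
def collapseSetoid (S : Set X) : Setoid X where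
  r x y := x = y ∨ (x ∈ S ∧ y ∈ S)
  iseqv := ⟨fun _ => .inl rfl, by rintro x y (rfl | h) <;> simp_all, by
    rintro x y z (rfl | h) (rfl | h') <;> simp_all⟩

/-- The quotient space `X / S`. -/
abbrev Collapse (S : Set X) : Type := Quotient (collapseSetoid S)

theorem Collapse.mk_eq_iff {X : Type} {S : Set X} {x y : X} :
    (Quotient.mk (collapseSetoid S) x = Quotient.mk (collapseSetoid S) y) ↔
      (x = y ∨ (x ∈ S ∧ y ∈ S)) :=
  Quotient.eq (r := collapseSetoid S)

theorem Collapse.weakHausdorff [IsGeneratedBy CH X] [WeakHausdorff X] {S : Set X}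
    (hS : IsClosed S) : WeakHausdorff (Collapse S) := by
  refine .of_eqLocus fun K f g => ?_
  let q : X → Collapse S := Quotient.mk _
  have hq : IsQuotientMap q := isQuotientMap_quotient_mk'
  have key : ContinuousGeneratedBy CH fun p : Collapse S × Collapse S => p.1 ≠ p.2 := by
    refine kcont_of_quotient_right hq (kcont_of_quotient_left hq ?_)
    intro K f
    refine continuous_Prop.mpr ?_
    have h1 := isClosed_eqLocus K (⟨_, continuous_fst.comp f.continuous⟩ : C(CH K, X))
      ⟨_, continuous_snd.comp f.continuous⟩
    have h2 := (hS.preimage (continuous_fst.comp f.continuous)).inter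
      (hS.preimage (continuous_snd.comp f.continuous))
    convert (h1.union h2).isOpen_compl using 1
    ext k
    exact not_congr Collapse.mk_eq_iff
  have := continuous_Prop.mp (key ⟨fun k => (f k, g k), by fun_prop⟩)
  convert this.isClosed_compl using 1
  ext k
  simp

end WeakHausdorff

/-! ### Based compactly generated spaces -/

/-- A based compactly generated (weak Hausdorff) space. -/
structure BasedTop where
  /-- the points -/
  carrier : Type
  [top : TopologicalSpace carrier]
  [gen : IsGeneratedBy CH carrier]
  [wh : WeakHausdorff carrier]
  /-- the basepoint -/
  pt : carrier

namespace BasedTop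

instance : CoeSort BasedTop Type := ⟨carrier⟩

attribute [instance] top gen wh

/-- Basepoint-preserving continuous maps. -/
@[ext]
structure Hom (X Y : BasedTop) where
  /-- the underlying function -/
  toFun : X → Y
  cont : Continuous toFun
  map_pt : toFun X.pt = Y.pt

instance : Category BasedTop where
  Hom := Hom
  id X := ⟨id, continuous_id, rfl⟩
  comp f g := ⟨g.toFun ∘ f.toFun, g.cont.comp f.cont, by simp [f.map_pt, g.map_pt]⟩

instance (X Y : BasedTop) : CoeFun (X ⟶ Y) (fun _ => X → Y) := ⟨Hom.toFun⟩

@[ext]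
theorem hom_ext {X Y : BasedTop} {f g : X ⟶ Y} (h : ∀ x, f x = g x) : f = g :=
  Hom.ext (funext h)

@[simp] theorem id_app (X : BasedTop) (x : X) : (𝟙 X : X ⟶ X) x = x := rfl

@[simp] theorem comp_app {X Y Z : BasedTop} (f : X ⟶ Y) (g : Y ⟶ Z) (x : X) :
    (f ≫ g) x = g (f x) := rfl

@[simp] theorem map_pt {X Y : BasedTop} (f : X ⟶ Y) : f X.pt = Y.pt := Hom.map_pt f

/-- The map that sends every point to the basepoint. -/
def const (X Y : BasedTop) : X ⟶ Y := ⟨fun _ => Y.pt, continuous_const, rfl⟩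

/-- The quotient `X / S` of a compactly generated space by a closed subset, with basepoint the
image of the point `s` of `S`. -/
def quot (X : Type) [TopologicalSpace X] [IsGeneratedBy CH X] [WeakHausdorff X] (S : Set X)
    (hS : IsClosed S) (s : X) : BasedTop :=
  letI := Collapse.weakHausdorff hS
  { carrier := Collapse S, pt := Quotient.mk _ s }

section Smash

variable (X Y : BasedTop)

/-- The wedge `X ∨ Y` as a subset of `X × Y`. -/
def wedge : Set (KProd X Y) :=
  {p | (WithGeneratedByTopology.equiv p).1 = X.pt ∨ (WithGeneratedByTopology.equiv p).2 = Y.pt}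

theorem isClosed_wedge : IsClosed (wedge X Y) :=
  (((isClosed_point X.pt).preimage continuous_fst).union
    ((isClosed_point Y.pt).preimage continuous_snd)).preimage
      WithGeneratedByTopology.continuous_equiv

/-- The smash product `X ∧ Y`: the quotient of the compactly generated product `X × Y` by the
wedge `X ∨ Y`. -/
def smash : BasedTop :=
  quot (KProd X Y) (wedge X Y) (isClosed_wedge X Y) (WithGeneratedByTopology.equiv.symm (X.pt, Y.pt))

variable {X Y} {Z W : BasedTop}

/-- The point `x ∧ y` of `X ∧ Y`. -/
def smk (x : X) (y : Y) : smash X Y :=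
  Quotient.mk (collapseSetoid _) (WithGeneratedByTopology.equiv.symm (x, y))

theorem smash_ind {p : smash X Y → Prop} (h : ∀ x y, p (smk x y)) (z : smash X Y) : p z :=
  Quotient.ind (fun q => h q.1 q.2) z

@[simp] theorem smk_pt_left (y : Y) : smk X.pt y = (smash X Y).pt :=
  Collapse.mk_eq_iff.mpr (.inr ⟨.inl rfl, .inl rfl⟩)

@[simp] theorem smk_pt_right (x : X) : smk x Y.pt = (smash X Y).pt :=
  Collapse.mk_eq_iff.mpr (.inr ⟨.inr rfl, .inl rfl⟩)

theorem isQuotientMap_mk : IsQuotientMap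
    (Quotient.mk (collapseSetoid (wedge X Y)) : KProd X Y → smash X Y) :=
  isQuotientMap_quotient_mk'

theorem kcont_equiv_symm {T : Type} [TopologicalSpace T] : ContinuousGeneratedBy CH
    (WithGeneratedByTopology.equiv.symm : T → WithGeneratedByTopology CH T) :=
  (WithGeneratedByTopology.equivSymmAsContinuousMapGeneratedBy CH T).prop

theorem kcont_smk : ContinuousGeneratedBy CH fun p : X × Y => smk p.1 p.2 :=
  (isQuotientMap_mk.continuous.continuousGeneratedBy).comp kcont_equiv_symm

theorem continuous_smash_iff {T : Type} [TopologicalSpace T] {g : smash X Y → T} :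
    Continuous g ↔ ContinuousGeneratedBy CH fun p : X × Y => g (smk p.1 p.2) := by
  refine ⟨fun h => h.continuousGeneratedBy.comp kcont_smk, fun h => ?_⟩
  exact isQuotientMap_mk.continuous_iff.mpr
    ((WithGeneratedByTopology.continuous_from_iff _).mpr h)

theorem kcont_smash_left {T S : Type} [TopologicalSpace T] [TopologicalSpace S]
    {g : smash X Y × S → T}
    (h : ContinuousGeneratedBy CH fun p : (X × Y) × S => g (smk p.1.1 p.1.2, p.2)) :
    ContinuousGeneratedBy CH g :=
  kcont_of_quotient_left isQuotientMap_mk (h.comp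
    (((WithGeneratedByTopology.continuous_equiv.comp continuous_fst).prodMk
      continuous_snd).continuousGeneratedBy (X := CH)))

theorem kcont_smash_right {T S : Type} [TopologicalSpace T] [TopologicalSpace S]
    {g : S × smash X Y → T}
    (h : ContinuousGeneratedBy CH fun p : S × (X × Y) => g (p.1, smk p.2.1 p.2.2)) :
    ContinuousGeneratedBy CH g :=
  kcont_of_quotient_right isQuotientMap_mk (h.comp
    ((continuous_fst.prodMk
      (WithGeneratedByTopology.continuous_equiv.comp continuous_snd)).continuousGeneratedBy
        (X := CH)))

/-- The map out of a smash product given by a map of two variables. -/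
def smashLift (f : X → Y → Z) (hf : ContinuousGeneratedBy CH fun p : X × Y => f p.1 p.2)
    (h₁ : ∀ y, f X.pt y = Z.pt) (h₂ : ∀ x, f x Y.pt = Z.pt) : smash X Y ⟶ Z where
  toFun := Quotient.lift
    (fun p => f (WithGeneratedByTopology.equiv p).1 (WithGeneratedByTopology.equiv p).2) (by
      rintro p q (rfl | ⟨hp, hq⟩)
      · rfl
      · trans Z.pt
        · rcases hp with hp | hp
          · rw [hp, h₁]
          · rw [hp, h₂]
        · rcases hq with hq | hq
          · rw [hq, h₁]
          · rw [hq, h₂])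
  cont := continuous_smash_iff.mpr hf
  map_pt := h₁ _

@[simp] theorem smashLift_smk (f : X → Y → Z) (hf h₁ h₂) (x : X) (y : Y) :
    (smashLift f hf h₁ h₂ : smash X Y ⟶ Z) (smk x y) = f x y := rfl

theorem smash_hom_ext {f g : smash X Y ⟶ Z} (h : ∀ x y, f (smk x y) = g (smk x y)) : f = g :=
  hom_ext (smash_ind h)

/-- The smash product of two maps. -/
def smashMap (f : X ⟶ Z) (g : Y ⟶ W) : smash X Y ⟶ smash Z W :=
  smashLift (fun x y => smk (f x) (g y))
    (kcont_smk.comp ((f.cont.comp continuous_fst).prodMk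
      (g.cont.comp continuous_snd)).continuousGeneratedBy)
    (by simp) (by simp)

/-- The symmetry. -/
def smashSwap (X Y : BasedTop) : smash X Y ⟶ smash Y X :=
  smashLift (fun x y => smk y x)
    (kcont_smk.comp (f := Prod.swap) continuous_swap.continuousGeneratedBy) (by simp) (by simp)

/-- The associativity map. -/
def smashAssoc (X Y Z : BasedTop) : smash (smash X Y) Z ⟶ smash X (smash Y Z) :=
  smashLift
    (fun p z => (smashLift (fun x y => smk x (smk y z))
      (kcont_smk.comp (ContinuousGeneratedBy.prodMk continuous_fst.continuousGeneratedBy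
        (kcont_smk.comp (f := fun p : X × Y => (p.2, z))
          (continuous_snd.prodMk continuous_const).continuousGeneratedBy)))
      (by simp) (by simp) : smash X Y ⟶ smash X (smash Y Z)) p)
    (kcont_smash_left (kcont_smk.comp (f := fun p : (X × Y) × Z => (p.1.1, smk p.1.2 p.2))
      (ContinuousGeneratedBy.prodMk
        (continuous_fst.comp continuous_fst).continuousGeneratedBy
        (kcont_smk.comp (f := fun p : (X × Y) × Z => (p.1.2, p.2))
          ((continuous_snd.comp continuous_fst).prodMk continuous_snd).continuousGeneratedBy))))
    (by simp) (smash_ind (by simp))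

/-- The inverse of the associativity map. -/
def smashAssocInv (X Y Z : BasedTop) : smash X (smash Y Z) ⟶ smash (smash X Y) Z :=
  smashLift
    (fun x p => (smashLift (fun y z => smk (smk x y) z)
      (kcont_smk.comp (ContinuousGeneratedBy.prodMk
        (kcont_smk.comp (f := fun p : Y × Z => (x, p.1))
          (continuous_const.prodMk continuous_fst).continuousGeneratedBy)
        continuous_snd.continuousGeneratedBy))
      (by simp) (by simp) : smash Y Z ⟶ smash (smash X Y) Z) p)
    (kcont_smash_right (kcont_smk.comp (f := fun p : X × (Y × Z) => (smk p.1 p.2.1, p.2.2))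
      (ContinuousGeneratedBy.prodMk
        (kcont_smk.comp (f := fun p : X × (Y × Z) => (p.1, p.2.1))
          (continuous_fst.prodMk (continuous_fst.comp continuous_snd)).continuousGeneratedBy)
        (continuous_snd.comp continuous_snd).continuousGeneratedBy)))
    (smash_ind (by simp)) (by simp)

@[simp] theorem smashMap_smk (f : X ⟶ Z) (g : Y ⟶ W) (x : X) (y : Y) :
    smashMap f g (smk x y) = smk (f x) (g y) := rfl

@[simp] theorem smashSwap_smk (x : X) (y : Y) : smashSwap X Y (smk x y) = smk y x := rfl

@[simp] theorem smashAssoc_smk (x : X) (y : Y) (z : Z) :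
    smashAssoc X Y Z (smk (smk x y) z) = smk x (smk y z) := rfl

@[simp] theorem smashAssocInv_smk (x : X) (y : Y) (z : Z) :
    smashAssocInv X Y Z (smk x (smk y z)) = smk (smk x y) z := rfl

/-- The 0-sphere `S⁰`, with basepoint `false`. -/
abbrev sphereZero : BasedTop where
  carrier := Bool
  pt := false

/-- The map `S⁰ ∧ X ⟶ X`. -/
def smashUnit (X : BasedTop) : smash sphereZero X ⟶ X :=
  smashLift (fun (b : Bool) x => if b then x else X.pt)
    (Continuous.continuousGeneratedBy (by
      refine continuous_prod_of_discrete_left.mpr fun b => ?_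
      cases b
      · exact continuous_const
      · exact continuous_id))
    (fun _ => rfl) (fun b => by cases b <;> rfl)

/-- The inverse of the map `S⁰ ∧ X ⟶ X`. -/
def smashUnitInv (X : BasedTop) : X ⟶ smash sphereZero X where
  toFun x := smk (X := sphereZero) true x
  cont := continuous_iff_kcont.mpr (ContinuousGeneratedBy.comp (kcont_smk (X := sphereZero))
    (f := fun x : X => ((true : sphereZero), x))
    (continuous_const.prodMk continuous_id).continuousGeneratedBy)
  map_pt := by simp

@[simp] theorem smashUnit_true (x : X) : smashUnit X (smk (X := sphereZero) true x) = x := rfl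

@[simp] theorem smashUnit_false (x : X) :
    smashUnit X (smk (X := sphereZero) false x) = X.pt := rfl

@[simp] theorem smashUnitInv_app (x : X) :
    smashUnitInv X x = smk (X := sphereZero) true x := rfl

theorem smk_false (x : X) : smk (X := sphereZero) false x = (smash sphereZero X).pt :=
  smk_pt_left (X := sphereZero) x

/-- The isomorphism `S⁰ ∧ X ≅ X`. -/
def smashUnitIso (X : BasedTop) : smash sphereZero X ≅ X where
  hom := smashUnit X
  inv := smashUnitInv X
  hom_inv_id := smash_hom_ext fun (b : Bool) x => by
    cases b
    · simp [smk_false]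
    · simp
  inv_hom_id := hom_ext fun x => by simp

/-- The symmetry isomorphism. -/
def smashSwapIso (X Y : BasedTop) : smash X Y ≅ smash Y X where
  hom := smashSwap X Y
  inv := smashSwap Y X
  hom_inv_id := smash_hom_ext fun x y => by simp
  inv_hom_id := smash_hom_ext fun x y => by simp

instance : MonoidalCategoryStruct BasedTop where
  tensorObj := smash
  whiskerLeft X _ _ f := smashMap (𝟙 X) f
  whiskerRight f Y := smashMap f (𝟙 Y)
  tensorHom := smashMap
  tensorUnit := sphereZero
  associator X Y Z :=
    { hom := smashAssoc X Y Z
      inv := smashAssocInv X Y Z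
      hom_inv_id := hom_ext (smash_ind fun p z => by
        revert p; exact smash_ind fun x y => by simp)
      inv_hom_id := hom_ext (smash_ind fun x p => by
        revert p; exact smash_ind fun y z => by simp) }
  leftUnitor := smashUnitIso
  rightUnitor X := smashSwapIso X sphereZero ≪≫ smashUnitIso X

instance : MonoidalCategory BasedTop :=
  MonoidalCategory.ofTensorHom
    (id_tensorHom_id := fun _ _ => smash_hom_ext fun _ _ => rfl)
    (id_tensorHom := fun _ _ _ _ => rfl)
    (tensorHom_id := fun _ _ => rfl)
    (tensorHom_comp_tensorHom := fun _ _ _ _ => smash_hom_ext fun _ _ => rfl)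
    (associator_naturality := fun _ _ _ => smash_hom_ext (smash_ind fun _ _ _ => rfl))
    (leftUnitor_naturality := fun f => smash_hom_ext fun (b : Bool) x => by
      cases b
      · exact (f.map_pt).symm
      · rfl)
    (rightUnitor_naturality := fun f => smash_hom_ext fun x (b : Bool) => by
      cases b
      · exact (f.map_pt).symm
      · rfl)
    (pentagon := fun _ _ _ _ => smash_hom_ext (smash_ind (fun p z => by
      revert p; exact smash_ind fun _ _ _ => rfl)))
    (triangle := fun X Y => smash_hom_ext (smash_ind fun x (b : Bool) y => by
      cases b
      · exact (smk_pt_right x).trans (smk_pt_left y).symm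
      · rfl))

instance : SymmetricCategory BasedTop where
  braiding := smashSwapIso
  braiding_naturality_right _ _ _ _ := smash_hom_ext fun _ _ => rfl
  braiding_naturality_left _ _ := smash_hom_ext fun _ _ => rfl
  hexagon_forward _ _ _ := smash_hom_ext (smash_ind fun _ _ _ => rfl)
  hexagon_reverse _ _ _ := smash_hom_ext fun _ => smash_ind fun _ _ => rfl
  symmetry _ _ := smash_hom_ext fun _ _ => rfl

end Smash

section Closed

variable (X Y : BasedTop)

/-- The continuous map that underlies a based map. -/
def homMap (f : X ⟶ Y) : ContinuousMapGeneratedBy CH X Y := ⟨f, f.cont.continuousGeneratedBy⟩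

/-- The compact-open topology on based maps, tested on maps from compact Hausdorff spaces. -/
abbrev homTopology : TopologicalSpace (X ⟶ Y) :=
  .induced (homMap X Y) inferInstance

attribute [local instance] homTopology

variable {X Y} in
theorem continuous_homMap : Continuous (homMap X Y) := continuous_induced_dom

variable {X Y} in
theorem kcont_eval (x : X) :
    ContinuousGeneratedBy CH fun f : ContinuousMapGeneratedBy CH X Y => f x :=
  (ContinuousMapGeneratedBy.ev (X := CH) (Y := X) (Z := Y)).prop.comp
    (f := fun f => (x, f)) (continuous_const.prodMk continuous_id).continuousGeneratedBy

instance : WeakHausdorff (WithGeneratedByTopology CH (X ⟶ Y)) := by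
  refine .of_eqLocus fun K f g => ?_
  have hc : ∀ (f : C(CH K, WithGeneratedByTopology CH (X ⟶ Y))) (x : X),
      Continuous fun k => (WithGeneratedByTopology.equiv (f k) : X ⟶ Y) x := fun f x =>
    (kcont_eval x) ⟨_, continuous_homMap.comp
      (WithGeneratedByTopology.continuous_equiv.comp f.continuous)⟩
  have := isClosed_iInter fun x : X => isClosed_eqLocus K (⟨_, hc f x⟩ : C(CH K, Y)) ⟨_, hc g x⟩
  convert this
  ext k
  simp only [Set.mem_ofPred_eq, Set.mem_iInter]
  exact ⟨fun h x => congrArg (fun h : X ⟶ Y => h x) h, fun h => hom_ext (Y := Y) h⟩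

/-- The space of based maps `Map(X, Y)`: the compact-open topology made compactly generated. -/
def mapSpace : BasedTop where
  carrier := WithGeneratedByTopology CH (X ⟶ Y)
  pt := WithGeneratedByTopology.equiv.symm (const X Y)

/-- The bijection between maps `X ∧ Y ⟶ Z` and maps `Y ⟶ Map(X, Z)`. -/
def curry (X Y Z : BasedTop) : (smash X Y ⟶ Z) ≃ (Y ⟶ mapSpace X Z) where
  toFun f :=
    { toFun := fun y => WithGeneratedByTopology.equiv.symm
        ({ toFun := fun x => f (smk x y)
           cont := continuous_iff_kcont.mpr
            (f.cont.continuousGeneratedBy.comp (kcont_smk.comp (f := fun x : X => (x, y))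
              (continuous_id.prodMk continuous_const).continuousGeneratedBy))
           map_pt := by simp } : X ⟶ Z)
      cont := by
        refine (IsGeneratedBy.equiv_symm_comp_continuous_iff (X := CH)
          (Y := Y) (Z := (X ⟶ Z)) _).mpr ?_
        refine continuous_induced_rng.mpr ?_
        exact continuous_iff_kcont.mpr (ContinuousMapGeneratedBy.curryEquiv (X := CH)
          (⟨_, f.cont.continuousGeneratedBy.comp kcont_smk⟩ :
            ContinuousMapGeneratedBy CH (X × Y) Z)).prop
      map_pt := congrArg (WithGeneratedByTopology.equiv (X := CH)).symm
        (hom_ext fun x => by simp [const]) }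
  invFun g := smashLift (fun x y => (WithGeneratedByTopology.equiv (g y) : X ⟶ Z) x)
    (ContinuousMapGeneratedBy.curryEquiv.symm
      (⟨fun y => homMap X Z (WithGeneratedByTopology.equiv (g y)),
        (continuous_homMap.comp
          (WithGeneratedByTopology.continuous_equiv.comp g.cont)).continuousGeneratedBy⟩ :
        ContinuousMapGeneratedBy CH Y (ContinuousMapGeneratedBy CH X Z))).prop
    (fun y => map_pt (WithGeneratedByTopology.equiv (g y) : X ⟶ Z))
    (fun x => by rw [map_pt g]; rfl)
  left_inv f := smash_hom_ext fun x y => rfl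
  right_inv g := rfl

/-- Postcomposition with a based map. -/
def mapSpacePost (X : BasedTop) {Y Z : BasedTop} (g : Y ⟶ Z) : mapSpace X Y ⟶ mapSpace X Z :=
  curry X (mapSpace X Y) Z ((curry X (mapSpace X Y) Y).symm (𝟙 _) ≫ g)

instance : MonoidalClosed BasedTop where
  closed X :=
    { rightAdj :=
        { obj := mapSpace X
          map := fun g => mapSpacePost X g
          map_id := fun _ => rfl
          map_comp := fun _ _ => rfl }
      adj := Adjunction.mkOfHomEquiv
        { homEquiv := curry X
          homEquiv_naturality_left_symm := fun _ _ => smash_hom_ext fun _ _ => rfl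
          homEquiv_naturality_right := fun f g => hom_ext fun y =>
            congrArg (WithGeneratedByTopology.equiv (X := CH)).symm (hom_ext fun x => by
              change (f ≫ g) (smk x y) = _
              rfl) } }

end Closed

end BasedTop

/-! ### Symmetric monoidal enriched categories -/

section Enriched

universe v₁ u₁ v₂ u₂

variable (V : Type u₁) [Category.{v₁} V] [MonoidalCategory V] [SymmetricCategory V]
  [MonoidalClosed V] (C : Type u₂) [Category.{v₂} C] [EnrichedOrdinaryCategory V C]

/-- A tensoring of a `V`-category `C` over `V`: a functor `(X, A) ↦ X ⊗ A` and isomorphisms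
`Map(X ⊗ A, B) ≅ Map(X, Map(A, B))` in `V`, natural in all variables. -/
class Tensored where
  /-- the functor `(X, A) ↦ X ⊗ A` -/
  tens : V ⥤ C ⥤ C
  /-- the isomorphism `Map(X ⊗ A, B) ≅ Map(X, Map(A, B))` -/
  tensIso (X : V) (A B : C) : ((tens.obj X).obj A ⟶[V] B) ≅ (ihom X).obj (A ⟶[V] B)
  tensIso_natural_V {X X' : V} (f : X ⟶ X') (A B : C) :
    (tensIso X' A B).hom ≫ (MonoidalClosed.pre f).app (A ⟶[V] B) =
      eHomWhiskerRight V ((tens.map f).app A) B ≫ (tensIso X A B).hom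
  tensIso_natural_left (X : V) {A A' : C} (g : A ⟶ A') (B : C) :
    (tensIso X A' B).hom ≫ (ihom X).map (eHomWhiskerRight V g B) =
      eHomWhiskerRight V ((tens.obj X).map g) B ≫ (tensIso X A B).hom
  tensIso_natural_right (X : V) (A : C) {B B' : C} (h : B ⟶ B') :
    (tensIso X A B).hom ≫ (ihom X).map (eHomWhiskerLeft V A h) =
      eHomWhiskerLeft V ((tens.obj X).obj A) h ≫ (tensIso X A B').hom

/-- A cotensoring of a `V`-category `C` over `V`: a functor `(X, B) ↦ Map_C(X, B)` and isomorphisms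
`Map(A, Map_C(X, B)) ≅ Map(X, Map(A, B))` in `V`, natural in all variables. -/
class Cotensored where
  /-- the functor `(X, B) ↦ Map_C(X, B)` -/
  cot : Vᵒᵖ ⥤ C ⥤ C
  /-- the isomorphism `Map(A, Map_C(X, B)) ≅ Map(X, Map(A, B))` -/
  cotIso (X : V) (A B : C) : (A ⟶[V] (cot.obj (.op X)).obj B) ≅ (ihom X).obj (A ⟶[V] B)
  cotIso_natural_V {X X' : V} (f : X ⟶ X') (A B : C) :
    (cotIso X' A B).hom ≫ (MonoidalClosed.pre f).app (A ⟶[V] B) =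
      eHomWhiskerLeft V A ((cot.map f.op).app B) ≫ (cotIso X A B).hom
  cotIso_natural_left (X : V) {A A' : C} (g : A ⟶ A') (B : C) :
    (cotIso X A' B).hom ≫ (ihom X).map (eHomWhiskerRight V g B) =
      eHomWhiskerRight V g ((cot.obj (.op X)).obj B) ≫ (cotIso X A B).hom
  cotIso_natural_right (X : V) (A : C) {B B' : C} (h : B ⟶ B') :
    (cotIso X A B).hom ≫ (ihom X).map (eHomWhiskerLeft V A h) =
      eHomWhiskerLeft V A ((cot.obj (.op X)).map h) ≫ (cotIso X A B').hom

variable {V C}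

/-- The bijection between maps `I ⟶ Map(X, Y)` and maps `X ⟶ Y` in `V`. -/
def unitHomEquiv (X Y : V) : (𝟙_ V ⟶ (ihom X).obj Y) ≃ (X ⟶ Y) :=
  ((ihom.adjunction X).homEquiv (𝟙_ V) Y).symm.trans ((ρ_ X).homCongr (Iso.refl Y))

section Tensored

variable [Tensored V C]

/-- The tensor product of a map in `V` and a map in `C`. -/
def tensMap {X X' : V} {A A' : C} (f : X ⟶ X') (g : A ⟶ A') :
    ((Tensored.tens (V := V)).obj X).obj A ⟶ (Tensored.tens.obj X').obj A' :=
  (Tensored.tens.map f).app A ≫ (Tensored.tens.obj X').map g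

/-- The bijection between maps `X ⊗ A ⟶ B` in `C` and maps `X ⟶ Map(A, B)` in `V`. -/
def tensEquiv (X : V) (A B : C) :
    (((Tensored.tens (V := V)).obj X).obj A ⟶ B) ≃ (X ⟶ (A ⟶[V] B)) :=
  (eHomEquiv V).trans (((Iso.refl _).homCongr (Tensored.tensIso X A B)).trans (unitHomEquiv _ _))

variable (V) in
/-- The canonical map `I ⊗ A ⟶ A`. -/
def tensUnit (A : C) : ((Tensored.tens (V := V)).obj (𝟙_ V)).obj A ⟶ A :=
  (tensEquiv (𝟙_ V) A A).symm (eId V A)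

end Tensored

section Cotensored

variable [Cotensored V C]

/-- The map between cotensors `Map_C(X', A) ⟶ Map_C(X, A')` induced by `X ⟶ X'` and `A ⟶ A'`. -/
def cotMap {X X' : V} {A A' : C} (f : X ⟶ X') (g : A ⟶ A') :
    ((Cotensored.cot (V := V)).obj (.op X')).obj A ⟶ (Cotensored.cot.obj (.op X)).obj A' :=
  (Cotensored.cot.map f.op).app A ≫ (Cotensored.cot.obj (.op X)).map g

/-- The bijection between maps `A ⟶ Map_C(X, B)` in `C` and maps `X ⟶ Map(A, B)` in `V`. -/
def cotEquiv (X : V) (A B : C) :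
    (A ⟶ ((Cotensored.cot (V := V)).obj (.op X)).obj B) ≃ (X ⟶ (A ⟶[V] B)) :=
  (eHomEquiv V).trans (((Iso.refl _).homCongr (Cotensored.cotIso X A B)).trans (unitHomEquiv _ _))

variable [Tensored V C]

/-- The adjunction between tensors and cotensors: the bijection between maps `X ⊗ A ⟶ B` and maps
`A ⟶ Map_C(X, B)`. -/
def tensCotEquiv (X : V) (A B : C) :
    (((Tensored.tens (V := V)).obj X).obj A ⟶ B) ≃
      (A ⟶ ((Cotensored.cot (V := V)).obj (.op X)).obj B) :=
  (tensEquiv X A B).trans (cotEquiv X A B).symm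

/-- The evaluation map `X ⊗ Map_C(X, B) ⟶ B`. -/
def cotEval (X : V) (B : C) :
    ((Tensored.tens (V := V)).obj X).obj ((Cotensored.cot.obj (.op X)).obj B) ⟶ B :=
  (tensCotEquiv X _ B).symm (𝟙 _)

end Cotensored

variable (V C) in
/-- A symmetric monoidal `V`-category: a symmetric monoidal category `C`, enriched, tensored and
cotensored over `V`, with a natural transformation `d : (X ∧ Y) ⊗ (A ∧ B) ⟶ (X ⊗ A) ∧ (Y ⊗ B)`
that is compatible with the associativity, unit and symmetry isomorphisms. -/
class SymmetricMonoidalVCategory [MonoidalCategory C] [SymmetricCategory C] extends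
    Tensored V C, Cotensored V C where
  /-- the distributivity map `(X ∧ Y) ⊗ (A ∧ B) ⟶ (X ⊗ A) ∧ (Y ⊗ B)` -/
  d (X Y : V) (A B : C) :
    (tens.obj (X ⊗ Y)).obj (A ⊗ B) ⟶ (tens.obj X).obj A ⊗ (tens.obj Y).obj B
  d_natural {X X' Y Y' : V} {A A' B B' : C} (f : X ⟶ X') (g : Y ⟶ Y') (h : A ⟶ A')
      (k : B ⟶ B') :
    tensMap (f ⊗ₘ g) (h ⊗ₘ k) ≫ d X' Y' A' B' = d X Y A B ≫ (tensMap f h ⊗ₘ tensMap g k)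
  d_assoc (X Y Z : V) (A B D : C) :
    d (X ⊗ Y) Z (A ⊗ B) D ≫ d X Y A B ▷ _ ≫ (α_ _ _ _).hom =
      tensMap (α_ X Y Z).hom (α_ A B D).hom ≫ d X (Y ⊗ Z) A (B ⊗ D) ≫ _ ◁ d Y Z B D
  d_unit (X : V) (A : C) :
    tensMap (ρ_ X).inv (ρ_ A).inv ≫ d X (𝟙_ V) A (𝟙_ C) ≫ _ ◁ tensUnit V (𝟙_ C) ≫ (ρ_ _).hom =
      𝟙 ((tens.obj X).obj A)
  d_symm (X Y : V) (A B : C) :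
    d X Y A B ≫ (β_ _ _).hom = tensMap (β_ X Y).hom (β_ A B).hom ≫ d Y X B A

/-- The dual of the distributivity map: the map
`Map_C(X, A) ∧ Map_C(Y, B) ⟶ Map_C(X ∧ Y, A ∧ B)` whose adjoint is `d` followed by evaluation. -/
def dCot [MonoidalCategory C] [SymmetricCategory C] [SymmetricMonoidalVCategory V C]
    (X Y : V) (A B : C) :
    (Cotensored.cot.obj (.op X)).obj A ⊗ (Cotensored.cot.obj (.op Y)).obj B ⟶
      (Cotensored.cot.obj (.op (X ⊗ Y))).obj (A ⊗ B) :=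
  tensCotEquiv (X ⊗ Y) _ (A ⊗ B) (SymmetricMonoidalVCategory.d X Y _ _ ≫
    (cotEval X A ⊗ₘ cotEval Y B))

end Enriched

/-! ### Operads and cooperads -/

/-- A nonempty finite set. -/
structure NEFin where
  /-- the elements -/
  carrier : Type
  [fin : Finite carrier]
  [ne : Nonempty carrier]

namespace NEFin

instance : CoeSort NEFin Type := ⟨carrier⟩

attribute [instance] fin ne

/-- The set `1` with one element. -/
def one : NEFin := ⟨Unit⟩

/-- The set `A ∪_a B`, the disjoint union of `A ∖ {a}` and `B`. -/
def graft (A : NEFin) (a : A) (B : NEFin) : NEFin := ⟨{x : A // x ≠ a} ⊕ B⟩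

/-- The element of `A ∪_a B` given by an element of `A` other than `a`. -/
def inA {A B : NEFin} {a : A} (x : A) (hx : x ≠ a) : graft A a B := .inl ⟨x, hx⟩

/-- The element of `A ∪_a B` given by an element of `B`. -/
def inB {A B : NEFin} {a : A} (b : B) : graft A a B := .inr b

/-- The bijection `A ∪_a B ≃ A' ∪_{σ a} B'` induced by bijections `A ≃ A'` and `B ≃ B'`. -/
def graftCongr {A A' B B' : NEFin} (σ : A ≃ A') (τ : B ≃ B') (a : A) :
    graft A a B ≃ graft A' (σ a) B' :=
  Equiv.sumCongr (σ.subtypeEquiv fun _ => σ.injective.ne_iff.symm) τ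

/-- The bijection `(A ∪_a B) ∪_b C ≃ A ∪_a (B ∪_b C)` that is the identity on elements of `A`,
`B` and `C`. -/
def graftAssoc (A B C : NEFin) (a : A) (b : B) :
    graft (graft A a B) (inB b) C ≃ graft A a (graft B b C) where
  toFun
    | .inl ⟨.inl x, _⟩ => .inl x
    | .inl ⟨.inr y, h⟩ => .inr (.inl ⟨y, fun e => h (congrArg Sum.inr e)⟩)
    | .inr z => .inr (.inr z)
  invFun
    | .inl x => .inl ⟨.inl x, Sum.inl_ne_inr⟩
    | .inr (.inl ⟨y, h⟩) => .inl ⟨.inr y, fun e => h (Sum.inr_injective e)⟩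
    | .inr (.inr z) => .inr z
  left_inv := by rintro (⟨_ | _, _⟩ | _) <;> rfl
  right_inv := by rintro (_ | ⟨_, _⟩ | _) <;> rfl

/-- The bijection `(A ∪_a B) ∪_{a'} C ≃ (A ∪_{a'} C) ∪_a B` that is the identity on elements of
`A`, `B` and `C`. -/
def graftComm (A B C : NEFin) (a a' : A) (h : a ≠ a') :
    graft (graft A a B) (inA a' h.symm) C ≃ graft (graft A a' C) (inA a h) B where
  toFun
    | .inl ⟨.inl ⟨x, hx⟩, hx'⟩ =>
      .inl ⟨.inl ⟨x, fun e => hx' (congrArg Sum.inl (Subtype.ext e))⟩,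
        fun e => hx (congrArg Subtype.val (Sum.inl_injective e))⟩
    | .inl ⟨.inr y, _⟩ => .inr y
    | .inr z => .inl ⟨.inr z, Sum.inr_ne_inl⟩
  invFun
    | .inl ⟨.inl ⟨x, hx⟩, hx'⟩ =>
      .inl ⟨.inl ⟨x, fun e => hx' (congrArg Sum.inl (Subtype.ext e))⟩,
        fun e => hx (congrArg Subtype.val (Sum.inl_injective e))⟩
    | .inl ⟨.inr z, _⟩ => .inr z
    | .inr y => .inl ⟨.inr y, Sum.inr_ne_inl⟩
  left_inv := by rintro (⟨_ | _, _⟩ | _) <;> rfl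
  right_inv := by rintro (⟨_ | _, _⟩ | _) <;> rfl

/-- The bijection `1 ∪_1 A ≃ A`. -/
def graftOneLeft (A : NEFin) : graft one () A ≃ A where
  toFun
    | .inl ⟨(), h⟩ => (h rfl).elim
    | .inr x => x
  invFun := .inr
  left_inv := by
    rintro (⟨⟨⟩, h⟩ | _)
    · exact (h rfl).elim
    · rfl
  right_inv _ := rfl

open Classical in
/-- The bijection `A ≃ A ∪_a 1`. -/
noncomputable def graftOneRight (A : NEFin) (a : A) : A ≃ graft A a one where
  toFun x := if h : x = a then .inr () else .inl ⟨x, h⟩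
  invFun
    | .inl x => x
    | .inr () => a
  left_inv x := by
    by_cases h : x = a
    · simp [h]
    · simp [h]
  right_inv := by
    rintro (⟨x, h⟩ | ⟨⟩)
    · exact dif_neg h
    · exact dif_pos rfl

end NEFin

open NEFin

section Operads

universe v u

variable {C : Type u} [Category.{v} C]

/-- The structure of a symmetric sequence (a functor from nonempty finite sets and bijections
to `C`) on a family of objects. -/
@[ext]
structure SymmetricSequence (F : NEFin → C) where
  /-- the action of bijections -/
  map {A B : NEFin} : (A ≃ B) → (F A ⟶ F B)
  map_refl (A : NEFin) : map (Equiv.refl A) = 𝟙 _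
  map_trans {A B D : NEFin} (σ : A ≃ B) (τ : B ≃ D) : map (σ.trans τ) = map σ ≫ map τ

variable [MonoidalCategory C] [SymmetricCategory C]

/-- The structure of an operad in `C` on a family of objects, with partial compositions `∘_a`. -/
@[ext]
structure Operad (P : NEFin → C) extends SymmetricSequence P where
  /-- the partial composition `∘_a` -/
  comp (A B : NEFin) (a : A) : P A ⊗ P B ⟶ P (graft A a B)
  /-- the unit map -/
  unit : 𝟙_ C ⟶ P one
  comp_natural {A A' B B' : NEFin} (σ : A ≃ A') (τ : B ≃ B') (a : A) :
    comp A B a ≫ map (graftCongr σ τ a) = (map σ ⊗ₘ map τ) ≫ comp A' B' (σ a)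
  comp_assoc (A B D : NEFin) (a : A) (b : B) :
    comp A B a ▷ P D ≫ comp (graft A a B) D (inB b) ≫ map (graftAssoc A B D a b) =
      (α_ _ _ _).hom ≫ P A ◁ comp B D b ≫ comp A (graft B b D) a
  comp_comm (A B D : NEFin) (a a' : A) (h : a ≠ a') :
    comp A B a ▷ P D ≫ comp (graft A a B) D (inA a' h.symm) ≫ map (graftComm A B D a a' h) =
      (α_ _ _ _).hom ≫ P A ◁ (β_ (P B) (P D)).hom ≫ (α_ _ _ _).inv ≫
        comp A D a' ▷ P B ≫ comp (graft A a' D) B (inA a h)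
  unit_comp (A : NEFin) :
    (λ_ (P A)).inv ≫ unit ▷ P A ≫ comp one A () ≫ map (graftOneLeft A) = 𝟙 (P A)
  comp_unit (A : NEFin) (a : A) :
    (ρ_ (P A)).inv ≫ P A ◁ unit ≫ comp A one a = map (graftOneRight A a)

/-- An operad is reduced if its unit map is an isomorphism. -/
def Operad.IsReduced {P : NEFin → C} (o : Operad P) : Prop := IsIso o.unit

/-- The structure of a cooperad in `C` on a family of objects: this is dual to an operad. -/
@[ext]
structure Cooperad (Q : NEFin → C) extends SymmetricSequence Q where
  /-- the partial cocomposition -/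
  cocomp (A B : NEFin) (a : A) : Q (graft A a B) ⟶ Q A ⊗ Q B
  /-- the counit map -/
  counit : Q one ⟶ 𝟙_ C
  cocomp_natural {A A' B B' : NEFin} (σ : A ≃ A') (τ : B ≃ B') (a : A) :
    map (graftCongr σ τ a) ≫ cocomp A' B' (σ a) = cocomp A B a ≫ (map σ ⊗ₘ map τ)
  cocomp_assoc (A B D : NEFin) (a : A) (b : B) :
    map (graftAssoc A B D a b).symm ≫ cocomp (graft A a B) D (inB b) ≫ cocomp A B a ▷ Q D =
      cocomp A (graft B b D) a ≫ Q A ◁ cocomp B D b ≫ (α_ _ _ _).inv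
  cocomp_comm (A B D : NEFin) (a a' : A) (h : a ≠ a') :
    map (graftComm A B D a a' h).symm ≫ cocomp (graft A a B) D (inA a' h.symm) ≫
        cocomp A B a ▷ Q D =
      cocomp (graft A a' D) B (inA a h) ≫ cocomp A D a' ▷ Q B ≫ (α_ _ _ _).hom ≫
        Q A ◁ (β_ (Q D) (Q B)).hom ≫ (α_ _ _ _).inv
  counit_cocomp (A : NEFin) :
    map (graftOneLeft A).symm ≫ cocomp one A () ≫ counit ▷ Q A ≫ (λ_ (Q A)).hom = 𝟙 (Q A)
  cocomp_counit (A : NEFin) (a : A) :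
    cocomp A one a ≫ Q A ◁ counit ≫ (ρ_ (Q A)).hom = map (graftOneRight A a).symm

/-- A cooperad is reduced if its counit map is an isomorphism. -/
def Cooperad.IsReduced {Q : NEFin → C} (q : Cooperad Q) : Prop := IsIso q.counit

/-! ### Unordered tensor products -/

/-- The tensor product of the objects `X i` for `i` in a list. -/
def listTensor {ι : Type} (X : ι → C) : List ι → C
  | [] => 𝟙_ C
  | i :: l => X i ⊗ listTensor X l

/-- Termwise maps of tensor products over lists. -/
def listTensorMap {ι : Type} {X Y : ι → C} (f : ∀ i, X i ⟶ Y i) :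
    ∀ l : List ι, listTensor X l ⟶ listTensor Y l
  | [] => 𝟙 _
  | i :: l => f i ⊗ₘ listTensorMap f l

/-- The identification of the tensor product over the image of a list with a tensor product over
the list itself. -/
def listTensorPull {ι κ : Type} (X : ι → C) (e : κ → ι) :
    ∀ l : List κ, listTensor X (l.map e) ≅ listTensor (fun k => X (e k)) l
  | [] => Iso.refl _
  | k :: l => whiskerLeftIso (X (e k)) (listTensorPull X e l)

/-- The canonical isomorphism between the tensor product over a concatenation of lists and the
tensor product of the tensor products. -/
def listTensorAppend {ι : Type} (X : ι → C) (m : List ι) :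
    ∀ l : List ι, listTensor X (l ++ m) ≅ listTensor X l ⊗ listTensor X m
  | [] => (λ_ _).symm
  | i :: l => whiskerLeftIso (X i) (listTensorAppend X m l) ≪≫ (α_ _ _ _).symm

open Classical in
/-- The symmetry isomorphism that moves the factor of index `i` to the front. -/
noncomputable def listTensorExtract {ι : Type} (X : ι → C) (i : ι) :
    ∀ l : List ι, i ∈ l → (listTensor X l ≅ X i ⊗ listTensor X (l.erase i))
  | [], h => (List.not_mem_nil h).elim
  | j :: l, h =>
    if e : j = i then eqToIso (by rw [e, List.erase_cons_head]; rfl)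
    else
      whiskerLeftIso (X j) (listTensorExtract X i l (by
        rcases List.mem_cons.mp h with rfl | h
        · exact (e rfl).elim
        · exact h)) ≪≫ (α_ _ _ _).symm ≪≫ whiskerRightIso (β_ _ _) _ ≪≫ α_ _ _ _ ≪≫
      eqToIso (by rw [List.erase_cons_tail (by simpa using e)]; rfl)

open Classical in
/-- The symmetry isomorphism between tensor products over lists that are permutations of each
other. For lists without repetitions it matches the factors with equal index. -/
noncomputable def listTensorReorder {ι : Type} (X : ι → C) :
    ∀ l m : List ι, l.Perm m → (listTensor X l ≅ listTensor X m)
  | [], m, h => eqToIso (by rw [h.nil_eq])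
  | i :: l, m, h =>
    whiskerLeftIso (X i) (listTensorReorder X l (m.erase i) (by
      simpa using h.erase i)) ≪≫
      (listTensorExtract X i m (h.subset List.mem_cons_self)).symm

/-- A list of all elements of a finite type, in some chosen order. -/
noncomputable def enum (ι : Type) [Finite ι] : List ι :=
  letI := Fintype.ofFinite ι
  Finset.univ.toList

theorem mem_enum {ι : Type} [Finite ι] (i : ι) : i ∈ enum ι := by
  simp [enum]

theorem nodup_enum (ι : Type) [Finite ι] : (enum ι).Nodup := by
  simp [enum, Finset.nodup_toList]

/-- The tensor product `⋀_i X i` over a finite index type, in some chosen order. Different choices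
of the order are related by `listTensorReorder`. -/
noncomputable def bigTensor {ι : Type} [Finite ι] (X : ι → C) : C :=
  listTensor X (enum ι)

/-- The map of tensor products induced by maps of the factors. -/
noncomputable def bigTensorMap {ι : Type} [Finite ι] {X Y : ι → C} (f : ∀ i, X i ⟶ Y i) :
    bigTensor X ⟶ bigTensor Y :=
  listTensorMap f (enum ι)

/-- The isomorphism of tensor products induced by a bijection of the index types. -/
noncomputable def bigTensorReindex {ι κ : Type} [Finite ι] [Finite κ] (X : ι → C) (e : κ ≃ ι) :
    bigTensor X ≅ bigTensor (fun k => X (e k)) :=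
  listTensorReorder X (enum ι) ((enum κ).map e)
    ((List.perm_ext_iff_of_nodup (nodup_enum ι) ((nodup_enum κ).map e.injective)).mpr
      (fun i => ⟨fun _ => List.mem_map.mpr ⟨e.symm i, mem_enum _, e.apply_symm_apply i⟩,
        fun _ => mem_enum i⟩)) ≪≫ listTensorPull X e (enum κ)

/-- The isomorphism between the unit and a tensor product over an empty index type. -/
noncomputable def bigTensorEmpty {ι : Type} [Finite ι] [IsEmpty ι] (X : ι → C) :
    bigTensor X ≅ 𝟙_ C :=
  listTensorReorder X (enum ι) [] (by
    rw [List.eq_nil_iff_forall_not_mem.mpr (fun i _ => IsEmpty.false i : ∀ i, i ∉ enum ι)])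

/-- The isomorphism that splits off one factor. -/
noncomputable def bigTensorOption {ι : Type} [Finite ι] (X : Option ι → C) :
    bigTensor X ≅ X none ⊗ bigTensor (fun i => X (some i)) :=
  listTensorReorder X (enum _) (none :: (enum ι).map some)
    ((List.perm_ext_iff_of_nodup (nodup_enum _) (by
      simp [List.nodup_map_iff (Option.some_injective _), nodup_enum])).mpr
      (fun k => ⟨fun _ => by cases k <;> simp [mem_enum], fun _ => mem_enum k⟩)) ≪≫
    whiskerLeftIso (X none) (listTensorPull X some (enum ι))

/-- The isomorphism that splits a tensor product over a disjoint union. -/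
noncomputable def bigTensorSum {ι κ : Type} [Finite ι] [Finite κ] (X : ι ⊕ κ → C) :
    bigTensor X ≅ bigTensor (fun i => X (.inl i)) ⊗ bigTensor (fun k => X (.inr k)) :=
  listTensorReorder X (enum _) ((enum ι).map Sum.inl ++ (enum κ).map Sum.inr)
    ((List.perm_ext_iff_of_nodup (nodup_enum _) (by
      refine List.nodup_append.mpr ⟨(nodup_enum ι).map Sum.inl_injective,
        (nodup_enum κ).map Sum.inr_injective, ?_⟩
      simp)).mpr
      (fun k => ⟨fun _ => by cases k <;> simp [mem_enum], fun _ => mem_enum k⟩)) ≪≫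
    listTensorAppend X _ _ ≪≫
    (listTensorPull X Sum.inl (enum ι) ⊗ᵢ listTensorPull X Sum.inr (enum κ))

end Operads

/-! ### Labelled trees

A leaf-labelled rooted tree in which no vertex has exactly one incoming edge is determined, up to
isomorphism, by the family of the sets of leaves above its non-root elements. Each element other
than the root is the upper endpoint of a unique edge, so this family is also the set of edges. -/

/-- An isomorphism class of `A`-labelled trees, given as the family `clusters` of the sets of
labels of the leaves above each element of the tree other than the root. The cluster `univ`
is the root edge, the clusters `{a}` are the leaf edges. -/
@[ext]
structure LTree (A : NEFin) where
  /-- the clusters -/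
  clusters : Set (Set A)
  nonempty_of_mem : ∀ c ∈ clusters, c.Nonempty
  univ_mem : Set.univ ∈ clusters
  singleton_mem : ∀ a, {a} ∈ clusters
  laminar : ∀ c ∈ clusters, ∀ d ∈ clusters, c ⊆ d ∨ d ⊆ c ∨ Disjoint c d

namespace LTree

variable {A B : NEFin}

/-- `T ≤ T'` if `T` is obtained from `T'` by collapsing internal edges. -/
instance : PartialOrder (LTree A) := PartialOrder.lift clusters fun _ _ => LTree.ext

theorem le_def {T T' : LTree A} : T ≤ T' ↔ T.clusters ⊆ T'.clusters := Iff.rfl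

/-- The edges of a tree. -/
abbrev Edge (T : LTree A) : Type := {c : Set A // c ∈ T.clusters}

/-- The vertices of a tree: the elements other than the root and the leaves. The edge below a vertex
is given by the same cluster. -/
abbrev Vert (T : LTree A) : Type := {c : Set A // c ∈ T.clusters ∧ c.Nontrivial}

/-- The incoming edges of a vertex: the maximal clusters below it. -/
abbrev Inc (T : LTree A) (v : Set A) : Type :=
  {c : Set A // c ∈ T.clusters ∧ c ⊂ v ∧ ∀ d ∈ T.clusters, c ⊂ d → ¬ d ⊂ v}

theorem exists_inc (T : LTree A) {c v : Set A} (hc : c ∈ T.clusters) (hv : c ⊂ v) :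
    ∃ d : T.Inc v, c ⊆ d.1 := by
  obtain ⟨d, hcd, hd⟩ := (Set.toFinite {d | d ∈ T.clusters ∧ d ⊂ v}).exists_le_maximal ⟨hc, hv⟩
  exact ⟨⟨d, hd.prop.1, hd.prop.2, fun e he hde hev =>
    hde.2 (hd.le_of_ge ⟨he, hev⟩ hde.1)⟩, hcd⟩

theorem nonempty_inc (T : LTree A) {v : Set A} (hv : v.Nontrivial) : Nonempty (T.Inc v) := by
  obtain ⟨a, ha⟩ := hv.nonempty
  have : ({a} : Set A) ⊂ v := by
    refine ⟨by simpa using ha, fun h => ?_⟩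
    exact (Set.not_nontrivial_singleton (hv.mono h))
  exact ⟨(T.exists_inc (T.singleton_mem a) this).choose⟩

/-- The set `i(v)` of incoming edges of a vertex. -/
def inc (T : LTree A) (v : T.Vert) : NEFin :=
  haveI := T.nonempty_inc v.2.2
  ⟨T.Inc v.1⟩

/-! #### Edge collapse -/

/-- The tree obtained by collapsing the internal edge `c`. -/
def collapse (T : LTree A) (c : Set A) (h : c ≠ Set.univ) (h' : c.Nontrivial) : LTree A where
  clusters := T.clusters \ {c}
  nonempty_of_mem d hd := T.nonempty_of_mem d hd.1
  univ_mem := ⟨T.univ_mem, fun e => h (Set.mem_singleton_iff.mp e).symm⟩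
  singleton_mem a := ⟨T.singleton_mem a, fun e => by
    rw [← Set.mem_singleton_iff.mp e] at h'
    exact Set.not_nontrivial_singleton h'⟩
  laminar d hd e he := T.laminar d hd.1 e he.1

/-- An internal edge: a vertex `low`, together with an incoming edge of it whose upper endpoint is
a vertex as well. -/
structure InternalEdge (T : LTree A) where
  /-- the lower endpoint -/
  low : T.Vert
  /-- the edge -/
  edge : T.inc low
  nontrivial : edge.1.Nontrivial

namespace InternalEdge

variable {T : LTree A} (e : T.InternalEdge)

/-- The upper endpoint of an internal edge. -/
def up : T.Vert := ⟨e.edge.1, e.edge.2.1, e.nontrivial⟩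

theorem up_ssubset : e.up.1 ⊂ e.low.1 := e.edge.2.2.1

theorem up_ne_univ : e.up.1 ≠ Set.univ := fun h =>
  e.up_ssubset.2 (by rw [h]; exact Set.subset_univ _)

/-- The tree `T / e`. -/
def coll : LTree A := T.collapse e.up.1 e.up_ne_univ e.nontrivial

theorem coll_le : e.coll ≤ T := fun _ h => h.1

/-- The vertices of `T` other than the endpoints of `e`. -/
abbrev Rest : Type := {v : T.Vert // v.1 ≠ e.low.1 ∧ v.1 ≠ e.up.1}

/-- The vertices of `T` are the endpoints of `e` and the other vertices. -/
noncomputable def vertEquiv : Option (Option e.Rest) ≃ T.Vert :=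
  Equiv.ofBijective (fun
    | none => e.low
    | some none => e.up
    | some (some r) => r.1) (by
    have hne : e.up.1 ≠ e.low.1 := e.up_ssubset.ne
    constructor
    · rintro (_ | _ | r) (_ | _ | s) h
      · rfl
      · exact (hne (congrArg Subtype.val h).symm).elim
      · exact (s.2.1 (congrArg Subtype.val h).symm).elim
      · exact (hne (congrArg Subtype.val h)).elim
      · rfl
      · exact (s.2.2 (congrArg Subtype.val h).symm).elim
      · exact (r.2.1 (congrArg Subtype.val h)).elim
      · exact (r.2.2 (congrArg Subtype.val h)).elim
      · exact congrArg (some ∘ some) (Subtype.ext h)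
    · intro v
      by_cases h : v.1 = e.low.1
      · exact ⟨none, Subtype.ext h.symm⟩
      · by_cases h' : v.1 = e.up.1
        · exact ⟨some none, Subtype.ext h'.symm⟩
        · exact ⟨some (some ⟨v, h, h'⟩), rfl⟩)

/-- The lower endpoint of `e` as a vertex of `T / e`: the vertex to which `e` is collapsed. -/
def collVert : e.coll.Vert :=
  ⟨e.low.1, ⟨e.low.2.1, fun h => e.up_ssubset.ne (Set.mem_singleton_iff.mp h).symm⟩, e.low.2.2⟩

/-- The other vertices of `T / e`. -/
def restVert (r : e.Rest) : e.coll.Vert :=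
  ⟨r.1.1, ⟨r.1.2.1, r.2.2⟩, r.1.2.2⟩

/-- The vertices of `T / e` are the collapsed vertex and the other vertices. -/
noncomputable def collVertEquiv : Option e.Rest ≃ e.coll.Vert :=
  Equiv.ofBijective (fun
    | none => e.collVert
    | some r => e.restVert r) (by
    constructor
    · rintro (_ | r) (_ | s) h
      · rfl
      · exact (s.2.1 (congrArg (fun v : e.coll.Vert => v.1) h).symm).elim
      · exact (r.2.1 (congrArg (fun v : e.coll.Vert => v.1) h)).elim
      · have : r.1.1 = s.1.1 := congrArg (fun v : e.coll.Vert => v.1) h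
        exact congrArg some (Subtype.ext (Subtype.ext this))
    · intro v
      by_cases h : v.1 = e.low.1
      · exact ⟨none, Subtype.ext h.symm⟩
      · exact ⟨some ⟨⟨v.1, v.2.1.1, v.2.2⟩, h, v.2.1.2⟩, rfl⟩)

theorem comparable {c d f : Set A} (hc : c ∈ T.clusters) (hd : d ∈ T.clusters)
    (hf : f ∈ T.clusters) (h : f ⊆ c) (h' : f ⊆ d) : c ⊆ d ∨ d ⊂ c := by
  by_cases hcd : c ⊆ d
  · exact .inl hcd
  · rcases T.laminar c hc d hd with h1 | h1 | h1
    · exact .inl h1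
    · exact .inr ⟨h1, hcd⟩
    · obtain ⟨x, hx⟩ := T.nonempty_of_mem f hf
      exact (Set.disjoint_left.mp h1 (h hx) (h' hx)).elim

/-- `i(u ∘ v) = i(u) ∪_v i(v)` for the endpoints `u`, `v` of the collapsed edge. -/
noncomputable def incCollEquiv : e.coll.inc e.collVert ≃ graft (T.inc e.low) e.edge (T.inc e.up) :=
  (Equiv.ofBijective (fun
    | .inl f => ⟨f.1.1, ⟨f.1.2.1, fun h => f.2 (Subtype.ext h)⟩, f.1.2.2.1,
        fun d hd => f.1.2.2.2 d hd.1⟩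
    | .inr f => ⟨f.1, ⟨f.2.1, fun h => f.2.2.1.ne h⟩, f.2.2.1.trans e.up_ssubset,
        fun d hd hfd hdp => by
          rcases comparable e.up.2.1 hd.1 f.2.1 f.2.2.1.1 hfd.1 with h | h
          · exact e.edge.2.2.2 d hd.1 (h.ssubset_of_ne fun h => hd.2 h.symm) hdp
          · exact f.2.2.2 d hd.1 hfd h⟩ :
      graft (T.inc e.low) e.edge (T.inc e.up) → e.coll.inc e.collVert) (by
    constructor
    · rintro (⟨f, hf⟩ | f) (⟨g, hg⟩ | g) h
      · have : f.1 = g.1 := congrArg (fun v : e.coll.inc e.collVert => v.1) h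
        exact congrArg Sum.inl (Subtype.ext (Subtype.ext this))
      · have h1 : f.1 = g.1 := congrArg (fun v : e.coll.inc e.collVert => v.1) h
        exact (f.2.2.2 e.up.1 e.up.2.1 (h1 ▸ g.2.2.1) e.up_ssubset).elim
      · have h1 : f.1 = g.1 := congrArg (fun v : e.coll.inc e.collVert => v.1) h
        exact (g.2.2.2 e.up.1 e.up.2.1 (h1 ▸ f.2.2.1) e.up_ssubset).elim
      · have : f.1 = g.1 := congrArg (fun v : e.coll.inc e.collVert => v.1) h
        exact congrArg Sum.inr (Subtype.ext this)
    · rintro ⟨f, ⟨hf, hne⟩, hfl, hmax⟩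
      have hne' : f ≠ e.up.1 := hne
      by_cases hfu : f ⊆ e.up.1
      · refine ⟨.inr ⟨f, hf, hfu.ssubset_of_ne hne', fun d hd hfd hdu => ?_⟩, rfl⟩
        exact hmax d ⟨hd, hdu.ne⟩ hfd (hdu.trans e.up_ssubset)
      · refine ⟨.inl ⟨⟨f, hf, hfl, fun d hd hfd hdl => ?_⟩,
          fun h => hne' (congrArg Subtype.val h)⟩, rfl⟩
        by_cases hdu : d = e.up.1
        · exact hfu (hdu ▸ hfd.1)
        · exact hmax d ⟨hd, hdu⟩ hfd hdl)).symm

/-- The other vertices have the same incoming edges in `T / e` and in `T`. -/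
noncomputable def incRestEquiv (r : e.Rest) : e.coll.inc (e.restVert r) ≃ T.inc r.1 :=
  (Equiv.refl (Set A)).subtypeEquiv fun f => by
    have hlow : e.up.1 ⊂ r.1.1 → e.low.1 ⊂ r.1.1 := fun h => by
      rcases comparable e.low.2.1 r.1.2.1 e.up.2.1 e.up_ssubset.1 h.1 with h' | h'
      · exact h'.ssubset_of_ne r.2.1.symm
      · exact (e.edge.2.2.2 _ r.1.2.1 h h').elim
    constructor
    · rintro ⟨⟨hf, hfu⟩, hfr, hmax⟩
      refine ⟨hf, hfr, fun d hd hfd hdr => ?_⟩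
      have hdr' : d ⊂ r.1.1 := hdr
      by_cases hdu : d = e.up.1
      · subst hdu
        exact hmax e.low.1 e.collVert.2.1 (hfd.trans e.up_ssubset) (hlow hdr')
      · exact hmax d ⟨hd, hdu⟩ hfd hdr
    · rintro ⟨hf, hfr, hmax⟩
      refine ⟨⟨hf, fun h => ?_⟩, hfr, fun d hd => hmax d hd.1⟩
      have h : f = e.up.1 := h
      subst h
      exact hmax e.low.1 e.low.2.1 e.up_ssubset (hlow hfr)

end InternalEdge

/-! #### Relabelling -/

/-- The tree obtained by relabelling along a bijection. -/
def relabel (σ : A ≃ B) (T : LTree A) : LTree B where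
  clusters := {d | σ ⁻¹' d ∈ T.clusters}
  nonempty_of_mem d hd := by
    obtain ⟨a, ha⟩ := T.nonempty_of_mem _ hd
    exact ⟨σ a, ha⟩
  univ_mem := T.univ_mem
  singleton_mem b := by
    have : σ ⁻¹' {b} = {σ.symm b} := by
      ext a
      simp [Equiv.eq_symm_apply]
    exact (congrArg (· ∈ T.clusters) this).mpr (T.singleton_mem _)
  laminar c hc d hd := by
    have := T.laminar _ hc _ hd
    rwa [σ.surjective.preimage_subset_preimage_iff, σ.surjective.preimage_subset_preimage_iff,
      Set.disjoint_preimage_iff σ.surjective] at this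

theorem nontrivial_preimage (σ : A ≃ B) {d : Set B} : (σ ⁻¹' d).Nontrivial ↔ d.Nontrivial := by
  rw [← Equiv.image_symm_eq_preimage, Set.image_nontrivial σ.symm.injective]

theorem ssubset_preimage (σ : A ≃ B) {c d : Set B} : σ ⁻¹' c ⊂ σ ⁻¹' d ↔ c ⊂ d := by
  simp only [ssubset_iff_subset_not_subset, σ.surjective.preimage_subset_preimage_iff]

/-- The bijection on sets given by preimages. -/
def preimageEquiv (σ : A ≃ B) : Set B ≃ Set A where
  toFun d := σ ⁻¹' d
  invFun c := σ.symm ⁻¹' c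
  left_inv d := by ext; simp
  right_inv c := by ext; simp

/-- The edges of a relabelled tree. -/
def relabelEdge (σ : A ≃ B) (T : LTree A) : (T.relabel σ).Edge ≃ T.Edge :=
  (preimageEquiv σ).subtypeEquiv fun _ => Iff.rfl

/-- The vertices of a relabelled tree. -/
def relabelVert (σ : A ≃ B) (T : LTree A) : (T.relabel σ).Vert ≃ T.Vert :=
  (preimageEquiv σ).subtypeEquiv fun _ => and_congr Iff.rfl (nontrivial_preimage σ).symm

/-- The incoming edges of a vertex of a relabelled tree. -/
def relabelInc (σ : A ≃ B) (T : LTree A) (v : (T.relabel σ).Vert) :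
    T.inc (T.relabelVert σ v) ≃ (T.relabel σ).inc v :=
  ((preimageEquiv σ).subtypeEquiv fun c => by
    refine and_congr Iff.rfl (and_congr (ssubset_preimage σ).symm ⟨fun h d hd hcd hdv => ?_,
      fun h d hd hcd hdv => ?_⟩)
    · obtain ⟨d, rfl⟩ := (preimageEquiv σ).surjective d
      exact h d hd ((ssubset_preimage σ).mp hcd) ((ssubset_preimage σ).mp hdv)
    · exact h (σ ⁻¹' d) hd ((ssubset_preimage σ).mpr hcd) ((ssubset_preimage σ).mpr hdv)).symm

/-! #### Grafting -/

section Graft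

variable {a : A}

/-- The map `A ∪_a B → A` that sends the elements of `B` to `a`. -/
def proj : graft A a B → A
  | .inl x => x.1
  | .inr _ => a

theorem proj_surjective : Function.Surjective (proj : graft A a B → A) := fun x => by
  by_cases h : x = a
  · obtain ⟨b⟩ := B.ne
    exact ⟨.inr b, h.symm⟩
  · exact ⟨.inl ⟨x, h⟩, rfl⟩

/-- The set of labels of `A ∪_a B` that corresponds to a set of labels of `A`: if it contains `a`
then `a` is replaced by the elements of `B`. -/
def liftA (c : Set A) : Set (graft A a B) := proj ⁻¹' c

/-- The set of labels of `A ∪_a B` that corresponds to a set of labels of `B`. -/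
def liftB (d : Set B) : Set (graft A a B) := inB '' d

theorem liftA_subset {c d : Set A} : (liftA c : Set (graft A a B)) ⊆ liftA d ↔ c ⊆ d :=
  proj_surjective.preimage_subset_preimage_iff

theorem liftA_ssubset {c d : Set A} : (liftA c : Set (graft A a B)) ⊂ liftA d ↔ c ⊂ d := by
  simp only [ssubset_iff_subset_not_subset, liftA_subset]

theorem liftA_injective : Function.Injective (liftA : Set A → Set (graft A a B)) :=
  proj_surjective.preimage_injective

theorem inB_injective : Function.Injective (inB : B → graft A a B) := Sum.inr_injective

theorem liftB_injective : Function.Injective (liftB : Set B → Set (graft A a B)) :=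
  inB_injective.image_injective

theorem liftB_subset {c d : Set B} : (liftB c : Set (graft A a B)) ⊆ liftB d ↔ c ⊆ d :=
  Set.image_subset_image_iff inB_injective

theorem liftB_ssubset {c d : Set B} : (liftB c : Set (graft A a B)) ⊂ liftB d ↔ c ⊂ d := by
  simp only [ssubset_iff_subset_not_subset, liftB_subset]

theorem liftB_univ : (liftB Set.univ : Set (graft A a B)) = liftA {a} := by
  ext (x | b)
  · exact iff_of_false (by rintro ⟨b, _, h⟩; exact Sum.inr_ne_inl h) x.2
  · exact iff_of_true ⟨b, trivial, rfl⟩ rfl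

theorem liftB_subset_liftA {d : Set B} {c : Set A} (hd : d.Nonempty) :
    (liftB d : Set (graft A a B)) ⊆ liftA c ↔ a ∈ c := by
  constructor
  · intro h
    obtain ⟨b, hb⟩ := hd
    exact h ⟨b, hb, rfl⟩
  · rintro h _ ⟨b, _, rfl⟩
    exact h

theorem liftA_subset_liftB {d : Set B} {c : Set A} (hc : c.Nonempty)
    (h : (liftA c : Set (graft A a B)) ⊆ liftB d) : c = {a} ∧ d = Set.univ := by
  have h1 : c = {a} := by
    refine Set.Nonempty.subset_singleton_iff hc |>.mp ?_
    rw [← liftA_subset (B := B) (a := a), ← liftB_univ]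
    exact h.trans (liftB_subset.mpr (Set.subset_univ d))
  subst h1
  rw [← liftB_univ, liftB_subset] at h
  exact ⟨rfl, Set.univ_subset_iff.mp h⟩

/-- The tree `T ∪_a U` obtained by grafting `U` onto `T` at the leaf `a`: the root edge of `U` is
identified with the leaf edge `a` of `T`. -/
def graft (T : LTree A) (a : A) (U : LTree B) : LTree (NEFin.graft A a B) where
  clusters := liftA '' T.clusters ∪ liftB '' U.clusters
  nonempty_of_mem := by
    rintro _ (⟨c, hc, rfl⟩ | ⟨d, hd, rfl⟩)
    · exact (T.nonempty_of_mem c hc).preimage proj_surjective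
    · exact (U.nonempty_of_mem d hd).image _
  univ_mem := .inl ⟨_, T.univ_mem, rfl⟩
  singleton_mem := by
    rintro (⟨x, hx⟩ | b)
    · refine .inl ⟨{x}, T.singleton_mem x, ?_⟩
      ext (⟨y, hy⟩ | b)
      · exact ⟨fun h => congrArg Sum.inl (Subtype.ext h),
          fun h => congrArg Subtype.val (Sum.inl_injective h)⟩
      · exact iff_of_false (fun h => hx (Eq.symm h)) Sum.inr_ne_inl
    · exact .inr ⟨{b}, U.singleton_mem b, Set.image_singleton⟩
  laminar := by
    have key : ∀ c ∈ T.clusters, ∀ d ∈ U.clusters,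
        (liftB d : Set (NEFin.graft A a B)) ⊆ liftA c ∨
          Disjoint (liftB d : Set (NEFin.graft A a B)) (liftA c) := fun c hc d hd => by
      by_cases h : a ∈ c
      · exact .inl ((liftB_subset_liftA (U.nonempty_of_mem d hd)).mpr h)
      · refine .inr (Set.disjoint_left.mpr ?_)
        rintro _ ⟨b, _, rfl⟩
        exact h
    rintro _ (⟨c, hc, rfl⟩ | ⟨c, hc, rfl⟩) _ (⟨d, hd, rfl⟩ | ⟨d, hd, rfl⟩)
    · simp only [liftA_subset]
      rcases T.laminar c hc d hd with h | h | h
      · exact .inl h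
      · exact .inr (.inl h)
      · exact .inr (.inr (h.preimage _))
    · rcases key c hc d hd with h | h
      · exact .inr (.inl h)
      · exact .inr (.inr h.symm)
    · rcases key d hd c hc with h | h
      · exact .inl h
      · exact .inr (.inr h)
    · simp only [liftB_subset]
      rcases U.laminar c hc d hd with h | h | h
      · exact .inl h
      · exact .inr (.inl h)
      · exact .inr (.inr ((Set.disjoint_image_iff inB_injective).mpr h))

variable (T : LTree A) (U : LTree B)

theorem liftA_mem {c : Set A} (h : c ∈ T.clusters) : liftA c ∈ (T.graft a U).clusters :=
  .inl ⟨c, h, rfl⟩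

theorem liftB_mem {d : Set B} (h : d ∈ U.clusters) : liftB d ∈ (T.graft a U).clusters :=
  .inr ⟨d, h, rfl⟩

theorem nontrivial_liftA {c : Set A} (h : c.Nontrivial) :
    (liftA c : Set (NEFin.graft A a B)).Nontrivial := h.preimage proj_surjective

theorem nontrivial_liftB {d : Set B} (h : d.Nontrivial) :
    (liftB d : Set (NEFin.graft A a B)).Nontrivial := h.image inB_injective

/-- The vertices of `T ∪_a U` are the vertices of `T` and the vertices of `U`. -/
noncomputable def graftVert (a : A) : T.Vert ⊕ U.Vert ≃ (T.graft a U).Vert :=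
  Equiv.ofBijective (fun
    | .inl v => ⟨liftA v.1, liftA_mem T U v.2.1, nontrivial_liftA v.2.2⟩
    | .inr v => ⟨liftB v.1, liftB_mem T U v.2.1, nontrivial_liftB v.2.2⟩) (by
    have key : ∀ (v : T.Vert) (w : U.Vert), (liftA v.1 : Set (NEFin.graft A a B)) ≠ liftB w.1 :=
      fun v w h => by
        obtain ⟨h1, -⟩ := liftA_subset_liftB v.2.2.nonempty h.subset
        exact Set.not_nontrivial_singleton (h1 ▸ v.2.2)
    constructor
    · rintro (v | v) (w | w) h
      · exact congrArg Sum.inl (Subtype.ext (liftA_injective (congrArg Subtype.val h)))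
      · exact (key v w (congrArg Subtype.val h)).elim
      · exact (key w v (congrArg Subtype.val h).symm).elim
      · exact congrArg Sum.inr (Subtype.ext (liftB_injective (congrArg Subtype.val h)))
    · rintro ⟨_, ⟨c, hc, rfl⟩ | ⟨d, hd, rfl⟩, hn⟩
      · by_cases h : c.Nontrivial
        · exact ⟨.inl ⟨c, hc, h⟩, rfl⟩
        · obtain ⟨x, rfl⟩ := ((T.nonempty_of_mem c hc).exists_eq_singleton_or_nontrivial).resolve_right h
          by_cases hx : x = a
          · subst hx
            have hn' : (liftB Set.univ : Set (NEFin.graft A x B)).Nontrivial := liftB_univ ▸ hn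
            exact ⟨.inr ⟨Set.univ, U.univ_mem, (Set.image_nontrivial inB_injective).mp hn'⟩, Subtype.ext liftB_univ⟩
          · exfalso
            obtain ⟨y, hy, z, hz, hyz⟩ := hn
            rcases y with y | y
            · rcases z with z | z
              · exact hyz (congrArg Sum.inl (Subtype.ext (Eq.trans hy (Eq.symm hz))))
              · exact hx (Eq.symm hz)
            · exact hx (Eq.symm hy)
      · exact ⟨.inr ⟨d, hd, (Set.image_nontrivial inB_injective).mp hn⟩, rfl⟩)

/-- The incoming edges in `T ∪_a U` of a vertex of `T`. -/
noncomputable def graftIncA (a : A) (v : T.Vert) :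
    T.inc v ≃ (T.graft a U).inc (T.graftVert U a (.inl v)) :=
  Equiv.ofBijective (fun c => ⟨liftA c.1, liftA_mem T U c.2.1, liftA_ssubset.mpr c.2.2.1, by
      rintro _ (⟨d, hd, rfl⟩ | ⟨d, hd, rfl⟩) h h'
      · exact c.2.2.2 d hd (liftA_ssubset.mp h) (liftA_ssubset.mp h')
      · obtain ⟨h1, rfl⟩ := liftA_subset_liftB (T.nonempty_of_mem _ c.2.1) h.1
        rw [h1, liftB_univ] at h
        exact h.2 subset_rfl⟩) (by
    constructor
    · intro c d h
      exact Subtype.ext (liftA_injective (congrArg Subtype.val h))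
    · rintro ⟨_, ⟨c, hc, rfl⟩ | ⟨d, hd, rfl⟩, hlt, hmax⟩
      · exact ⟨⟨c, hc, liftA_ssubset.mp hlt, fun d hd h h' => hmax _ (liftA_mem T U hd)
          (liftA_ssubset.mpr h) (liftA_ssubset.mpr h')⟩, rfl⟩
      · have ha : a ∈ v.1 := (liftB_subset_liftA (U.nonempty_of_mem d hd)).mp hlt.1
        have hav : ({a} : Set A) ⊂ v.1 := by
          refine ⟨by simpa using ha, fun h => ?_⟩
          exact (Set.not_nontrivial_singleton (v.2.2.mono h))
        have hd' : d = Set.univ := by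
          by_contra hne
          exact hmax (liftA {a}) (liftA_mem T U (T.singleton_mem a))
            (liftB_univ ▸ liftB_ssubset.mpr ((Set.ssubset_univ_iff).mpr hne))
            (liftA_ssubset.mpr hav)
        subst hd'
        refine ⟨⟨{a}, T.singleton_mem a, hav, fun d hd h h' => ?_⟩, Subtype.ext liftB_univ.symm⟩
        exact hmax _ (liftA_mem T U hd) (liftB_univ ▸ liftA_ssubset.mpr h)
          (liftA_ssubset.mpr h'))

/-- The incoming edges in `T ∪_a U` of a vertex of `U`. -/
noncomputable def graftIncB (a : A) (v : U.Vert) :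
    U.inc v ≃ (T.graft a U).inc (T.graftVert U a (.inr v)) :=
  Equiv.ofBijective (fun c => ⟨liftB c.1, liftB_mem T U c.2.1, liftB_ssubset.mpr c.2.2.1, by
      rintro _ (⟨d, hd, rfl⟩ | ⟨d, hd, rfl⟩) h h'
      · obtain ⟨-, h2⟩ := liftA_subset_liftB (T.nonempty_of_mem _ hd) h'.1
        obtain ⟨rfl, -⟩ := liftA_subset_liftB (T.nonempty_of_mem _ hd) h'.1
        change (liftA {a} : Set (NEFin.graft A a B)) ⊂ liftB v.1 at h'
        rw [h2, liftB_univ] at h'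
        exact h'.2 subset_rfl
      · exact c.2.2.2 d hd (liftB_ssubset.mp h) (liftB_ssubset.mp h')⟩) (by
    constructor
    · intro c d h
      exact Subtype.ext (liftB_injective (congrArg Subtype.val h))
    · rintro ⟨_, ⟨c, hc, rfl⟩ | ⟨d, hd, rfl⟩, hlt, hmax⟩
      · exfalso
        have hlt' : (liftA c : Set (NEFin.graft A a B)) ⊂ liftB v.1 := hlt
        obtain ⟨rfl, h2⟩ := liftA_subset_liftB (T.nonempty_of_mem _ hc) hlt'.1
        rw [h2, liftB_univ] at hlt'
        exact hlt'.2 subset_rfl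
      · exact ⟨⟨d, hd, liftB_ssubset.mp hlt, fun c hc h h' => hmax _ (liftB_mem T U hc)
          (liftB_ssubset.mpr h) (liftB_ssubset.mpr h')⟩, rfl⟩)

end Graft


/-! #### Weightings -/

noncomputable instance (T : LTree A) : Fintype T.Edge := Fintype.ofFinite _

open Classical in
/-- The total length of the edges between the root and the leaf `a`, for given edge lengths. -/
noncomputable def dist (T : LTree A) (f : T.Edge → unitInterval) (a : A) : ℝ :=
  ∑ e : T.Edge, if a ∈ e.1 then (f e : ℝ) else 0

/-- The space `w(T)` of weightings: edge lengths for which the distance from the root to each leaf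
is `1`. -/
abbrev Weighting (T : LTree A) : Type := {f : T.Edge → unitInterval // ∀ a, T.dist f a = 1}

theorem continuous_dist (T : LTree A) (a : A) : Continuous fun f => T.dist f a := by
  unfold dist
  refine continuous_finsetSum _ fun e _ => ?_
  split_ifs
  · exact continuous_subtype_val.comp (continuous_apply e)
  · exact continuous_const

instance (T : LTree A) : CompactSpace T.Weighting :=
  isCompact_iff_compactSpace.mp (IsClosed.isCompact (by
    have := isClosed_iInter fun a => isClosed_eq (T.continuous_dist a)
      (continuous_const (y := (1 : ℝ)))
    have heq : {f | ∀ a, T.dist f a = 1} = ⋂ a, {f | T.dist f a = 1} := by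
      ext f
      simp
    rw [← heq] at this
    exact this))

/-- The root edge. -/
def rootEdge (T : LTree A) : T.Edge := ⟨Set.univ, T.univ_mem⟩

/-- The leaf edge of the leaf `a`. -/
def leafEdge (T : LTree A) (a : A) : T.Edge := ⟨{a}, T.singleton_mem a⟩

/-- The set `w₀(T)` of weightings for which the root edge or some leaf edge has length `0`. -/
def zeroSet (T : LTree A) : Set T.Weighting :=
  {f | f.1 T.rootEdge = 0 ∨ ∃ a, f.1 (T.leafEdge a) = 0}

theorem isClosed_zeroSet (T : LTree A) : IsClosed T.zeroSet := by
  have hc : ∀ e : T.Edge, IsClosed {f : T.Weighting | f.1 e = 0} := fun e =>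
    isClosed_eq ((continuous_apply e).comp continuous_subtype_val) continuous_const
  have := (hc T.rootEdge).union (isClosed_iUnion_of_finite fun a => hc (T.leafEdge a))
  convert this
  ext f
  simp [zeroSet]

/-- The based space `w(T) / w₀(T)`, where the quotient by the empty set adjoins a disjoint
basepoint. -/
def wbar (T : LTree A) : BasedTop :=
  BasedTop.quot (T.Weighting ⊕ Unit) (Sum.inl '' T.zeroSet ∪ {.inr ()})
    ((IsClosedEmbedding.inl.isClosedMap _ T.isClosed_zeroSet).union isClosed_singleton) (.inr ())

/-- The point of `wbar T` given by a weighting. -/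
def wmk {T : LTree A} (x : T.Weighting) : T.wbar := Quotient.mk (collapseSetoid _) (.inl x)

theorem wmk_eq_pt {T : LTree A} {x : T.Weighting} (h : x ∈ T.zeroSet) : wmk x = T.wbar.pt :=
  Collapse.mk_eq_iff.mpr (.inr ⟨.inl ⟨x, h, rfl⟩, .inr rfl⟩)

theorem continuous_wmk {T : LTree A} : Continuous (wmk : T.Weighting → T.wbar) :=
  (isQuotientMap_quotient_mk' (s := collapseSetoid _)).continuous.comp continuous_inl

theorem wbar_ind {T : LTree A} {p : T.wbar → Prop} (h : ∀ x, p (wmk x)) (h' : p T.wbar.pt)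
    (z : T.wbar) : p z :=
  Quotient.ind (fun | .inl x => h x | .inr () => h') z

/-- Based maps out of `wbar T`. -/
def wbarLift {T : LTree A} {Z : BasedTop} (f : T.Weighting → Z) (hf : Continuous f)
    (h : ∀ x ∈ T.zeroSet, f x = Z.pt) : T.wbar ⟶ Z where
  toFun := Quotient.lift (Sum.elim f fun _ => Z.pt) (by
    have key : ∀ p ∈ (Sum.inl '' T.zeroSet ∪ {.inr ()} : Set (T.Weighting ⊕ Unit)),
        Sum.elim f (fun _ => Z.pt) p = Z.pt := by
      rintro _ (⟨x, hx, rfl⟩ | rfl)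
      · exact h x hx
      · rfl
    rintro p q (rfl | ⟨hp, hq⟩)
    · rfl
    · rw [key p hp, key q hq])
  cont := (isQuotientMap_quotient_mk' (s := collapseSetoid _)).continuous_iff.mpr
    (hf.sumElim continuous_const)
  map_pt := rfl

@[simp] theorem wbarLift_wmk {T : LTree A} {Z : BasedTop} (f : T.Weighting → Z) (hf h)
    (x : T.Weighting) : wbarLift f hf h (wmk x) = f x := rfl

theorem wbar_hom_ext {T : LTree A} {Z : BasedTop} {f g : T.wbar ⟶ Z}
    (h : ∀ x, f (wmk x) = g (wmk x)) : f = g :=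
  BasedTop.hom_ext (wbar_ind h (by simp))

open Classical in
/-- Edge lengths of `T'` that are those of `T` on the edges of `T` and `0` on the collapsed edges. -/
noncomputable def extendFun {T : LTree A} (T' : LTree A) (f : T.Edge → unitInterval)
    (e : T'.Edge) : unitInterval :=
  if h : e.1 ∈ T.clusters then f ⟨e.1, h⟩ else 0

theorem dist_extendFun {T T' : LTree A} (h : T ≤ T') (f : T.Edge → unitInterval) (a : A) :
    T'.dist (extendFun T' f) a = T.dist f a := by
  classical
  unfold dist
  symm
  refine Finset.sum_of_injOn (fun e => ⟨e.1, h e.2⟩) ?_ ?_ ?_ ?_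
  · intro e _ e' _ he
    exact Subtype.ext (congrArg (fun e : T'.Edge => e.1) he)
  · simp
  · intro e _ he
    have : e.1 ∉ T.clusters := fun h => he ⟨⟨e.1, h⟩, by simp, rfl⟩
    simp [extendFun, this]
  · rintro ⟨e, he⟩ -
    simp [extendFun, he]

/-- The inclusion `w(T) → w(T')` for `T ≤ T'`. -/
noncomputable def extend {T T' : LTree A} (h : T ≤ T') (x : T.Weighting) : T'.Weighting :=
  ⟨extendFun T' x.1, fun a => (dist_extendFun h x.1 a).trans (x.2 a)⟩

theorem continuous_extend {T T' : LTree A} (h : T ≤ T') : Continuous (extend h) := by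
  refine Continuous.subtype_mk (continuous_pi fun e => ?_) _
  unfold extendFun
  split_ifs
  · exact (continuous_apply _).comp continuous_subtype_val
  · exact continuous_const

theorem extend_mem_zeroSet {T T' : LTree A} (h : T ≤ T') {x : T.Weighting} (hx : x ∈ T.zeroSet) :
    extend h x ∈ T'.zeroSet := by
  rcases hx with hx | ⟨a, hx⟩
  · exact .inl ((dif_pos T.univ_mem).trans hx)
  · exact .inr ⟨a, (dif_pos (T.singleton_mem a)).trans hx⟩

variable (A) in
/-- The functor `T ↦ wbar T` on the poset of `A`-labelled trees. -/
noncomputable def wbarFunctor : LTree A ⥤ BasedTop where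
  obj := wbar
  map f := wbarLift (fun x => wmk (extend (leOfHom f) x))
    (continuous_wmk.comp (continuous_extend _)) fun _ hx => wmk_eq_pt (extend_mem_zeroSet _ hx)
  map_id T := wbar_hom_ext fun x => congrArg wmk (Subtype.ext (funext fun e => dif_pos e.2))
  map_comp {T T' T''} f g := wbar_hom_ext fun x => congrArg wmk (Subtype.ext (funext fun e => by
    by_cases h : e.1 ∈ T.clusters
    · have h' : e.1 ∈ T'.clusters := leOfHom f h
      simp [extend, extendFun, h, h']
    · simp [extend, extendFun, h]))

/-! The map induced by a relabelling. -/

theorem dist_relabel (σ : A ≃ B) (T : LTree A) (f : (T.relabel σ).Edge → unitInterval) (a : A) :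
    T.dist (fun e => f ((T.relabelEdge σ).symm e)) a = (T.relabel σ).dist f (σ a) := by
  classical
  unfold dist
  refine Fintype.sum_equiv (T.relabelEdge σ).symm _ _ fun e => ?_
  have : σ a ∈ ((T.relabelEdge σ).symm e).1 ↔ a ∈ e.1 := by
    obtain ⟨e, rfl⟩ := (T.relabelEdge σ).surjective e
    rw [Equiv.symm_apply_apply]
    rfl
  simp [this]

/-- The bijection between weightings of a tree and of its relabelling, from right to left. -/
def unrelabel (σ : A ≃ B) (T : LTree A) (x : (T.relabel σ).Weighting) : T.Weighting :=
  ⟨fun e => x.1 ((T.relabelEdge σ).symm e), fun a => (dist_relabel σ T x.1 a).trans (x.2 _)⟩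

/-- The map `wbar (σ T) ⟶ wbar T` that gives the edges of `T` the lengths of the corresponding
edges of the relabelled tree. -/
def wbarRelabel (σ : A ≃ B) (T : LTree A) : (T.relabel σ).wbar ⟶ T.wbar :=
  wbarLift (fun x => wmk (unrelabel σ T x))
    (continuous_wmk.comp (Continuous.subtype_mk (f := fun (x : (T.relabel σ).Weighting) e =>
      x.1 ((T.relabelEdge σ).symm e))
      (continuous_pi fun e => (continuous_apply _).comp continuous_subtype_val) _)) (by
    intro x hx
    refine wmk_eq_pt ?_
    rcases hx with hx | ⟨b, hx⟩
    · exact .inl hx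
    · refine .inr ⟨σ.symm b, ?_⟩
      have : (T.relabelEdge σ).symm (T.leafEdge (σ.symm b)) = (T.relabel σ).leafEdge b := by
        rw [Equiv.symm_apply_eq]
        refine Subtype.ext ?_
        ext a
        exact Equiv.eq_symm_apply σ
      exact (congrArg x.1 this).trans hx)

/-! The map `wbar (T ∪_a U) ⟶ wbar T ∧ wbar U`. -/

section Ungraft

variable (T : LTree A) (a : A) (U : LTree B)

/-- The weightings `t` of `T` and `u` of `U` are obtained from the weighting `x` of `T ∪_a U` by
ungrafting: the edges of `T` other than the leaf edge `a` have the same length for `t` and for `x`,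
and the lengths of the edges of `U` for `x` are those for `u`, scaled by the length for `t` of the
leaf edge `a`. -/
def IsUngrafting (x : (T.graft a U).Weighting) (t : T.Weighting) (u : U.Weighting) : Prop :=
  (∀ c : T.Edge, c.1 ≠ {a} → t.1 c = x.1 ⟨liftA c.1, liftA_mem T U c.2⟩) ∧
    ∀ d : U.Edge, x.1 ⟨liftB d.1, liftB_mem T U d.2⟩ = t.1 (T.leafEdge a) * u.1 d

variable {T a U}

open Classical in
theorem dist_eq (t : T.Edge → unitInterval) (x : A) :
    T.dist t x = (∑ c : {c : T.Edge // c.1 ≠ {a}}, if x ∈ c.1.1 then (t c.1 : ℝ) else 0) +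
      if x = a then (t (T.leafEdge a) : ℝ) else 0 := by
  unfold dist
  rw [← Fintype.sum_subtype_add_sum_subtype (fun c : T.Edge => c.1 ≠ {a})]
  congr 1
  have : Unique {c : T.Edge // ¬ c.1 ≠ {a}} :=
    ⟨⟨⟨T.leafEdge a, fun h => h rfl⟩⟩, fun c => Subtype.ext (Subtype.ext (not_not.mp c.2))⟩
  rw [Fintype.sum_unique]
  have hd : (default : {c : T.Edge // ¬ c.1 ≠ {a}}).1 = T.leafEdge a :=
    Subtype.ext (not_not.mp (default : {c : T.Edge // ¬ c.1 ≠ {a}}).2)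
  rw [hd]
  exact if_congr Iff.rfl rfl rfl

/-- The edges of `T ∪_a U`. -/
noncomputable def graftEdge : {c : T.Edge // c.1 ≠ {a}} ⊕ U.Edge ≃ (T.graft a U).Edge :=
  Equiv.ofBijective (fun
    | .inl c => ⟨liftA c.1.1, liftA_mem T U c.1.2⟩
    | .inr d => ⟨liftB d.1, liftB_mem T U d.2⟩) (by
    have key : ∀ (c : {c : T.Edge // c.1 ≠ {a}}) (d : U.Edge),
        (liftA c.1.1 : Set (NEFin.graft A a B)) ≠ liftB d.1 := fun c d h =>
      c.2 (liftA_subset_liftB (T.nonempty_of_mem _ c.1.2) h.subset).1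
    constructor
    · rintro (c | c) (d | d) h
      · exact congrArg Sum.inl (Subtype.ext (Subtype.ext
          (liftA_injective (congrArg Subtype.val h))))
      · exact (key c d (congrArg Subtype.val h)).elim
      · exact (key d c (congrArg Subtype.val h).symm).elim
      · exact congrArg Sum.inr (Subtype.ext (liftB_injective (congrArg Subtype.val h)))
    · rintro ⟨_, ⟨c, hc, rfl⟩ | ⟨d, hd, rfl⟩⟩
      · by_cases h : c = {a}
        · subst h
          exact ⟨.inr U.rootEdge, Subtype.ext liftB_univ⟩
        · exact ⟨.inl ⟨⟨c, hc⟩, h⟩, rfl⟩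
      · exact ⟨.inr ⟨d, hd⟩, rfl⟩)

open Classical in
theorem dist_graft (x : (T.graft a U).Edge → unitInterval) (z : NEFin.graft A a B) :
    (T.graft a U).dist x z =
      (∑ c : {c : T.Edge // c.1 ≠ {a}},
        if proj z ∈ c.1.1 then (x (graftEdge (.inl c)) : ℝ) else 0) +
      ∑ d : U.Edge, if z ∈ liftB d.1 then (x (graftEdge (.inr d)) : ℝ) else 0 := by
  unfold dist
  rw [← Fintype.sum_equiv graftEdge _ _ (fun _ => rfl), Fintype.sum_sum_type]
  rfl

open Classical in
theorem dist_graft_inB (x : (T.graft a U).Edge → unitInterval) (b : B) :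
    (T.graft a U).dist x (inB b) =
      (∑ c : {c : T.Edge // c.1 ≠ {a}},
        if a ∈ c.1.1 then (x (graftEdge (.inl c)) : ℝ) else 0) +
      U.dist (fun d => x (graftEdge (.inr d))) b := by
  rw [dist_graft]
  unfold dist
  congr 1
  refine Finset.sum_congr rfl fun d _ => ?_
  have : (inB b : NEFin.graft A a B) ∈ liftB d.1 ↔ b ∈ d.1 := inB_injective.mem_set_image
  simp [this]

open Classical in
theorem dist_graft_inA (x : (T.graft a U).Edge → unitInterval) (y : A) (hy : y ≠ a) :
    (T.graft a U).dist x (inA y hy) =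
      ∑ c : {c : T.Edge // c.1 ≠ {a}},
        if y ∈ c.1.1 then (x (graftEdge (.inl c)) : ℝ) else 0 := by
  refine (dist_graft x _).trans ?_
  refine (congrArg (_ + ·) ?_).trans (add_zero _)
  refine Finset.sum_eq_zero fun d _ => if_neg ?_
  rintro ⟨b, _, h⟩
  exact Sum.inr_ne_inl h

theorem le_dist (f : U.Edge → unitInterval) (d : U.Edge) {b : B} (hb : b ∈ d.1) :
    (f d : ℝ) ≤ U.dist f b := by
  classical
  unfold dist
  have := Finset.single_le_sum (f := fun e : U.Edge => if b ∈ e.1 then (f e : ℝ) else 0)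
    (fun e _ => by
      split_ifs
      · exact (f e).2.1
      · exact le_rfl) (Finset.mem_univ d)
  simpa [hb] using this

theorem dist_nonneg (f : U.Edge → unitInterval) (b : B) : 0 ≤ U.dist f b := by
  classical
  refine Finset.sum_nonneg fun e _ => ?_
  split_ifs
  · exact (f e).2.1
  · exact le_rfl

theorem exists_weighting (U : LTree B) : ∃ u : U.Weighting, u.1 U.rootEdge = 1 := by
  classical
  refine ⟨⟨fun d => if d = U.rootEdge then 1 else 0, fun b => ?_⟩, if_pos rfl⟩
  unfold dist
  rw [Finset.sum_eq_single U.rootEdge]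
  · simp [rootEdge]
  · intro d _ h
    simp [h]
  · simp

theorem exists_isUngrafting (x : (T.graft a U).Weighting) : ∃ t u, IsUngrafting T a U x t u := by
  classical
  let xU : U.Edge → unitInterval := fun d => x.1 (graftEdge (.inr d))
  obtain ⟨b₀⟩ := B.ne
  have h₁ := fun b : B => (dist_graft_inB x.1 b).symm.trans (x.2 (inB b))
  have hL : ∀ b, U.dist xU b = U.dist xU b₀ := fun b =>
    add_left_cancel ((h₁ b).trans (h₁ b₀).symm)
  have hL1 : U.dist xU b₀ ≤ 1 := by
    rw [← h₁ b₀]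
    refine le_add_of_nonneg_left (Finset.sum_nonneg fun c _ => ?_)
    split_ifs
    · exact (x.1 _).2.1
    · exact le_rfl
  have hle : ∀ d, (xU d : ℝ) ≤ U.dist xU b₀ := fun d => by
    obtain ⟨b, hb⟩ := U.nonempty_of_mem d.1 d.2
    exact (le_dist xU d hb).trans_eq (hL b)
  let t : T.Edge → unitInterval := fun c =>
    if h : c.1 ≠ {a} then x.1 (graftEdge (.inl ⟨c, h⟩)) else ⟨_, dist_nonneg xU b₀, hL1⟩
  have ht : ∀ c : {c : T.Edge // c.1 ≠ {a}}, t c.1 = x.1 (graftEdge (.inl c)) :=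
    fun c => dif_pos c.2
  have hta : (t (T.leafEdge a) : ℝ) = U.dist xU b₀ :=
    congrArg Subtype.val (dif_neg (fun h => h rfl))
  have htw : ∀ y, T.dist t y = 1 := fun y => by
    rw [dist_eq (a := a)]
    simp only [ht, hta]
    by_cases hy : y = a
    · subst hy
      rw [if_pos rfl]
      exact h₁ b₀
    · rw [if_neg hy, add_zero]
      exact (dist_graft_inA x.1 y hy).symm.trans (x.2 _)
  refine ⟨⟨t, htw⟩, ?_⟩
  suffices h : ∃ u : U.Weighting, ∀ d, (xU d : ℝ) = U.dist xU b₀ * (u.1 d : ℝ) by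
    obtain ⟨u, hu⟩ := h
    refine ⟨u, fun c hc => ht ⟨c, hc⟩, fun d => Subtype.ext ?_⟩
    exact (hu d).trans (congrArg (· * (u.1 d : ℝ)) hta.symm)
  rcases (dist_nonneg xU b₀).eq_or_lt with h0 | h0
  · obtain ⟨u, -⟩ := exists_weighting U
    refine ⟨u, fun d => ?_⟩
    rw [← h0, zero_mul]
    exact le_antisymm ((hle d).trans h0.ge) (xU d).2.1
  · refine ⟨⟨fun d => ⟨xU d / U.dist xU b₀, div_nonneg (xU d).2.1 h0.le,
      (div_le_one h0).mpr (hle d)⟩, fun b => ?_⟩, fun d => ?_⟩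
    · have : U.dist (fun d => ⟨xU d / U.dist xU b₀, div_nonneg (xU d).2.1 h0.le,
          (div_le_one h0).mpr (hle d)⟩) b = U.dist xU b / U.dist xU b₀ := by
        conv_rhs => rw [dist]
        conv_lhs => rw [dist]
        rw [Finset.sum_div]
        refine Finset.sum_congr rfl fun e _ => ?_
        split_ifs
        · rfl
        · exact (zero_div _).symm
      rw [this, hL, div_self h0.ne']
    · exact (mul_div_cancel₀ _ h0.ne').symm

theorem IsUngrafting.unique {x : (T.graft a U).Weighting} {t t' : T.Weighting} {u u' : U.Weighting}
    (h : IsUngrafting T a U x t u) (h' : IsUngrafting T a U x t' u') :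
    BasedTop.smk (wmk t) (wmk u) = BasedTop.smk (wmk t') (wmk u') := by
  classical
  have ha : t.1 (T.leafEdge a) = t'.1 (T.leafEdge a) := by
    have h1 := (dist_eq (a := a) t.1 a).symm.trans (t.2 a)
    have h2 := (dist_eq (a := a) t'.1 a).symm.trans (t'.2 a)
    have h3 : ∀ c : {c : T.Edge // c.1 ≠ {a}}, t.1 c.1 = t'.1 c.1 :=
      fun c => (h.1 c.1 c.2).trans (h'.1 c.1 c.2).symm
    simp only [h3, if_true] at h1 h2
    exact Subtype.ext (add_left_cancel (h1.trans h2.symm))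
  have ht : t = t' := by
    refine Subtype.ext (funext fun c => ?_)
    by_cases hc : c.1 = {a}
    · have : c = T.leafEdge a := Subtype.ext hc
      rw [this, ha]
    · exact (h.1 c hc).trans (h'.1 c hc).symm
  subst ht
  by_cases h0 : t.1 (T.leafEdge a) = 0
  · rw [wmk_eq_pt (.inr ⟨a, h0⟩), BasedTop.smk_pt_left, BasedTop.smk_pt_left]
  · have hu : u = u' := by
      refine Subtype.ext (funext fun d => Subtype.ext ?_)
      have h1 := congrArg Subtype.val ((h.2 d).symm.trans (h'.2 d))
      exact mul_left_cancel₀ (fun e => h0 (Subtype.ext e)) h1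
    rw [hu]

theorem isClosed_isUngrafting : IsClosed
    {p : (T.graft a U).Weighting × (T.Weighting × U.Weighting) |
      IsUngrafting T a U p.1 p.2.1 p.2.2} := by
  have hx : ∀ e, Continuous fun p : (T.graft a U).Weighting × (T.Weighting × U.Weighting) =>
      p.1.1 e := fun e =>
    (continuous_apply e).comp (continuous_subtype_val.comp continuous_fst)
  have ht : ∀ e, Continuous fun p : (T.graft a U).Weighting × (T.Weighting × U.Weighting) =>
      p.2.1.1 e := fun e =>
    (continuous_apply e).comp (continuous_subtype_val.comp (continuous_fst.comp continuous_snd))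
  have hu : ∀ e, Continuous fun p : (T.graft a U).Weighting × (T.Weighting × U.Weighting) =>
      p.2.2.1 e := fun e =>
    (continuous_apply e).comp (continuous_subtype_val.comp (continuous_snd.comp continuous_snd))
  have h1 := isClosed_iInter fun c : T.Edge => isClosed_iInter fun _ : c.1 ≠ {a} =>
    isClosed_eq (ht c) (hx ⟨liftA c.1, liftA_mem T U c.2⟩)
  have h2 := isClosed_iInter fun d : U.Edge =>
    isClosed_eq (hx ⟨liftB d.1, liftB_mem T U d.2⟩) ((ht (T.leafEdge a)).mul (hu d))
  convert h1.inter h2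
  ext p
  simp [IsUngrafting]

variable (T a U)

/-- The point of `wbar T ∧ wbar U` given by an ungrafting of a weighting. -/
noncomputable def ungraftFun (x : (T.graft a U).Weighting) : BasedTop.smash T.wbar U.wbar :=
  BasedTop.smk (wmk (exists_isUngrafting x).choose)
    (wmk (exists_isUngrafting x).choose_spec.choose)

theorem ungraftFun_eq {x : (T.graft a U).Weighting} {t : T.Weighting} {u : U.Weighting}
    (h : IsUngrafting T a U x t u) : ungraftFun T a U x = BasedTop.smk (wmk t) (wmk u) :=
  (exists_isUngrafting x).choose_spec.choose_spec.unique h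

theorem continuous_ungraftFun : Continuous (ungraftFun T a U) := by
  let G := {p : (T.graft a U).Weighting × (T.Weighting × U.Weighting) |
      IsUngrafting T a U p.1 p.2.1 p.2.2}
  have : CompactSpace G := isCompact_iff_compactSpace.mp isClosed_isUngrafting.isCompact
  have hq : IsQuotientMap (fun p : G => p.1.1) := by
    refine IsClosedMap.isQuotientMap ?_ ?_ ?_
    · exact Continuous.isClosedMap (by fun_prop)
    · fun_prop
    · intro x
      obtain ⟨t, u, h⟩ := exists_isUngrafting x
      exact ⟨⟨(x, t, u), h⟩, rfl⟩
  rw [hq.continuous_iff]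
  have hc : Continuous fun p : T.Weighting × U.Weighting =>
      (BasedTop.smk (wmk p.1) (wmk p.2) : BasedTop.smash T.wbar U.wbar) :=
    continuous_iff_kcont.mpr (BasedTop.kcont_smk.comp
      ((continuous_wmk.comp continuous_fst).prodMk
        (continuous_wmk.comp continuous_snd)).continuousGeneratedBy)
  have : ungraftFun T a U ∘ (fun p : G => p.1.1) =
      fun p : G => BasedTop.smk (wmk p.1.2.1) (wmk p.1.2.2) :=
    funext fun p => ungraftFun_eq T a U p.2
  rw [this]
  exact hc.comp (continuous_snd.comp continuous_subtype_val)

/-- The map `wbar (T ∪_a U) ⟶ wbar T ∧ wbar U` given by ungrafting weightings. -/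
noncomputable def wbarUngraft : (T.graft a U).wbar ⟶ T.wbar ⊗ U.wbar :=
  wbarLift (ungraftFun T a U) (continuous_ungraftFun T a U) (by
    intro x hx
    obtain ⟨t, u, h⟩ := exists_isUngrafting x
    rw [ungraftFun_eq T a U h]
    have hroot : a ∈ (Set.univ : Set A) := trivial
    have hB : ∀ d : U.Edge, x.1 ⟨liftB d.1, liftB_mem T U d.2⟩ = 0 →
        t.1 (T.leafEdge a) = 0 ∨ u.1 d = 0 := fun d hd => by
      have := congrArg Subtype.val ((h.2 d).symm.trans hd)
      rcases mul_eq_zero.mp this with h | h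
      · exact .inl (Subtype.ext h)
      · exact .inr (Subtype.ext h)
    suffices t ∈ T.zeroSet ∨ u ∈ U.zeroSet by
      rcases this with h | h
      · rw [wmk_eq_pt h]
        exact BasedTop.smk_pt_left _
      · rw [wmk_eq_pt h]
        exact BasedTop.smk_pt_right _
    rcases hx with hx | ⟨z, hx⟩
    · by_cases hA : (Set.univ : Set A) = {a}
      · have : (T.graft a U).rootEdge = ⟨liftB U.rootEdge.1, liftB_mem T U U.rootEdge.2⟩ :=
          Subtype.ext (by
            change Set.univ = liftB Set.univ
            rw [liftB_univ, ← hA]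
            rfl)
        rcases hB U.rootEdge (this ▸ hx) with h | h
        · exact .inl (.inr ⟨a, h⟩)
        · exact .inr (.inl h)
      · exact .inl (.inl ((h.1 T.rootEdge hA).trans hx))
    · rcases z with ⟨y, hy⟩ | b
      · refine .inl (.inr ⟨y, (h.1 (T.leafEdge y) (fun e => hy
          (Set.singleton_injective e))).trans ?_⟩)
        have : (⟨liftA {y}, liftA_mem T U (T.singleton_mem y)⟩ : (T.graft a U).Edge) =
            (T.graft a U).leafEdge (.inl ⟨y, hy⟩) := Subtype.ext (by
          ext (⟨y', hy'⟩ | b)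
          · exact ⟨fun h => congrArg Sum.inl (Subtype.ext h),
              fun h => congrArg Subtype.val (Sum.inl_injective h)⟩
          · exact iff_of_false (fun h => hy (Eq.symm h)) Sum.inr_ne_inl)
        exact (congrArg x.1 this).trans hx
      · have : (⟨liftB {b}, liftB_mem T U (U.singleton_mem b)⟩ : (T.graft a U).Edge) =
            (T.graft a U).leafEdge (.inr b) := Subtype.ext Set.image_singleton
        rcases hB (U.leafEdge b) ((congrArg x.1 this).trans hx) with h | h
        · exact .inl (.inr ⟨a, h⟩)
        · exact .inr (.inr ⟨b, h⟩))

theorem wbarUngraft_wmk {x : (T.graft a U).Weighting} {t : T.Weighting} {u : U.Weighting}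
    (h : IsUngrafting T a U x t u) :
    wbarUngraft T a U (wmk x) = BasedTop.smk (wmk t) (wmk u) :=
  ungraftFun_eq T a U h

end Ungraft

/-! The tree with one edge. -/

theorem eq_univ_of_one {c : Set NEFin.one} (h : c.Nonempty) : c = Set.univ := by
  ext x
  obtain ⟨y, hy⟩ := h
  exact iff_of_true (by rwa [Subsingleton.elim (α := Unit) x y]) trivial

instance (T : LTree NEFin.one) : IsEmpty T.Vert :=
  ⟨fun v => by
    obtain ⟨x, _, y, _, h⟩ := v.2.2
    exact h (Subsingleton.elim (α := Unit) x y)⟩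

/-- The identification of `wbar T` with `S⁰` for a tree `T` with one leaf. -/
def wbarOne (T : LTree NEFin.one) : T.wbar ⟶ 𝟙_ BasedTop :=
  wbarLift (Z := BasedTop.sphereZero) (fun _ => true) continuous_const fun x hx => by
    exfalso
    have hroot : x.1 T.rootEdge = 0 := by
      rcases hx with hx | ⟨a, hx⟩
      · exact hx
      · exact (congrArg x.1 (Subtype.ext (eq_univ_of_one (Set.singleton_nonempty a)).symm)).trans hx
    have h1 := x.2 ()
    have : T.dist x.1 () = 0 := by
      classical
      refine Finset.sum_eq_zero fun e _ => ?_
      have he : e = T.rootEdge := Subtype.ext (eq_univ_of_one (T.nonempty_of_mem _ e.2))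
      rw [he, hroot]
      simp
    rw [this] at h1
    exact zero_ne_one h1

end LTree

/-! ### The cobar construction -/

section Cobar

universe v u

variable {C : Type u} [Category.{v} C] [MonoidalCategory C] [SymmetricCategory C] {Q : NEFin → C}

/-- The object `Q(T)`: the tensor product of the objects `Q(i(v))` over the vertices `v` of `T`. -/
noncomputable def treeObj (Q : NEFin → C) {A : NEFin} (T : LTree A) : C :=
  bigTensor fun v : T.Vert => Q (T.inc v)

namespace Cooperad

variable (q : Cooperad Q) {A B : NEFin}

/-- The map `Q(T / e) ⟶ Q(T)` given by the cocomposition `Q(i(u ∘ v)) ⟶ Q(i(u)) ∧ Q(i(v))` for the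
endpoints `u`, `v` of the internal edge `e`. -/
noncomputable def collapseMap {T : LTree A} (e : T.InternalEdge) :
    treeObj Q e.coll ⟶ treeObj Q T :=
  (bigTensorReindex (fun v => Q (e.coll.inc v)) e.collVertEquiv).hom ≫
    (bigTensorOption fun k => Q (e.coll.inc (e.collVertEquiv k))).hom ≫
    ((q.map e.incCollEquiv ≫ q.cocomp (T.inc e.low) (T.inc e.up) e.edge) ⊗ₘ
      bigTensorMap (fun r => q.map (e.incRestEquiv r))) ≫
    (α_ _ _ _).hom ≫
    (Q (T.inc e.low) ◁ (bigTensorOption fun k => Q (T.inc (e.vertEquiv (some k)))).inv) ≫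
    (bigTensorOption fun k => Q (T.inc (e.vertEquiv k))).inv ≫
    (bigTensorReindex (fun v => Q (T.inc v)) e.vertEquiv).inv

/-- The isomorphism `Q(T) ⟶ Q(σ T)` for a relabelled tree. -/
noncomputable def treeRelabel (σ : A ≃ B) (T : LTree A) :
    treeObj Q T ⟶ treeObj Q (T.relabel σ) :=
  (bigTensorReindex (fun v => Q (T.inc v)) (T.relabelVert σ)).hom ≫
    bigTensorMap fun v => q.map (T.relabelInc σ v)

/-- The isomorphism `Q(T) ∧ Q(U) ⟶ Q(T ∪_a U)`. -/
noncomputable def treeGraft (T : LTree A) (a : A) (U : LTree B) :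
    treeObj Q T ⊗ treeObj Q U ⟶ treeObj Q (T.graft a U) :=
  (bigTensorMap (fun v => q.map (T.graftIncA U a v)) ⊗ₘ
    bigTensorMap (fun v => q.map (T.graftIncB U a v))) ≫
    (bigTensorSum fun k => Q ((T.graft a U).inc (T.graftVert U a k))).inv ≫
    (bigTensorReindex (fun v => Q ((T.graft a U).inc v)) (T.graftVert U a)).inv

variable (A) in
/-- The data of the functor `Q_A : T ↦ Q(T)` on the poset of `A`-labelled trees: the action on
morphisms is functorial and is given by the cocomposition maps for the collapse of a single internal
edge. -/
structure TreeFunctor where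
  /-- the action on morphisms -/
  map {T T' : LTree A} : T ≤ T' → (treeObj Q T ⟶ treeObj Q T')
  map_refl (T : LTree A) : map (le_refl T) = 𝟙 _
  map_trans {T T' T'' : LTree A} (h : T ≤ T') (h' : T' ≤ T'') :
    map (h.trans h') = map h ≫ map h'
  map_collapse {T : LTree A} (e : T.InternalEdge) : map e.coll_le = q.collapseMap e

variable {q}

/-- The functor `Q_A`. -/
noncomputable def TreeFunctor.functor (D : q.TreeFunctor A) : LTree A ⥤ C where
  obj T := treeObj Q T
  map f := D.map (leOfHom f)
  map_id T := D.map_refl T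
  map_comp f g := D.map_trans (leOfHom f) (leOfHom g)

end Cooperad

variable [EnrichedOrdinaryCategory BasedTop C] [SymmetricMonoidalVCategory BasedTop C]
  [HasLimitsOfSize.{0, 0} C] {q : Cooperad Q}

/-- The zero map: the basepoint of the mapping space. -/
def zeroHom (X Y : C) : X ⟶ Y := (eHomEquiv BasedTop).symm (BasedTop.const _ _)

/-- The bifunctor `(T, T') ↦ Map_C(wbar(T), Q_A(T'))`. -/
noncomputable def cobarBifunctor {A : NEFin} (D : q.TreeFunctor A) :
    (LTree A)ᵒᵖ ⥤ LTree A ⥤ C :=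
  (LTree.wbarFunctor A).op ⋙ Cotensored.cot ⋙ (Functor.whiskeringLeft _ _ C).obj D.functor

/-- The object `Ω(Q)(A)`: the end of `Map_C(wbar(T), Q_A(T))` over the poset of `A`-labelled
trees `T`. -/
noncomputable def cobar (D : ∀ A, q.TreeFunctor A) (A : NEFin) : C :=
  end_ (cobarBifunctor (D A))

/-- The projection of `Ω(Q)(A)` to `Map_C(wbar(T), Q_A(T))`. -/
noncomputable def cobarProj (D : ∀ A, q.TreeFunctor A) {A : NEFin} (T : LTree A) :
    cobar D A ⟶ (Cotensored.cot.obj (.op T.wbar)).obj (treeObj Q T) :=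
  end_.π (cobarBifunctor (D A)) T

/-- The operad structure `o` on `Ω(Q)` is the one of the cobar construction. -/
structure IsCobarStructure (D : ∀ A, q.TreeFunctor A) (o : Operad (cobar D)) : Prop where
  /-- bijections act by relabelling trees -/
  map {A B : NEFin} (σ : A ≃ B) (T : LTree A) :
    o.map σ ≫ cobarProj D (T.relabel σ) =
      cobarProj D T ≫ cotMap (LTree.wbarRelabel σ T) (q.treeRelabel σ T)
  /-- the component of `∘_a` at a tree of the form `T ∪_a U` is dual to ungrafting -/
  comp_graft {A B : NEFin} (T : LTree A) (a : A) (U : LTree B) :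
    o.comp A B a ≫ cobarProj D (T.graft a U) =
      (cobarProj D T ⊗ₘ cobarProj D U) ≫ dCot T.wbar U.wbar (treeObj Q T) (treeObj Q U) ≫
        cotMap (LTree.wbarUngraft T a U) (q.treeGraft T a U)
  /-- the component of `∘_a` at any other tree is zero -/
  comp_zero {A B : NEFin} (a : A) (V : LTree (graft A a B))
    (h : ∀ (T : LTree A) (U : LTree B), V ≠ T.graft a U) :
    o.comp A B a ≫ cobarProj D V = zeroHom _ _
  /-- the unit is the identification of `I` with `Map_C(S⁰, I)` -/
  unit (T : LTree NEFin.one) :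
    o.unit ≫ cobarProj D T =
      tensCotEquiv T.wbar (𝟙_ C) (treeObj Q T)
        (tensMap (LTree.wbarOne T) (bigTensorEmpty fun v : T.Vert => Q (T.inc v)).inv ≫
          tensUnit BasedTop _)

end Cobar

end CobarOperad

open CategoryTheory MonoidalCategory Limits CobarOperad

universe v u

/-!
# The cobar construction of a reduced cooperad

A tree with leaves `A` is a laminar family of subsets of `A`, the sets of leaves above its edges. So
identities between relabelled, grafted and collapsed trees are identities between families of sets,
and the structure maps of the objects `Q(T)` are determined by what they do to clusters.

**Tensor products over vertices.** All identities between maps into `Q(T)` involve reorderings of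
tensor products. They are hidden by `Multi`: maps into tensor products over lists of indices, where
maps that differ by symmetries are identified. Nothing is lost for lists without repetitions, since
there is only one reordering between two such lists (`IsReorder.unique`, by a normal form in which
the factors are inserted one by one). Substitution `Multi.bind` then describes maps of tensor
products factor by factor: relabelling and grafting are given by embeddings of trees
(`LTree.Emb.push`), and the collapse of an edge by a cocomposition at its lower endpoint
(`LTree.InternalEdge.pre_map`).

**The functor `Q_A`.** Every inequality of trees is a sequence of collapses of edges. Two
collapses can be exchanged (`LTree.InternalEdge.map_square`): the components at the vertices agree
trivially unless the two edges share an endpoint, and otherwise by the sequential or the parallel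
coassociativity of `Q`. Hence the composite does not depend on the order (`LTree.IsPath.unique`),
which gives existence and uniqueness of the functor.

**The structure maps of `Ω(Q)`.** A map into the end is a compatible family of components. The trees
of the form `T ∪_a U` are those with an edge `B`, and so are closed under passing to larger trees.
For a tree `S ≤ T ∪_a U` without this edge, the map `wbar S ⟶ wbar (T ∪_a U) ⟶ wbar T ∧ wbar U` is
constant, as the length `0` of the edge `B` is a product of the length of a leaf of `T` and that of
the root of `U` (`LTree.wbarMap_wbarUngraft_of_notMem`). So the family of the prescribed components
at the trees `T ∪_a U` and zero elsewhere is compatible (`exists_cobar_lift_of_embedding`).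

**The axioms** are checked on components. At trees that are not of the appropriate form both sides
vanish, since zero maps are preserved by `d^∨` and by composition. At the other trees each axiom is
a combination of three identities of the same shape: for the ungrafting maps of the spaces `wbar`
(`LTree.wbarUngraft_assoc` and the lemmas after it), for the grafting maps of the objects `Q(T)`
(`LTree.treeGraft_assoc` and the lemmas around it) and for the maps `d^∨` (`dCot_assoc`,
`dCot_swap`, `dCot_unit`), which are adjoint to the coherence of `d`.

**The unit** is an isomorphism because there is only one tree `I` with one leaf, `wbar I` is `S⁰`,
and `Q(I)` is the empty tensor product. Uniqueness holds since all components are prescribed.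
-/

set_option linter.unusedSectionVars false

namespace CobarOperad

open NEFin

/-! ### Coherence for reorderings of tensor products over lists -/

section Reorder

variable {C : Type u} [Category.{v} C] [MonoidalCategory C] [SymmetricCategory C]

/-- The symmetry isomorphism that exchanges the first two of three factors. -/
def swapHead (A B D : C) : A ⊗ (B ⊗ D) ⟶ B ⊗ (A ⊗ D) :=
  (α_ A B D).inv ≫ (β_ A B).hom ▷ D ≫ (α_ B A D).hom

theorem swapHead_swapHead (A B D : C) : swapHead A B D ≫ swapHead B A D = 𝟙 _ := by
  simp [swapHead, ← comp_whiskerRight_assoc]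

theorem swapHead_natural (A B : C) {D D' : C} (f : D ⟶ D') :
    swapHead A B D ≫ B ◁ A ◁ f = A ◁ B ◁ f ≫ swapHead A B D' := by
  simp only [swapHead, Category.assoc]
  rw [← associator_naturality_right, ← whisker_exchange_assoc,
    associator_inv_naturality_right_assoc]

/-- The hexagon of the six orders of three factors: the Yang-Baxter equation for `swapHead`. -/
theorem swapHead_braid (A B K D : C) :
    A ◁ swapHead B K D ≫ swapHead A K (B ⊗ D) ≫ K ◁ swapHead A B D =
      swapHead A B (K ⊗ D) ≫ B ◁ swapHead A K D ≫ swapHead B K (A ⊗ D) := by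
  trans 𝟙 _ ⊗≫ (A ◁ (β_ B K).hom ⊗≫ (β_ A K).hom ▷ B ⊗≫ K ◁ (β_ A B).hom) ▷ D ⊗≫ 𝟙 _
  · simp only [swapHead]
    monoidal
  · trans 𝟙 _ ⊗≫ ((β_ A B).hom ▷ K ⊗≫ B ◁ (β_ A K).hom ⊗≫ (β_ B K).hom ▷ A) ▷ D ⊗≫ 𝟙 _
    · rw [BraidedCategory.yang_baxter']
      monoidal
    · simp only [swapHead]
      monoidal

theorem swapHead_tensor (A B L M : C) : swapHead A B (L ⊗ M) =
    A ◁ (α_ _ _ _).inv ≫ (α_ _ _ _).inv ≫ swapHead A B L ▷ M ≫ (α_ _ _ _).hom ≫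
      B ◁ (α_ _ _ _).hom := by
  simp only [swapHead]
  monoidal

theorem swapHead_tensor_middle (A B L M : C) : swapHead A (B ⊗ L) M =
    A ◁ (α_ _ _ _).hom ≫ swapHead A B (L ⊗ M) ≫ B ◁ swapHead A L M ≫ (α_ _ _ _).inv := by
  simp only [swapHead, BraidedCategory.braiding_tensor_right_hom]
  monoidal

theorem swapHead_tensor_iso (A B : C) {L M P : C} (a : P ≅ L ⊗ M) : swapHead A B P =
    (A ◁ (B ◁ a.hom ≫ (α_ _ _ _).inv) ≫ (α_ _ _ _).inv) ≫ swapHead A B L ▷ M ≫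
      (α_ _ _ _).hom ≫ B ◁ ((α_ _ _ _).hom ≫ A ◁ a.inv) := by
  rw [← cancel_mono (B ◁ A ◁ a.hom), swapHead_natural, swapHead_tensor]
  simp

theorem swapHead_tensor_middle_iso (A B : C) {L M P N : C} (a : P ≅ L ⊗ M) (b : N ≅ L ⊗ A ⊗ M) :
    swapHead A B P ≫ B ◁ (A ◁ a.hom ≫ swapHead A L M ≫ b.inv) =
      A ◁ (B ◁ a.hom ≫ (α_ _ _ _).inv) ≫ swapHead A (B ⊗ L) M ≫ (α_ _ _ _).hom ≫ B ◁ b.inv := by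
  have h1 := swapHead_natural A B a.hom
  rw [swapHead_tensor_middle]
  simp [reassoc_of% h1]

variable {ι : Type} (X : ι → C)

/-- The maps between tensor products over lists that are composites of symmetries. -/
inductive IsReorder : ∀ {l m : List ι}, (listTensor X l ⟶ listTensor X m) → Prop
  | refl (l : List ι) : IsReorder (𝟙 (listTensor X l))
  | cons (i : ι) {l m : List ι} {f : listTensor X l ⟶ listTensor X m} (h : IsReorder f) :
      IsReorder (l := i :: l) (m := i :: m) (X i ◁ f)
  | swap (i j : ι) (l : List ι) :
      IsReorder (l := i :: j :: l) (m := j :: i :: l) (swapHead (X i) (X j) (listTensor X l))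
  | trans {l m n : List ι} {f : listTensor X l ⟶ listTensor X m}
      {g : listTensor X m ⟶ listTensor X n} (h : IsReorder f) (h' : IsReorder g) :
      IsReorder (f ≫ g)

/-- The maps that move the first factor to some other place. -/
inductive IsInsert (i : ι) : ∀ {l m : List ι}, (X i ⊗ listTensor X l ⟶ listTensor X m) → Prop
  | head (l : List ι) : IsInsert i (l := l) (m := i :: l) (𝟙 _)
  | tail (j : ι) {l m : List ι} {f : X i ⊗ listTensor X l ⟶ listTensor X m} (h : IsInsert i f) :
      IsInsert i (l := j :: l) (m := j :: m) (swapHead (X i) (X j) (listTensor X l) ≫ X j ◁ f)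

/-- A normal form for `IsReorder`: the factors are inserted one by one. -/
inductive IsSort : ∀ {l m : List ι}, (listTensor X l ⟶ listTensor X m) → Prop
  | nil : IsSort (l := []) (m := []) (𝟙 _)
  | cons (i : ι) {l m n : List ι} {f : listTensor X l ⟶ listTensor X m}
      {g : X i ⊗ listTensor X m ⟶ listTensor X n} (h : IsSort f) (h' : IsInsert X i g) :
      IsSort (l := i :: l) (X i ◁ f ≫ g)

variable {X}

/-- Two successive insertions may be performed in the other order, up to exchanging the two first
factors. -/
theorem IsInsert.comm {i j : ι} {l m n : List ι} {f : X i ⊗ listTensor X l ⟶ listTensor X m}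
    {g : X j ⊗ listTensor X m ⟶ listTensor X n} (hf : IsInsert X i f) (hg : IsInsert X j g) :
    ∃ (m' : List ι) (g' : X j ⊗ listTensor X l ⟶ listTensor X m')
      (f' : X i ⊗ listTensor X m' ⟶ listTensor X n), IsInsert X j g' ∧ IsInsert X i f' ∧
        X j ◁ f ≫ g = swapHead (X j) (X i) (listTensor X l) ≫ X i ◁ g' ≫ f' := by
  induction hg generalizing l with
  | head m =>
    refine ⟨_, _, _, .head l, .tail j hf, ?_⟩
    have := swapHead_swapHead (X j) (X i) (listTensor X l)
    change X j ◁ f ≫ 𝟙 _ = swapHead _ _ _ ≫ X i ◁ 𝟙 _ ≫ swapHead _ _ _ ≫ X j ◁ f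
    rw [MonoidalCategory.whiskerLeft_id, Category.id_comp, ← Category.assoc, this]
    simp
  | tail k hg ih =>
    rename_i m₀ n₀ g₀
    cases hf with
    | head =>
      refine ⟨_, _, _, hg, .head _, ?_⟩
      simp [listTensor]
    | tail _ hf =>
      rename_i l₀ f₀
      obtain ⟨m', g', f', hg', hf', e⟩ := ih hf
      refine ⟨_, _, _, .tail k hg', .tail k hf', ?_⟩
      have h1 := swapHead_natural (X j) (X k) f₀
      have h2 := swapHead_natural (X i) (X k) g'
      have h3 := swapHead_braid (X j) (X i) (X k) (listTensor X l₀)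
      simp only [MonoidalCategory.whiskerLeft_comp, Category.assoc, listTensor]
      rw [← reassoc_of% h1, ← reassoc_of% h2, ← MonoidalCategory.whiskerLeft_comp, e,
        MonoidalCategory.whiskerLeft_comp, MonoidalCategory.whiskerLeft_comp, reassoc_of% h3]

/-- An insertion followed by a sorting is a sorting followed by an insertion; this is the step that
makes the normal forms closed under composition. -/
theorem IsInsert.sort {i : ι} {l m n : List ι} {f : X i ⊗ listTensor X l ⟶ listTensor X m}
    {g : listTensor X m ⟶ listTensor X n} (hf : IsInsert X i f) (hg : IsSort X g) :
    ∃ (m' : List ι) (g' : listTensor X l ⟶ listTensor X m')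
      (f' : X i ⊗ listTensor X m' ⟶ listTensor X n), IsSort X g' ∧ IsInsert X i f' ∧
        f ≫ g = X i ◁ g' ≫ f' := by
  induction hf generalizing n with
  | head l =>
    cases hg with
    | cons _ hg hf => exact ⟨_, _, _, hg, hf, Category.id_comp _⟩
  | tail j hf ih =>
    rename_i l₀ m₀ f₀
    cases hg with
    | cons _ hg hh =>
      rename_i n₁ g₀ h
      obtain ⟨n₂, g₀', f₀', hg', hf', e⟩ := ih hg
      obtain ⟨n₁', h', f', hh', hf'', e'⟩ := hf'.comm hh
      refine ⟨_, _, _, .cons j hg' hh', hf'', ?_⟩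
      have h1 := swapHead_natural (X i) (X j) g₀'
      have h2 := swapHead_swapHead (X i) (X j) (listTensor X n₂)
      simp only [MonoidalCategory.whiskerLeft_comp, Category.assoc, listTensor]
      rw [← MonoidalCategory.whiskerLeft_comp_assoc, e, MonoidalCategory.whiskerLeft_comp,
        Category.assoc, e', reassoc_of% h1, reassoc_of% h2]

theorem IsSort.of_eq {l m : List ι} {f g : listTensor X l ⟶ listTensor X m}
    (h : IsSort X f) (e : f = g) : IsSort X g := e ▸ h

theorem IsSort.trans {l m n : List ι} {f : listTensor X l ⟶ listTensor X m}
    {g : listTensor X m ⟶ listTensor X n} (hf : IsSort X f) (hg : IsSort X g) :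
    IsSort X (f ≫ g) := by
  induction hf generalizing n with
  | nil => rwa [Category.id_comp]
  | cons i hf h ih =>
    obtain ⟨m', g', f', hg', hf', e⟩ := h.sort hg
    rename_i l₀ m₀ n₀ f₀ g₀
    have e' : (X i ◁ f₀ ≫ g₀) ≫ g = X i ◁ (f₀ ≫ g') ≫ f' := by
      rw [Category.assoc, e, MonoidalCategory.whiskerLeft_comp, Category.assoc]
    exact (IsSort.cons i (ih hg') hf').of_eq e'.symm

theorem IsSort.cons_self (i : ι) {l m : List ι} {f : listTensor X l ⟶ listTensor X m}
    (h : IsSort X f) : IsSort X (l := i :: l) (m := i :: m) (X i ◁ f) := by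
  have e : X i ◁ f ≫ 𝟙 _ = X i ◁ f := Category.comp_id _
  exact (IsSort.cons i h (.head m)).of_eq e

variable (X) in
theorem IsSort.refl (l : List ι) : IsSort X (𝟙 (listTensor X l)) := by
  induction l with
  | nil => exact .nil
  | cons i l ih =>
    have := ih.cons_self i
    rwa [MonoidalCategory.whiskerLeft_id] at this

theorem IsReorder.isSort {l m : List ι} {f : listTensor X l ⟶ listTensor X m}
    (h : IsReorder X f) : IsSort X f := by
  induction h with
  | refl l => exact .refl X l
  | cons i _ ih => exact ih.cons_self i
  | swap i j l =>
    have := IsSort.cons i (.refl X (j :: l)) (.tail j (.head l))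
    simpa [listTensor] using this
  | trans _ _ ih ih' => exact ih.trans ih'

theorem IsInsert.mem {i : ι} {l m : List ι} {f : X i ⊗ listTensor X l ⟶ listTensor X m}
    (h : IsInsert X i f) : m.Perm (i :: l) := by
  induction h with
  | head => exact .refl _
  | tail j _ ih => exact (ih.cons j).trans (.swap _ _ _)

/-- In a list without repetitions there is only one place for the inserted factor. -/
theorem IsInsert.unique {i : ι} {l l' m : List ι} {f : X i ⊗ listTensor X l ⟶ listTensor X m}
    {f' : X i ⊗ listTensor X l' ⟶ listTensor X m} (h : IsInsert X i f) (h' : IsInsert X i f')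
    (hm : m.Nodup) : ∃ e : l = l', f = eqToHom (by rw [e]) ≫ f' := by
  induction h generalizing l' with
  | head l =>
    cases h' with
    | head => exact ⟨rfl, (Category.id_comp _).symm⟩
    | tail _ h' => exact ((List.nodup_cons.mp hm).1 (h'.mem.symm.subset List.mem_cons_self)).elim
  | tail j h ih =>
    cases h' with
    | head => exact ((List.nodup_cons.mp hm).1 (h.mem.symm.subset List.mem_cons_self)).elim
    | tail _ h' =>
      obtain ⟨rfl, e⟩ := ih h' (List.nodup_cons.mp hm).2
      refine ⟨rfl, ?_⟩
      rw [e]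
      simp

theorem IsSort.unique {l m : List ι} {f f' : listTensor X l ⟶ listTensor X m} (h : IsSort X f)
    (h' : IsSort X f') (hm : m.Nodup) : f = f' := by
  induction h with
  | nil => cases h' with | nil => rfl
  | cons i h hi ih =>
    cases h' with
    | cons _ h' hi' =>
      obtain ⟨rfl, e⟩ := hi.unique hi' hm
      rw [ih h' (List.nodup_cons.mp (hi.mem.nodup_iff.mp hm)).2, e]
      simp

/-- Coherence: for lists without repetitions, there is at most one composite of symmetries. -/
theorem IsReorder.unique {l m : List ι} {f f' : listTensor X l ⟶ listTensor X m}
    (h : IsReorder X f) (h' : IsReorder X f') (hm : m.Nodup) : f = f' :=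
  h.isSort.unique h'.isSort hm

theorem IsReorder.of_eq {l m : List ι} {f g : listTensor X l ⟶ listTensor X m}
    (h : IsReorder X f) (e : f = g) : IsReorder X g := e ▸ h

theorem IsReorder.eqToHom {l m : List ι} (h : l = m) :
    IsReorder X (eqToHom (congrArg (listTensor X) h)) := by
  subst h
  exact .refl l

theorem IsReorder.exists_inv {l m : List ι} {f : listTensor X l ⟶ listTensor X m}
    (h : IsReorder X f) :
    ∃ g : listTensor X m ⟶ listTensor X l, IsReorder X g ∧ f ≫ g = 𝟙 _ ∧ g ≫ f = 𝟙 _ := by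
  induction h with
  | refl l => exact ⟨_, .refl l, by simp, by simp⟩
  | cons i _ ih =>
    obtain ⟨g, hg, h1, h2⟩ := ih
    refine ⟨_, hg.cons i, ?_, ?_⟩
    · refine (MonoidalCategory.whiskerLeft_comp _ _ _).symm.trans ?_
      rw [h1]
      exact MonoidalCategory.whiskerLeft_id _ _
    · refine (MonoidalCategory.whiskerLeft_comp _ _ _).symm.trans ?_
      rw [h2]
      exact MonoidalCategory.whiskerLeft_id _ _
  | swap i j l => exact ⟨_, .swap j i l, swapHead_swapHead _ _ _, swapHead_swapHead _ _ _⟩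
  | trans _ _ ih ih' =>
    obtain ⟨g, hg, h1, h2⟩ := ih
    obtain ⟨g', hg', h1', h2'⟩ := ih'
    refine ⟨_, hg'.trans hg, ?_, ?_⟩
    · rw [Category.assoc, reassoc_of% h1', h1]
    · rw [Category.assoc, reassoc_of% h2, h2']

theorem IsReorder.inv {l m : List ι} {e : listTensor X l ≅ listTensor X m}
    (h : IsReorder X e.hom) : IsReorder X e.inv := by
  obtain ⟨g, hg, h1, -⟩ := h.exists_inv
  exact hg.of_eq ((Iso.eq_inv_comp e).mpr h1 |>.trans (Category.comp_id _))

open Classical in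
theorem isReorder_listTensorExtract (i : ι) (l : List ι) (h : i ∈ l) :
    IsReorder X (l := l) (m := i :: l.erase i) (listTensorExtract X i l h).hom := by
  induction l with
  | nil => exact (List.not_mem_nil h).elim
  | cons j l ih =>
    by_cases e : j = i
    · have h1 : (listTensorExtract X i (j :: l) h).hom =
          eqToHom (congrArg (listTensor X)
            (by rw [e, List.erase_cons_head] : j :: l = i :: (j :: l).erase i)) := by
        rw [listTensorExtract, dif_pos e]
        rfl
      exact (IsReorder.eqToHom (by rw [e, List.erase_cons_head])).of_eq h1.symm
    · have hi : i ∈ l := (List.mem_cons.mp h).resolve_left (fun h => e h.symm)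
      have h2 : i :: j :: l.erase i = i :: (j :: l).erase i := by
        rw [List.erase_cons_tail (by simpa using e)]
      have h1 : (listTensorExtract X i (j :: l) h).hom =
          (X j ◁ (listTensorExtract X i l hi).hom ≫ swapHead (X j) (X i) _) ≫
          eqToHom (congrArg (listTensor X) h2) := by
        rw [listTensorExtract, dif_neg e]
        simp only [swapHead, Category.assoc]
        rfl
      exact ((((ih hi).cons j).trans (.swap _ _ _)).trans (.eqToHom h2)).of_eq h1.symm

theorem isReorder_listTensorReorder (l m : List ι) (h : l.Perm m) :
    IsReorder X (listTensorReorder X l m h).hom := by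
  classical
  induction l generalizing m with
  | nil =>
    obtain rfl := h.nil_eq
    exact .refl _
  | cons i l ih =>
    have h' : l.Perm (m.erase i) := by simpa using h.erase i
    have := (isReorder_listTensorExtract (X := X) i m (h.subset List.mem_cons_self)).inv
    exact (((ih _ h').cons i).trans this).of_eq (by rw [listTensorReorder]; rfl)

/-! ### Reorderings of concatenated lists -/

theorem listTensorAppend_cons_hom (i : ι) (l m : List ι) :
    (listTensorAppend X m (i :: l)).hom =
      X i ◁ (listTensorAppend X m l).hom ≫ (α_ _ _ _).inv := rfl

theorem listTensorAppend_cons_inv (i : ι) (l m : List ι) :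
    (listTensorAppend X m (i :: l)).inv =
      (α_ _ _ _).hom ≫ X i ◁ (listTensorAppend X m l).inv := by
  rfl

theorem IsReorder.append_left (l : List ι) {m m' : List ι} {f : listTensor X m ⟶ listTensor X m'}
    (h : IsReorder X f) : IsReorder X ((listTensorAppend X m l).hom ≫ _ ◁ f ≫
      (listTensorAppend X m' l).inv) := by
  induction l with
  | nil =>
    refine h.of_eq ?_
    change f = (λ_ _).inv ≫ 𝟙_ C ◁ f ≫ (λ_ _).hom
    simp
  | cons i l ih =>
    refine (ih.cons i).of_eq ?_
    rw [listTensorAppend_cons_hom, listTensorAppend_cons_inv]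
    simp [listTensor]

theorem IsReorder.append_right {l l' : List ι} (m : List ι) {f : listTensor X l ⟶ listTensor X l'}
    (h : IsReorder X f) : IsReorder X ((listTensorAppend X m l).hom ≫ f ▷ _ ≫
      (listTensorAppend X m l').inv) := by
  induction h with
  | refl l => exact (IsReorder.refl _).of_eq (by simp)
  | cons i h ih =>
    refine (ih.cons i).of_eq ?_
    rw [listTensorAppend_cons_hom, listTensorAppend_cons_inv]
    simp [listTensor]
  | swap i j l =>
    refine (IsReorder.swap i j (l ++ m)).of_eq ?_
    exact swapHead_tensor_iso _ _ (listTensorAppend X m l)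
  | trans _ _ ih ih' =>
    refine (ih.trans ih').of_eq ?_
    simp

theorem IsReorder.append {l l' m m' : List ι} {f : listTensor X l ⟶ listTensor X l'}
    {g : listTensor X m ⟶ listTensor X m'} (hf : IsReorder X f) (hg : IsReorder X g) :
    IsReorder X ((listTensorAppend X m l).hom ≫ (f ⊗ₘ g) ≫ (listTensorAppend X m' l').inv) := by
  refine ((hf.append_right m).trans (hg.append_left l')).of_eq ?_
  simp [MonoidalCategory.tensorHom_def]

theorem IsReorder.move (i : ι) (l m : List ι) :
    IsReorder X (l := i :: (l ++ m)) (m := l ++ i :: m) (X i ◁ (listTensorAppend X m l).hom ≫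
      swapHead _ _ _ ≫ (listTensorAppend X (i :: m) l).inv) := by
  induction l with
  | nil =>
    refine (IsReorder.refl _).of_eq ?_
    change 𝟙 _ = X i ◁ (λ_ _).inv ≫ swapHead _ (𝟙_ C) _ ≫ (λ_ _).hom
    simp [swapHead, braiding_tensorUnit_right]
  | cons j l ih =>
    refine ((IsReorder.swap i j (l ++ m)).trans (ih.cons j)).of_eq ?_
    exact swapHead_tensor_middle_iso _ _ (listTensorAppend X m l) (listTensorAppend X (i :: m) l)

theorem isReorder_append_nil (l : List ι) :
    IsReorder X ((listTensorAppend X [] l).hom ≫ (ρ_ _).hom) := by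
  induction l with
  | nil =>
    refine (IsReorder.refl _).of_eq ?_
    change 𝟙 (𝟙_ C) = (λ_ (𝟙_ C)).inv ≫ (ρ_ (𝟙_ C)).hom
    rw [← unitors_equal, Iso.inv_hom_id]
  | cons i l ih =>
    refine (ih.cons i).of_eq ?_
    rw [listTensorAppend_cons_hom]
    simp [listTensor]

theorem isReorder_append_nil_inv (l : List ι) :
    IsReorder X ((ρ_ _).inv ≫ (listTensorAppend X [] l).inv) := by
  have := isReorder_append_nil (X := X) l
  exact (IsReorder.inv (e := listTensorAppend X [] l ≪≫ ρ_ _) this).of_eq rfl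

theorem IsReorder.braiding (l m : List ι) :
    IsReorder X ((listTensorAppend X m l).hom ≫ (β_ _ _).hom ≫ (listTensorAppend X l m).inv) := by
  induction l with
  | nil =>
    refine (isReorder_append_nil_inv m).of_eq ?_
    change _ = (λ_ _).inv ≫ (β_ (𝟙_ C) _).hom ≫ _
    rw [braiding_tensorUnit_left]
    refine ((Iso.inv_hom_id_assoc (λ_ (listTensor X m)) _).symm.trans ?_)
    congr 1
    exact (Category.assoc _ _ _).symm
  | cons i l ih =>
    refine ((ih.cons i).trans (IsReorder.move i m l)).of_eq ?_
    rw [listTensorAppend_cons_hom]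
    simp [listTensor, swapHead, BraidedCategory.braiding_tensor_left_hom]

theorem isReorder_append_assoc (l m n : List ι) :
    IsReorder X (((listTensorAppend X (m ++ n) l).hom ≫ _ ◁ (listTensorAppend X n m).hom ≫
      (α_ _ _ _).inv ≫ (listTensorAppend X m l).inv ▷ _ ≫
        (listTensorAppend X n (l ++ m)).inv)) := by
  induction l with
  | nil =>
    refine (IsReorder.refl _).of_eq ?_
    change _ = (λ_ _).inv ≫ 𝟙_ C ◁ _ ≫ (α_ (𝟙_ C) _ _).inv ≫ (λ_ _).hom ▷ _ ≫ _
    simp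
  | cons i l ih =>
    refine (ih.cons i).of_eq ?_
    simp only [List.cons_append, listTensorAppend_cons_hom, listTensorAppend_cons_inv]
    simp [listTensor]

end Reorder

/-! ### Maps into tensor products up to reordering of the factors -/

section Multi

variable {C : Type u} [Category.{v} C] [MonoidalCategory C] [SymmetricCategory C]
variable {ι κ μ : Type} (X : ι → C) (Y : κ → C) (Z : μ → C)

/-- A map from `y` to a tensor product over some list. -/
structure PreMulti (y : C) where
  /-- the list of indices of the factors -/
  list : List ι
  /-- the map -/
  hom : y ⟶ listTensor X list

/-- Maps to tensor products over lists are identified if they differ by a reordering of the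
factors. -/
def multiSetoid (y : C) : Setoid (PreMulti X y) where
  r a b := ∃ r : listTensor X a.list ⟶ listTensor X b.list, IsReorder X r ∧ a.hom ≫ r = b.hom
  iseqv :=
    { refl := fun a => ⟨_, .refl _, Category.comp_id _⟩
      symm := fun ⟨r, hr, e⟩ => by
        obtain ⟨s, hs, h1, -⟩ := hr.exists_inv
        exact ⟨s, hs, by rw [← e, Category.assoc, h1, Category.comp_id]⟩
      trans := fun ⟨r, hr, e⟩ ⟨s, hs, e'⟩ =>
        ⟨_, hr.trans hs, by rw [← Category.assoc, e, e']⟩ }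

/-- Maps from `y` to tensor products of objects of the family `X`, up to reordering of the
factors. -/
def Multi (y : C) := Quotient (multiSetoid X y)

namespace Multi

variable {X Y Z} {y y' z w : C}

/-- The class of a map to a tensor product over a list. -/
def mk (l : List ι) (f : y ⟶ listTensor X l) : Multi X y := Quotient.mk (multiSetoid X y) ⟨l, f⟩

theorem ind {p : Multi X y → Prop} (h : ∀ l f, p (mk l f)) (a : Multi X y) : p a :=
  Quotient.ind (fun a => h a.1 a.2) a

theorem mk_eq {l m : List ι} {f : y ⟶ listTensor X l} {g : y ⟶ listTensor X m}
    {r : listTensor X l ⟶ listTensor X m} (hr : IsReorder X r) (h : f ≫ r = g) :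
    mk l f = mk m g :=
  Quotient.sound ⟨r, hr, h⟩

/-- For a list without repetitions, no map is lost in the quotient: the only reordering of the list
to itself is the identity. -/
theorem mk_injective {l : List ι} (hl : l.Nodup) {f g : y ⟶ listTensor X l}
    (h : mk l f = mk l g) : f = g := by
  obtain ⟨r, hr, e⟩ : ∃ r : listTensor X l ⟶ listTensor X l, IsReorder X r ∧ f ≫ r = g :=
    Quotient.exact h
  rw [← e, hr.unique (.refl l) hl, Category.comp_id]

/-- Precomposition. -/
def pre (f : y ⟶ z) : Multi X z → Multi X y :=
  Quotient.lift (fun a => mk a.list (f ≫ a.hom)) fun _ _ ⟨_, hr, e⟩ =>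
    mk_eq hr (by rw [Category.assoc, e])

/-- The tensor product. -/
def tens : Multi X y → Multi X z → Multi X (y ⊗ z) :=
  Quotient.lift₂ (fun a b => mk (a.list ++ b.list)
    ((a.hom ⊗ₘ b.hom) ≫ (listTensorAppend X b.list a.list).inv)) (by
      rintro _ _ _ _ ⟨r, hr, e⟩ ⟨s, hs, e'⟩
      refine mk_eq (hr.append hs) ?_
      rw [← e, ← e']
      simp)

variable (X) in
/-- The identity of a factor. -/
def single (i : ι) : Multi X (X i) := mk [i] (ρ_ (X i)).inv

variable (X) in
/-- The empty product. -/
def nil : Multi X (𝟙_ C) := mk [] (𝟙 _)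

@[simp] theorem pre_id (a : Multi X y) : pre (𝟙 y) a = a := by
  induction a using ind with | _ l f
  exact congrArg (mk l) (Category.id_comp f)

@[simp] theorem pre_pre (f : y ⟶ z) (g : z ⟶ w) (a : Multi X w) :
    pre f (pre g a) = pre (f ≫ g) a := by
  induction a using ind with | _ l h
  exact congrArg (mk l) (Category.assoc f g h).symm

theorem pre_injective (e : z ≅ y) {a b : Multi X y} (h : pre e.hom a = pre e.hom b) : a = b := by
  have := congrArg (pre e.inv) h
  rwa [pre_pre, pre_pre, Iso.inv_hom_id, pre_id, pre_id] at this

@[simp] theorem tens_pre {y₁ y₂ z₁ z₂ : C} (f : y₁ ⟶ z₁) (g : y₂ ⟶ z₂) (a : Multi X z₁)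
    (b : Multi X z₂) : tens (pre f a) (pre g b) = pre (f ⊗ₘ g) (tens a b) := by
  induction a using ind with | _ l h
  induction b using ind with | _ m k
  refine congrArg (mk (l ++ m)) ?_
  change ((f ≫ h) ⊗ₘ (g ≫ k)) ≫ _ = (f ⊗ₘ g) ≫ (h ⊗ₘ k) ≫ _
  simp

theorem tens_pre_left {y₁ y₂ z₁ : C} (f : y₁ ⟶ z₁) (a : Multi X z₁)
    (b : Multi X y₂) : tens (pre f a) b = pre (f ▷ y₂) (tens a b) := by
  have := tens_pre f (𝟙 _) a b
  rwa [pre_id, tensorHom_id] at this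

theorem tens_pre_right {y₁ y₂ z₂ : C} (g : y₂ ⟶ z₂) (a : Multi X y₁)
    (b : Multi X z₂) : tens a (pre g b) = pre (y₁ ◁ g) (tens a b) := by
  have := tens_pre (𝟙 _) g a b
  rwa [pre_id, id_tensorHom] at this

theorem tens_assoc (a : Multi X y) (b : Multi X z) (c : Multi X w) :
    pre (α_ y z w).hom (tens a (tens b c)) = tens (tens a b) c := by
  induction a using ind with | _ l f
  induction b using ind with | _ m g
  induction c using ind with | _ n h
  refine mk_eq (isReorder_append_assoc l m n) ?_
  change ((α_ y z w).hom ≫ (f ⊗ₘ ((g ⊗ₘ h) ≫ _)) ≫ _) ≫ _ ≫ _ ≫ _ ≫ _ ≫ _ =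
    (((f ⊗ₘ g) ≫ _) ⊗ₘ h) ≫ _
  have e1 : ∀ q : listTensor X m ⊗ listTensor X n ⟶ listTensor X (m ++ n),
      (f ⊗ₘ ((g ⊗ₘ h) ≫ q)) = (f ⊗ₘ (g ⊗ₘ h)) ≫ _ ◁ q := fun q => by
    rw [← id_tensorHom, tensorHom_comp_tensorHom, Category.comp_id]
  have e2 : ∀ q : listTensor X l ⊗ listTensor X m ⟶ listTensor X (l ++ m),
      (((f ⊗ₘ g) ≫ q) ⊗ₘ h) = ((f ⊗ₘ g) ⊗ₘ h) ≫ q ▷ _ := fun q => by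
    rw [← tensorHom_id, tensorHom_comp_tensorHom, Category.comp_id]
  rw [e1, e2]
  simp only [Category.assoc, Iso.inv_hom_id_assoc, ← MonoidalCategory.whiskerLeft_comp_assoc,
    Iso.inv_hom_id, MonoidalCategory.whiskerLeft_id, Category.id_comp]
  rw [← associator_naturality_assoc, Iso.hom_inv_id_assoc]

theorem tens_assoc' (a : Multi X y) (b : Multi X z) (c : Multi X w) :
    pre (α_ y z w).inv (tens (tens a b) c) = tens a (tens b c) := by
  rw [← tens_assoc, pre_pre, Iso.inv_hom_id, pre_id]

theorem tens_braid (a : Multi X y) (b : Multi X z) :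
    pre (β_ y z).hom (tens b a) = tens a b := by
  induction a using ind with | _ l f
  induction b using ind with | _ m g
  refine mk_eq (IsReorder.braiding m l) ?_
  change ((β_ y z).hom ≫ (g ⊗ₘ f) ≫ _) ≫ _ ≫ _ = (f ⊗ₘ g) ≫ _
  simp

theorem nil_tens (a : Multi X y) : pre (λ_ y).inv (tens (nil X) a) = a := by
  induction a using ind with | _ l f
  refine congrArg (mk l) ?_
  change (λ_ y).inv ≫ (𝟙 _ ⊗ₘ f) ≫ (λ_ _).hom = f
  simp

theorem tens_nil (a : Multi X y) : pre (ρ_ y).inv (tens a (nil X)) = a := by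
  rw [← tens_braid, pre_pre, rightUnitor_inv_braiding, nil_tens]

theorem tens_swap (a : Multi X y) (b : Multi X z) (c : Multi X w) :
    pre (swapHead y z w) (tens b (tens a c)) = tens a (tens b c) := by
  rw [swapHead, ← pre_pre, ← pre_pre, tens_assoc, ← tens_pre_left, tens_braid, tens_assoc']

theorem mk_cons (i : ι) (l : List ι) (f : y ⟶ X i) (g : z ⟶ listTensor X l) :
    mk (X := X) (i :: l) (f ⊗ₘ g) = tens (pre f (single X i)) (mk l g) := by
  refine congrArg (mk (i :: l)) ?_
  change f ⊗ₘ g = ((f ≫ (ρ_ _).inv) ⊗ₘ g) ≫ (α_ _ (𝟙_ C) _).hom ≫ _ ◁ (λ_ _).hom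
  simp [MonoidalCategory.tensorHom_def]

/-- Substitution into a tensor product over a list. -/
def bindList (H : ∀ k, Multi X (Y k)) : ∀ m : List κ, Multi X (listTensor Y m)
  | [] => nil X
  | k :: m => tens (H k) (bindList H m)

theorem bindList_reorder (H : ∀ k, Multi X (Y k)) {l m : List κ}
    {r : listTensor Y l ⟶ listTensor Y m} (hr : IsReorder Y r) :
    pre r (bindList H m) = bindList H l := by
  induction hr with
  | refl l => exact pre_id _
  | cons i _ ih =>
    refine (tens_pre_right _ _ _).symm.trans ?_
    rw [ih]
    rfl
  | swap i j l => exact tens_swap _ _ _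
  | trans _ _ ih ih' => rw [← pre_pre, ih', ih]

/-- Substitution of the maps `H k` for the factors. -/
def bind (a : Multi Y y) (H : ∀ k, Multi X (Y k)) : Multi X y :=
  Quotient.lift (fun a => pre a.hom (bindList H a.list)) (by
    rintro a b ⟨r, hr, e⟩
    rw [← e, ← pre_pre, bindList_reorder H hr]) a

theorem bind_mk (H : ∀ k, Multi X (Y k)) (l : List κ) (f : y ⟶ listTensor Y l) :
    bind (mk l f) H = pre f (bindList H l) := rfl

@[simp] theorem bind_pre (H : ∀ k, Multi X (Y k)) (f : y ⟶ z) (a : Multi Y z) :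
    bind (pre f a) H = pre f (bind a H) := by
  induction a using ind with | _ l g
  exact (pre_pre _ _ _).symm

theorem bindList_append (H : ∀ k, Multi X (Y k)) (l m : List κ) :
    pre (listTensorAppend Y m l).inv (bindList H (l ++ m)) =
      tens (bindList H l) (bindList H m) := by
  induction l with
  | nil =>
    refine (congrArg (fun a => pre (λ_ _).hom a) (nil_tens (bindList H m)).symm).trans ?_
    rw [pre_pre, Iso.hom_inv_id, pre_id]
    rfl
  | cons i l ih =>
    rw [listTensorAppend_cons_inv]
    refine (pre_pre _ _ _).symm.trans ?_
    refine (congrArg _ (tens_pre_right _ (H i) _).symm).trans ?_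
    refine (congrArg (fun a => pre _ (tens (H i) a)) ih).trans ?_
    exact tens_assoc _ _ _

@[simp] theorem bind_tens (H : ∀ k, Multi X (Y k)) (a : Multi Y y) (b : Multi Y z) :
    bind (tens a b) H = tens (bind a H) (bind b H) := by
  induction a using ind with | _ l f
  induction b using ind with | _ m g
  simp only [bind_mk, tens_pre]
  rw [← bindList_append, pre_pre]
  rfl

@[simp] theorem bind_nil (H : ∀ k, Multi X (Y k)) : bind (nil Y) H = nil X := pre_id (nil X)

@[simp] theorem bind_single (H : ∀ k, Multi X (Y k)) (k : κ) : bind (single Y k) H = H k :=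
  tens_nil (H k)

theorem bind_bind (H : ∀ k, Multi X (Y k)) (K : ∀ i, Multi Z (X i)) (a : Multi Y y) :
    bind (bind a H) K = bind a fun k => bind (H k) K := by
  induction a using ind with | _ l f
  simp only [bind_mk, bind_pre]
  congr 1
  clear f
  induction l with
  | nil => exact bind_nil K
  | cons k l ih => exact (bind_tens _ _ _).trans (congrArg _ ih)

section univ

variable [Finite ι] [Finite κ]

variable (X) in
/-- The identity of the tensor product over a finite type. Together with `Multi.hom_ext` it turns
equations of maps into `bigTensor X` into equations in `Multi`. -/
noncomputable def univ : Multi X (bigTensor X) := mk (enum ι) (𝟙 _)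

theorem hom_ext {f g : y ⟶ bigTensor X} (h : pre f (univ X) = pre g (univ X)) : f = g := by
  refine mk_injective (nodup_enum ι) ?_
  have : ∀ f : y ⟶ bigTensor X, pre f (univ X) = mk (enum ι) f := fun f =>
    congrArg (mk (enum ι)) (Category.comp_id f)
  rwa [this, this] at h

theorem mk_listTensorMap {W : ι → C} (f : ∀ i, X i ⟶ W i) (l : List ι) :
    mk l (listTensorMap f l) = bindList (fun i => pre (f i) (single W i)) l := by
  induction l with
  | nil => rfl
  | cons i l ih => exact (mk_cons i l (f i) _).trans (by rw [ih]; rfl)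

theorem bindList_single (l : List ι) : bindList (single X) l = mk l (𝟙 _) := by
  induction l with
  | nil => rfl
  | cons i l ih =>
    have h1 := mk_cons (X := X) i l (𝟙 _) (𝟙 _)
    rw [pre_id, ← ih, id_tensorHom_id] at h1
    exact h1.symm

@[simp] theorem bind_univ_single : bind (univ X) (single X) = univ X := by
  refine (pre_id _).trans (bindList_single _)

/-- The class of `bigTensorMap`. -/
theorem pre_bigTensorMap {W : ι → C} (f : ∀ i, X i ⟶ W i) :
    pre (bigTensorMap f) (univ W) = bind (univ X) fun i => pre (f i) (single W i) := by
  refine (congrArg (mk (enum ι)) (Category.comp_id _)).trans ?_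
  exact (mk_listTensorMap f _).trans (pre_id _).symm

theorem mk_listTensorPull_inv (e : κ → ι) (l : List κ) :
    mk (l.map e) (listTensorPull X e l).inv = bindList (fun k => single X (e k)) l := by
  induction l with
  | nil => rfl
  | cons k l ih =>
    have h1 := mk_cons (X := X) (e k) (l.map e) (𝟙 _) (listTensorPull X e l).inv
    rw [pre_id, ih, id_tensorHom] at h1
    exact h1

theorem pre_reorder_inv {l : List ι} (h : (enum ι).Perm l) (b : listTensor X l ≅ w) :
    pre (b.inv ≫ (listTensorReorder X (enum ι) l h).inv) (univ X) = mk l b.inv :=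
  mk_eq (isReorder_listTensorReorder (enum ι) l h) (by simp [bigTensor])

theorem bindList_single_append (l m : List ι) :
    mk (l ++ m) (listTensorAppend X m l).inv = tens (mk l (𝟙 _)) (mk m (𝟙 _)) := by
  have := bindList_append (single X) l m
  rw [bindList_single, bindList_single, bindList_single] at this
  rw [← this]
  exact congrArg (mk _) (Category.comp_id _).symm

theorem pre_bigTensorReindex_inv (e : κ ≃ ι) :
    pre (bigTensorReindex X e).inv (univ X) =
      bind (univ fun k => X (e k)) fun k => single X (e k) := by
  refine (pre_reorder_inv _ (listTensorPull X e (enum κ))).trans ?_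
  exact (mk_listTensorPull_inv _ _).trans (pre_id _).symm

theorem pre_bigTensorOption_inv (X : Option ι → C) :
    pre (bigTensorOption X).inv (univ X) =
      tens (single X none) (bind (univ fun i => X (some i)) fun i => single X (some i)) := by
  refine (pre_reorder_inv (l := none :: (enum ι).map some) _
    (whiskerLeftIso (X none) (listTensorPull X some (enum ι)))).trans ?_
  have h1 := mk_cons (X := X) none ((enum ι).map some) (𝟙 _) (listTensorPull X some (enum ι)).inv
  rw [pre_id, mk_listTensorPull_inv, id_tensorHom] at h1
  exact h1.trans (congrArg (tens _) (pre_id _).symm)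

theorem pre_bigTensorSum_inv (X : ι ⊕ κ → C) :
    pre (bigTensorSum X).inv (univ X) =
      tens (bind (univ fun i => X (.inl i)) fun i => single X (.inl i))
        (bind (univ fun k => X (.inr k)) fun k => single X (.inr k)) := by
  refine (pre_reorder_inv _ (listTensorAppend X _ _ ≪≫
    (listTensorPull X Sum.inl (enum ι) ⊗ᵢ listTensorPull X Sum.inr (enum κ)))).trans ?_
  refine (congrArg (pre _) (bindList_single_append _ _)).trans ?_
  refine (tens_pre _ _ _ _).symm.trans (congrArg₂ tens ?_ ?_)
  · refine (congrArg (mk _) (Category.comp_id _)).trans ?_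
    exact (mk_listTensorPull_inv _ _).trans (pre_id _).symm
  · refine (congrArg (mk _) (Category.comp_id _)).trans ?_
    exact (mk_listTensorPull_inv _ _).trans (pre_id _).symm

theorem pre_bigTensorEmpty_inv [IsEmpty ι] (X : ι → C) :
    pre (bigTensorEmpty X).inv (univ X) = nil X := by
  refine Eq.trans ?_ (pre_reorder_inv (X := X) (l := []) ?_ (Iso.refl _))
  · exact congrArg (fun f => pre f (univ X)) (Category.id_comp _).symm
  · rw [List.eq_nil_iff_forall_not_mem.mpr (fun i _ => IsEmpty.false i : ∀ i, i ∉ enum ι)]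

end univ

end Multi

end Multi

/-! ### Tensors, cotensors and the maps `d^∨` -/

section EnrichedLemmas

universe v₁ u₁ v₂ u₂

variable {V : Type u₁} [Category.{v₁} V] [MonoidalCategory V] [SymmetricCategory V]
  [MonoidalClosed V] {C : Type u₂} [Category.{v₂} C] [EnrichedOrdinaryCategory V C]

theorem eHomEquiv_comp_left {A B D : C} (f : A ⟶ B) (g : B ⟶ D) :
    eHomEquiv V (f ≫ g) = eHomEquiv V f ≫ eHomWhiskerLeft V A g := by
  rw [eHomEquiv_comp, eHomWhiskerLeft, MonoidalCategory.tensorHom_def,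
    rightUnitor_inv_naturality_assoc, unitors_inv_equal, Category.assoc]

theorem eHomEquiv_comp_right {A B D : C} (f : A ⟶ B) (g : B ⟶ D) :
    eHomEquiv V (f ≫ g) = eHomEquiv V g ≫ eHomWhiskerRight V f D := by
  rw [eHomEquiv_comp, eHomWhiskerRight, MonoidalCategory.tensorHom_def',
    leftUnitor_inv_naturality_assoc, Category.assoc]

theorem unitHomEquiv_eq {X Y : V} (g : 𝟙_ V ⟶ (ihom X).obj Y) :
    unitHomEquiv X Y g = (ρ_ X).inv ≫ MonoidalClosed.uncurry g := by
  simp [unitHomEquiv]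
  rfl

theorem unitHomEquiv_map {X Y Y' : V} (g : 𝟙_ V ⟶ (ihom X).obj Y) (h : Y ⟶ Y') :
    unitHomEquiv X Y' (g ≫ (ihom X).map h) = unitHomEquiv X Y g ≫ h := by
  simp only [unitHomEquiv_eq, MonoidalClosed.uncurry_natural_right, Category.assoc]

theorem unitHomEquiv_pre {X X' Y : V} (g : 𝟙_ V ⟶ (ihom X').obj Y) (f : X ⟶ X') :
    unitHomEquiv X Y (g ≫ (MonoidalClosed.pre f).app Y) = f ≫ unitHomEquiv X' Y g := by
  simp only [unitHomEquiv_eq, MonoidalClosed.uncurry_pre_app]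
  rw [rightUnitor_inv_naturality_assoc]

section Tensored

variable [Tensored V C]

/-- The object `X ⊗ A`. -/
abbrev tensObj (X : V) (A : C) : C := ((Tensored.tens (V := V)).obj X).obj A

theorem tensEquiv_eq (X : V) (A B : C) (f : tensObj X A ⟶ B) :
    tensEquiv X A B f = unitHomEquiv _ _ (eHomEquiv V f ≫ (Tensored.tensIso X A B).hom) := by
  simp [tensEquiv]

theorem tensEquiv_app {X X' : V} (f : X ⟶ X') (A B : C) (h : tensObj X' A ⟶ B) :
    tensEquiv X A B ((Tensored.tens.map f).app A ≫ h) = f ≫ tensEquiv X' A B h := by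
  rw [tensEquiv_eq, tensEquiv_eq, eHomEquiv_comp_right, Category.assoc,
    ← Tensored.tensIso_natural_V, ← Category.assoc, unitHomEquiv_pre]

theorem tensEquiv_map (X : V) {A A' : C} (g : A ⟶ A') (B : C) (h : tensObj X A' ⟶ B) :
    tensEquiv X A B ((Tensored.tens.obj X).map g ≫ h) =
      tensEquiv X A' B h ≫ eHomWhiskerRight V g B := by
  rw [tensEquiv_eq, tensEquiv_eq, eHomEquiv_comp_right, Category.assoc,
    ← Tensored.tensIso_natural_left, ← Category.assoc, unitHomEquiv_map]

theorem tensEquiv_comp (X : V) (A : C) {B B' : C} (h : tensObj X A ⟶ B) (k : B ⟶ B') :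
    tensEquiv X A B' (h ≫ k) = tensEquiv X A B h ≫ eHomWhiskerLeft V A k := by
  rw [tensEquiv_eq, tensEquiv_eq, eHomEquiv_comp_left, Category.assoc,
    ← Tensored.tensIso_natural_right, ← Category.assoc, unitHomEquiv_map]

theorem tensMap_comp {X X' X'' : V} {A A' A'' : C} (f : X ⟶ X') (f' : X' ⟶ X'') (g : A ⟶ A')
    (g' : A' ⟶ A'') : tensMap f g ≫ tensMap f' g' = tensMap (f ≫ f') (g ≫ g') := by
  simp [tensMap]

theorem tensMap_comp_assoc {X X' X'' : V} {A A' A'' B : C} (f : X ⟶ X') (f' : X' ⟶ X'') (g : A ⟶ A')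
    (g' : A' ⟶ A'') (h : tensObj X'' A'' ⟶ B) :
    tensMap f g ≫ tensMap f' g' ≫ h = tensMap (f ≫ f') (g ≫ g') ≫ h := by
  rw [← Category.assoc, tensMap_comp]

theorem tensUnit_natural {A B : C} (g : A ⟶ B) :
    tensMap (𝟙 (𝟙_ V)) g ≫ tensUnit V B = tensUnit V A ≫ g := by
  apply (tensEquiv (𝟙_ V) A B).injective
  rw [tensMap, CategoryTheory.Functor.map_id, NatTrans.id_app, Category.id_comp,
    tensEquiv_map, tensEquiv_comp, tensUnit, tensUnit, Equiv.apply_symm_apply,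
    Equiv.apply_symm_apply,
    ← eHomEquiv_id, ← eHomEquiv_comp_right, ← eHomEquiv_id, ← eHomEquiv_comp_left,
    Category.comp_id, Category.id_comp]

end Tensored

section Cotensored

variable [Cotensored V C]

/-- The object `Map_C(X, A)`. -/
abbrev cotObj (X : V) (A : C) : C := ((Cotensored.cot (V := V)).obj (.op X)).obj A

theorem cotEquiv_eq (X : V) (A B : C) (f : A ⟶ cotObj X B) :
    cotEquiv X A B f = unitHomEquiv _ _ (eHomEquiv V f ≫ (Cotensored.cotIso X A B).hom) := by
  simp [cotEquiv]

theorem cotEquiv_app {X X' : V} (f : X ⟶ X') (A B : C) (h : A ⟶ cotObj X' B) :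
    cotEquiv X A B (h ≫ (Cotensored.cot.map f.op).app B) = f ≫ cotEquiv X' A B h := by
  rw [cotEquiv_eq, cotEquiv_eq, eHomEquiv_comp_left, Category.assoc,
    ← Cotensored.cotIso_natural_V, ← Category.assoc, unitHomEquiv_pre]

theorem cotEquiv_comp (X : V) {A A' : C} (g : A ⟶ A') (B : C) (h : A' ⟶ cotObj X B) :
    cotEquiv X A B (g ≫ h) = cotEquiv X A' B h ≫ eHomWhiskerRight V g B := by
  rw [cotEquiv_eq, cotEquiv_eq, eHomEquiv_comp_right, Category.assoc,
    ← Cotensored.cotIso_natural_left, ← Category.assoc, unitHomEquiv_map]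

theorem cotEquiv_map (X : V) (A : C) {B B' : C} (h : A ⟶ cotObj X B) (k : B ⟶ B') :
    cotEquiv X A B' (h ≫ (Cotensored.cot.obj (.op X)).map k) =
      cotEquiv X A B h ≫ eHomWhiskerLeft V A k := by
  rw [cotEquiv_eq, cotEquiv_eq, eHomEquiv_comp_left, Category.assoc,
    ← Cotensored.cotIso_natural_right, ← Category.assoc, unitHomEquiv_map]

theorem cotMap_comp {X X' X'' : V} {A A' A'' : C} (f : X ⟶ X') (f' : X' ⟶ X'') (g : A ⟶ A')
    (g' : A' ⟶ A'') : cotMap f' g ≫ cotMap f g' = cotMap (f ≫ f') (g ≫ g') := by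
  simp [cotMap]

theorem cotMap_id (X : V) (A : C) : cotMap (𝟙 X) (𝟙 A) = 𝟙 (cotObj X A) := by
  simp [cotMap]

theorem cotEquiv_cotMap {X X' : V} {A B B' : C} (h : A ⟶ cotObj X' B) (f : X ⟶ X') (k : B ⟶ B') :
    cotEquiv X A B' (h ≫ cotMap f k) = f ≫ cotEquiv X' A B h ≫ eHomWhiskerLeft V A k := by
  rw [cotMap, ← Category.assoc, cotEquiv_map, cotEquiv_app, Category.assoc]

variable [Tensored V C]

theorem tensCotEquiv_symm_comp {X : V} {A A' B : C} (g : A ⟶ A') (h : A' ⟶ cotObj X B) :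
    (tensCotEquiv X A B).symm (g ≫ h) = (Tensored.tens.obj X).map g ≫
      (tensCotEquiv X A' B).symm h := by
  apply (tensEquiv X A B).injective
  rw [tensEquiv_map]
  simp only [tensCotEquiv, Equiv.symm_trans_apply, Equiv.apply_symm_apply, Equiv.symm_symm]
  rw [cotEquiv_comp]

theorem tensCotEquiv_symm_cotMap {X X' : V} {A B B' : C} (h : A ⟶ cotObj X' B) (f : X ⟶ X')
    (k : B ⟶ B') : (tensCotEquiv X A B').symm (h ≫ cotMap f k) =
      (Tensored.tens.map f).app A ≫ (tensCotEquiv X' A B).symm h ≫ k := by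
  apply (tensEquiv X A B').injective
  rw [tensEquiv_app, tensEquiv_comp]
  simp only [tensCotEquiv, Equiv.symm_trans_apply, Equiv.apply_symm_apply, Equiv.symm_symm]
  rw [cotEquiv_cotMap]

theorem tensCotEquiv_symm_eq {X : V} {A B : C} (h : A ⟶ cotObj X B) :
    (tensCotEquiv X A B).symm h = (Tensored.tens.obj X).map h ≫ cotEval X B := by
  rw [cotEval, ← tensCotEquiv_symm_comp, Category.comp_id]

/-- Evaluation is dinatural. -/
theorem map_cotMap_cotEval {X X' : V} {B B' : C} (f : X ⟶ X') (k : B ⟶ B') :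
    (Tensored.tens.obj X).map (cotMap f k) ≫ cotEval X B' =
      (Tensored.tens.map f).app (cotObj X' B) ≫ cotEval X' B ≫ k := by
  rw [← tensCotEquiv_symm_eq, ← Category.id_comp (cotMap f k), tensCotEquiv_symm_cotMap]
  rfl

theorem map_comp_cotMap_cotEval {X X' : V} {A B B' : C} (h : A ⟶ cotObj X' B) (f : X ⟶ X')
    (k : B ⟶ B') : (Tensored.tens.obj X).map (h ≫ cotMap f k) ≫ cotEval X B' =
      (Tensored.tens.map f).app A ≫ (Tensored.tens.obj X').map h ≫ cotEval X' B ≫ k := by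
  rw [← tensCotEquiv_symm_eq, tensCotEquiv_symm_cotMap, tensCotEquiv_symm_eq, Category.assoc]

/-- Maps into `Map_C(X, B)` are determined by their adjoints; the identities of `d^∨` are deduced
from those of `d` in this way. -/
theorem cot_hom_ext {X : V} {A B : C} {f g : A ⟶ cotObj X B}
    (h : (Tensored.tens.obj X).map f ≫ cotEval X B = (Tensored.tens.obj X).map g ≫ cotEval X B) :
    f = g := by
  rw [← tensCotEquiv_symm_eq, ← tensCotEquiv_symm_eq] at h
  exact (tensCotEquiv X A B).symm.injective h

theorem map_tensCotEquiv_cotEval {X : V} {A B : C} (f : tensObj X A ⟶ B) :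
    (Tensored.tens.obj X).map (tensCotEquiv X A B f) ≫ cotEval X B = f := by
  rw [← tensCotEquiv_symm_eq, Equiv.symm_apply_apply]

variable (V) in
/-- The canonical map `A ⟶ Map_C(I, A)`. -/
def cotUnit (A : C) : A ⟶ cotObj (𝟙_ V) A := tensCotEquiv (𝟙_ V) A A (tensUnit V A)

theorem tensCotEquiv_tensUnit {X : V} {A B : C} (f : X ⟶ 𝟙_ V) (g : A ⟶ B) :
    tensCotEquiv X A B (tensMap f g ≫ tensUnit V B) = cotUnit V A ≫ cotMap f g := by
  apply (tensCotEquiv X A B).symm.injective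
  rw [Equiv.symm_apply_apply, tensCotEquiv_symm_cotMap, cotUnit, Equiv.symm_apply_apply,
    ← tensUnit_natural]
  simp [tensMap]

/-- Under the adjunction, composition with `cotUnit` becomes the bijection `eHomEquiv`, so that an
inverse is given by the preimage of the identity. -/
theorem isIso_cotUnit (A : C) : IsIso (cotUnit V A) := by
  have h : ∀ {B : C} (f : B ⟶ A), cotEquiv (𝟙_ V) B A (f ≫ cotUnit V A) = eHomEquiv V f := by
    intro B f
    have : cotEquiv (𝟙_ V) A A (cotUnit V A) = eId V A := by
      simp [cotUnit, tensCotEquiv, tensUnit]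
    rw [cotEquiv_comp, this, ← eHomEquiv_id, ← eHomEquiv_comp_right, Category.comp_id]
  refine ⟨(eHomEquiv V).symm (cotEquiv (𝟙_ V) _ A (𝟙 _)), ?_, ?_⟩
  · apply (eHomEquiv V).injective
    rw [← h, ← h]
    congr 1
    rw [Category.id_comp, Category.assoc]
    convert Category.comp_id _
    apply (cotEquiv (𝟙_ V) _ A).injective
    rw [h, Equiv.apply_symm_apply]
  · apply (cotEquiv (𝟙_ V) _ A).injective
    rw [h, Equiv.apply_symm_apply]

end Cotensored

section Distributivity

variable [MonoidalCategory C] [SymmetricCategory C] [SymmetricMonoidalVCategory V C]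

open SymmetricMonoidalVCategory

theorem tens_map_eq (X : V) {A B : C} (f : A ⟶ B) :
    (Tensored.tens.obj X).map f = tensMap (𝟙 X) f := by simp [tensMap]

theorem tens_app_eq {X Y : V} (f : X ⟶ Y) (A : C) :
    (Tensored.tens.map f).app A = tensMap f (𝟙 A) := by simp [tensMap]

theorem tensMap_d {X Y : V} {A A' B B' : C} (f : A ⟶ A') (g : B ⟶ B') :
    (Tensored.tens.obj (X ⊗ Y)).map (f ⊗ₘ g) ≫ d X Y A' B' =
      d X Y A B ≫ ((Tensored.tens.obj X).map f ⊗ₘ (Tensored.tens.obj Y).map g) := by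
  simp only [tens_map_eq]
  rw [← d_natural, id_tensorHom_id]

theorem app_d {X X' Y Y' : V} (A B : C) (f : X ⟶ X') (g : Y ⟶ Y') :
    (Tensored.tens.map (f ⊗ₘ g)).app (A ⊗ B) ≫ d X' Y' A B =
      d X Y A B ≫ ((Tensored.tens.map f).app A ⊗ₘ (Tensored.tens.map g).app B) := by
  simp only [tens_app_eq]
  rw [← d_natural, id_tensorHom_id]

/-- The map adjoint to `d^∨`. -/
theorem map_dCot_cotEval (X Y : V) (A B : C) :
    (Tensored.tens.obj (X ⊗ Y)).map (dCot X Y A B) ≫ cotEval (X ⊗ Y) (A ⊗ B) =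
      d X Y _ _ ≫ (cotEval X A ⊗ₘ cotEval Y B) :=
  map_tensCotEquiv_cotEval _

/-- The map adjoint to `d^∨` after a pair of maps. -/
theorem map_tensorHom_dCot_cotEval {X Y : V} {A B D E : C} (f : D ⟶ cotObj X A)
    (g : E ⟶ cotObj Y B) :
    (Tensored.tens.obj (X ⊗ Y)).map ((f ⊗ₘ g) ≫ dCot X Y A B) ≫ cotEval (X ⊗ Y) (A ⊗ B) =
      d X Y _ _ ≫ (((Tensored.tens.obj X).map f ≫ cotEval X A) ⊗ₘ
        ((Tensored.tens.obj Y).map g ≫ cotEval Y B)) := by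
  rw [Functor.map_comp, Category.assoc, map_dCot_cotEval, ← Category.assoc, tensMap_d,
    Category.assoc, tensorHom_comp_tensorHom]

theorem dCot_natural {X X' Y Y' : V} {A A' B B' : C} (f : X ⟶ X') (g : Y ⟶ Y') (h : A ⟶ A')
    (k : B ⟶ B') : (cotMap f h ⊗ₘ cotMap g k) ≫ dCot X Y A' B' =
      dCot X' Y' A B ≫ cotMap (f ⊗ₘ g) (h ⊗ₘ k) := by
  apply cot_hom_ext
  rw [map_tensorHom_dCot_cotEval, map_cotMap_cotEval, map_cotMap_cotEval, map_comp_cotMap_cotEval]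
  rw [reassoc_of% (map_dCot_cotEval X' Y' A B), reassoc_of% (app_d (cotObj X' A) (cotObj Y' B) f g)]
  simp only [tensorHom_comp_tensorHom]

theorem dCot_assoc (X Y Z : V) (A B D : C) :
    dCot X Y A B ▷ cotObj Z D ≫ dCot (X ⊗ Y) Z (A ⊗ B) D ≫
      cotMap (α_ X Y Z).inv (α_ A B D).hom =
    (α_ _ _ _).hom ≫ cotObj X A ◁ dCot Y Z B D ≫ dCot X (Y ⊗ Z) A (B ⊗ D) := by
  apply cot_hom_ext
  rw [← Category.assoc, map_comp_cotMap_cotEval, ← tensorHom_id,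
    reassoc_of% (map_tensorHom_dCot_cotEval (dCot X Y A B) (𝟙 (cotObj Z D))), map_dCot_cotEval,
    CategoryTheory.Functor.map_id, Category.id_comp, Functor.map_comp, Category.assoc,
    ← id_tensorHom, map_tensorHom_dCot_cotEval, map_dCot_cotEval, CategoryTheory.Functor.map_id,
    Category.id_comp]
  have h := d_assoc X Y Z (cotObj X A) (cotObj Y B) (cotObj Z D)
  have e1 : (d X Y (cotObj X A) (cotObj Y B) ≫ (cotEval X A ⊗ₘ cotEval Y B) ⊗ₘ cotEval Z D) ≫
      (α_ A B D).hom = (d X Y _ _ ▷ _ ≫ (α_ _ _ _).hom) ≫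
        (cotEval X A ⊗ₘ (cotEval Y B ⊗ₘ cotEval Z D)) := by
    rw [Category.assoc, ← associator_naturality, ← tensorHom_id, tensorHom_comp_tensorHom_assoc,
      Category.id_comp]
  have e2 : (cotEval X A ⊗ₘ (d Y Z (cotObj Y B) (cotObj Z D) ≫ (cotEval Y B ⊗ₘ cotEval Z D))) =
      _ ◁ d Y Z _ _ ≫ (cotEval X A ⊗ₘ (cotEval Y B ⊗ₘ cotEval Z D)) := by
    rw [← id_tensorHom, tensorHom_comp_tensorHom, Category.id_comp]
  rw [e1, e2]
  simp only [Category.assoc]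
  rw [reassoc_of% h, tens_app_eq, tens_map_eq, tensMap_comp_assoc]
  simp

theorem dCot_symm (X Y : V) (A B : C) :
    (β_ _ _).hom ≫ dCot Y X B A = dCot X Y A B ≫ cotMap (β_ Y X).hom (β_ A B).hom := by
  apply cot_hom_ext
  rw [Functor.map_comp, Category.assoc, map_dCot_cotEval, map_comp_cotMap_cotEval,
    reassoc_of% (map_dCot_cotEval X Y A B), BraidedCategory.braiding_naturality,
    reassoc_of% (d_symm X Y (cotObj X A) (cotObj Y B)), tens_app_eq, tens_map_eq,
    tensMap_comp_assoc, SymmetricCategory.symmetry, Category.id_comp]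

theorem dCot_unit (X : V) (A : C) :
    (ρ_ _).inv ≫ cotObj X A ◁ cotUnit V (𝟙_ C) ≫ dCot X (𝟙_ V) A (𝟙_ C) ≫
      cotMap (ρ_ X).inv (ρ_ A).hom = 𝟙 _ := by
  apply cot_hom_ext
  rw [← Category.assoc, ← Category.assoc, map_comp_cotMap_cotEval, Category.assoc,
    Functor.map_comp, Category.assoc, ← id_tensorHom,
    reassoc_of% (map_tensorHom_dCot_cotEval (𝟙 (cotObj X A)) (cotUnit V (𝟙_ C))), cotUnit,
    map_tensCotEquiv_cotEval, CategoryTheory.Functor.map_id, Category.id_comp]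
  have h := d_unit X (cotObj X A)
  have e1 : (cotEval X A ⊗ₘ tensUnit V (𝟙_ C)) ≫ (ρ_ A).hom =
      (_ ◁ tensUnit V (𝟙_ C) ≫ (ρ_ _).hom) ≫ cotEval X A := by
    rw [MonoidalCategory.tensorHom_def', Category.assoc, Category.assoc, rightUnitor_naturality]
  rw [e1, tens_app_eq, tens_map_eq, tensMap_comp_assoc,
    Category.comp_id, Category.id_comp]
  simp only [Category.assoc]
  rw [reassoc_of% h]

/-- The unit axiom on the other side follows by symmetry. -/
theorem dCot_unit_left (X : V) (A : C) :
    (λ_ _).inv ≫ cotUnit V (𝟙_ C) ▷ cotObj X A ≫ dCot (𝟙_ V) X (𝟙_ C) A ≫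
      cotMap (λ_ X).inv (λ_ A).hom = 𝟙 _ := by
  rw [← dCot_unit X A, ← rightUnitor_inv_braiding, Category.assoc,
    ← BraidedCategory.braiding_naturality_right_assoc, reassoc_of% (dCot_symm X (𝟙_ V) A (𝟙_ C)),
    cotMap_comp]
  simp

end Distributivity

end EnrichedLemmas

/-! ### Zero maps into mapping objects -/

section Zero

variable {C : Type u} [Category.{v} C] [EnrichedOrdinaryCategory BasedTop C]

theorem BasedTop.comp_const {X Y Z : BasedTop} (f : X ⟶ Y) :
    f ≫ BasedTop.const Y Z = BasedTop.const X Z := rfl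

theorem BasedTop.const_comp {X Y Z : BasedTop} (f : Y ⟶ Z) :
    BasedTop.const X Y ≫ f = BasedTop.const X Z := BasedTop.hom_ext fun _ => BasedTop.map_pt f

theorem BasedTop.const_tensor {X Y Z W : BasedTop} (f : Z ⟶ W) :
    BasedTop.const X Y ⊗ₘ f = BasedTop.const (X ⊗ Z) (Y ⊗ W) :=
  BasedTop.smash_hom_ext fun _ _ => BasedTop.smk_pt_left _

theorem BasedTop.tensor_const {X Y Z W : BasedTop} (f : Z ⟶ W) :
    f ⊗ₘ BasedTop.const X Y = BasedTop.const (Z ⊗ X) (W ⊗ Y) :=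
  BasedTop.smash_hom_ext fun _ _ => BasedTop.smk_pt_right _

theorem unitHomEquiv_const (X Y : BasedTop) :
    unitHomEquiv X Y (BasedTop.const _ _) = BasedTop.const X Y := by
  rw [unitHomEquiv_eq, MonoidalClosed.uncurry_eq, ← id_tensorHom, BasedTop.tensor_const,
    BasedTop.const_comp]
  rfl

variable [Cotensored BasedTop C]

theorem cotEquiv_zeroHom (X : BasedTop) (A B : C) :
    cotEquiv X A B (zeroHom _ _) = BasedTop.const _ _ := by
  rw [cotEquiv_eq, zeroHom, Equiv.apply_symm_apply, BasedTop.const_comp, unitHomEquiv_const]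

/-- Composites with a constant map of the spaces are zero. -/
theorem comp_cotMap_const {X X' : BasedTop} {A B B' : C} (f : A ⟶ cotObj X' B) (g : B ⟶ B') :
    f ≫ cotMap (BasedTop.const X X') g = zeroHom _ _ := by
  apply (cotEquiv X A B').injective
  rw [cotEquiv_cotMap, cotEquiv_zeroHom, BasedTop.const_comp]

/-- Zero maps factor through constant maps of the spaces, whence everything known about `cotMap`
applies to them. -/
theorem zeroHom_eq (X : BasedTop) (A B : C) :
    zeroHom A (cotObj X B) = zeroHom A (cotObj X B) ≫ cotMap (BasedTop.const X X) (𝟙 B) :=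
  (comp_cotMap_const _ _).symm

theorem comp_zeroHom {X : BasedTop} {A A' B : C} (f : A ⟶ A') :
    f ≫ zeroHom A' (cotObj X B) = zeroHom A (cotObj X B) := by
  rw [zeroHom_eq, ← Category.assoc, comp_cotMap_const]

theorem zeroHom_comp {X X' : BasedTop} {A B B' : C} (f : X ⟶ X') (g : B ⟶ B') :
    zeroHom A (cotObj X' B) ≫ cotMap f g = zeroHom A (cotObj X B') := by
  rw [zeroHom_eq, Category.assoc, cotMap_comp, BasedTop.comp_const, comp_cotMap_const]

end Zero

section ZeroTensor

variable {C : Type u} [Category.{v} C] [EnrichedOrdinaryCategory BasedTop C]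
  [MonoidalCategory C] [SymmetricCategory C] [SymmetricMonoidalVCategory BasedTop C]

theorem zeroHom_tensor_dCot {X Y : BasedTop} {A B D E : C} (f : D ⟶ cotObj Y B) :
    (zeroHom E (cotObj X A) ⊗ₘ f) ≫ dCot X Y A B = zeroHom _ _ := by
  have : (zeroHom E (cotObj X A) ⊗ₘ f) =
      (zeroHom E (cotObj X A) ⊗ₘ f) ≫
        (cotMap (BasedTop.const X X) (𝟙 A) ⊗ₘ cotMap (𝟙 Y) (𝟙 B)) := by
    rw [tensorHom_comp_tensorHom, ← zeroHom_eq, cotMap_id, Category.comp_id]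
  rw [this, Category.assoc, dCot_natural, BasedTop.const_tensor, ← Category.assoc,
    comp_cotMap_const]

theorem tensor_zeroHom_dCot {X Y : BasedTop} {A B D E : C} (f : D ⟶ cotObj X A) :
    (f ⊗ₘ zeroHom E (cotObj Y B)) ≫ dCot X Y A B = zeroHom _ _ := by
  have : (f ⊗ₘ zeroHom E (cotObj Y B)) =
      (f ⊗ₘ zeroHom E (cotObj Y B)) ≫
        (cotMap (𝟙 X) (𝟙 A) ⊗ₘ cotMap (BasedTop.const Y Y) (𝟙 B)) := by
    rw [tensorHom_comp_tensorHom, ← zeroHom_eq, cotMap_id, Category.comp_id]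
  rw [this, Category.assoc, dCot_natural, BasedTop.tensor_const, ← Category.assoc,
    comp_cotMap_const]

end ZeroTensor

/-! ### Cocompositions and bijections -/

section CooperadLemmas

variable {C : Type u} [Category.{v} C] [MonoidalCategory C] [SymmetricCategory C] {Q : NEFin → C}

/-- The bijection `A ∪_a B ≃ A' ∪_{a'} B'` induced by bijections `σ`, `τ` with `σ a = a'`. -/
def graftEquiv {A A' B B' : NEFin} (σ : A ≃ A') (τ : B ≃ B') {a : A} {a' : A'} (h : σ a = a') :
    graft A a B ≃ graft A' a' B' :=
  Equiv.sumCongr (σ.subtypeEquiv fun _ => by rw [← h]; exact σ.injective.ne_iff.symm) τ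

/-- The function on `A ∪_a B` given by functions on `A` and `B`. -/
def graftElim {A B : NEFin} {a : A} {S : Type} (f : A → S) (g : B → S) : graft A a B → S :=
  Sum.elim (fun x => f x.1) g

theorem graftElim_graftEquiv {A A' B B' : NEFin} (σ : A ≃ A') (τ : B ≃ B') {a : A} {a' : A'}
    (h : σ a = a') {S : Type} (f : A' → S) (g : B' → S) (x : graft A a B) :
    graftElim f g (graftEquiv σ τ h x) = graftElim (fun x => f (σ x)) (fun y => g (τ y)) x := by
  rcases x with x | x <;> rfl

theorem graftElim_graftAssoc_symm {A B D : NEFin} (a : A) (b : B) {S : Type} (f : A → S)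
    (g : B → S) (k : D → S) (x : graft A a (graft B b D)) :
    graftElim (graftElim f g) k ((graftAssoc A B D a b).symm x) =
      graftElim f (graftElim g k) x := by
  rcases x with x | ⟨x | x⟩ <;> rfl

theorem graftElim_graftComm_symm {A B D : NEFin} (a a' : A) (h : a ≠ a') {S : Type} (f : A → S)
    (g : B → S) (k : D → S) (x : graft (graft A a' D) (inA a h) B) :
    graftElim (graftElim f g) k ((graftComm A B D a a' h).symm x) =
      graftElim (graftElim f k) g x := by
  rcases x with ⟨⟨x, hx⟩ | x, hx'⟩ | x <;> rfl

namespace Cooperad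

variable (q : Cooperad Q)

theorem map_map {A B D : NEFin} (σ : A ≃ B) (τ : B ≃ D) :
    q.map σ ≫ q.map τ = q.map (σ.trans τ) := (q.map_trans σ τ).symm

theorem map_map_assoc {A B D : NEFin} {Z : C} (σ : A ≃ B) (τ : B ≃ D) (f : Q D ⟶ Z) :
    q.map σ ≫ q.map τ ≫ f = q.map (σ.trans τ) ≫ f := by
  rw [← Category.assoc, map_map]

theorem cocomp_map {A A' B B' : NEFin} (σ : A ≃ A') (τ : B ≃ B') {a : A} {a' : A'} (h : σ a = a') :
    q.cocomp A B a ≫ (q.map σ ⊗ₘ q.map τ) = q.map (graftEquiv σ τ h) ≫ q.cocomp A' B' a' := by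
  subst h
  exact (q.cocomp_natural σ τ a).symm

theorem cocomp_map_left {A A' B B' D : NEFin} {a : A} {a' : A'}
    (σ : A ≃ graft A' a' B') (τ : B ≃ D) {b : graft A' a' B'} (h : σ a = b) :
    q.cocomp A B a ≫ ((q.map σ ≫ q.cocomp A' B' a') ⊗ₘ q.map τ) =
      q.map (graftEquiv σ τ h) ≫ q.cocomp (graft A' a' B') D b ≫ q.cocomp A' B' a' ▷ Q D := by
  rw [← Category.assoc, ← cocomp_map q σ τ h, Category.assoc, ← tensorHom_id,
    tensorHom_comp_tensorHom, Category.comp_id]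

theorem cocomp_map_right {A A' B B' D : NEFin} {a : A} {b' : B'}
    (σ : A ≃ A') (τ : B ≃ graft B' b' D) {a' : A'} (h : σ a = a') :
    q.cocomp A B a ≫ (q.map σ ⊗ₘ (q.map τ ≫ q.cocomp B' D b')) =
      q.map (graftEquiv σ τ h) ≫ q.cocomp A' (graft B' b' D) a' ≫ Q A' ◁ q.cocomp B' D b' := by
  rw [← Category.assoc, ← cocomp_map q σ τ h, Category.assoc, ← id_tensorHom,
    tensorHom_comp_tensorHom, Category.comp_id]

end Cooperad

end CooperadLemmas

namespace LTree

variable {A B D : NEFin}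

/-- Bijections from the incoming edges of a vertex agree if they are compatible with the same
injective labelling of the edges by sets. All identities between such bijections are checked on
clusters in this way. -/
theorem Inc.ext_val {T : LTree A} {v : T.Vert} {G : NEFin} {S : Type} (n : Set A → S)
    (hn : Function.Injective n) {t t' : T.inc v ≃ G}
    (w : G → S) (h : ∀ x, w (t x) = n x.1) (h' : ∀ x, w (t' x) = n x.1) : t = t' := by
  refine Equiv.ext fun x => ?_
  have : t.symm (t' x) = x := by
    refine Subtype.ext (hn ?_)
    rw [← h, ← h', Equiv.apply_symm_apply]
  rw [← this, Equiv.apply_symm_apply, this]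

/-! ### Embeddings of trees -/

/-- An embedding of a tree `T` into a tree `S`, as a map of clusters that sends vertices to vertices
and restricts to bijections between the sets of incoming edges. -/
@[ext]
structure Emb (T : LTree A) (S : LTree B) where
  /-- the map of clusters -/
  toFun : Set A → Set B
  injective : Function.Injective toFun
  vert_mem (v : T.Vert) : toFun v.1 ∈ S.clusters ∧ (toFun v.1).Nontrivial
  inc_mem (v : T.Vert) (c : T.inc v) : ∃ d : S.inc ⟨toFun v.1, vert_mem v⟩, d.1 = toFun c.1
  inc_surj (v : T.Vert) (d : S.inc ⟨toFun v.1, vert_mem v⟩) : ∃ c : T.inc v, d.1 = toFun c.1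

namespace Emb

variable {T : LTree A} {S : LTree B} {R : LTree D}

/-- The image of a vertex. -/
def vert (φ : Emb T S) (v : T.Vert) : S.Vert := ⟨φ.toFun v.1, φ.vert_mem v⟩

/-- The bijection between the sets of incoming edges. -/
noncomputable def inc (φ : Emb T S) (v : T.Vert) : T.inc v ≃ S.inc (φ.vert v) :=
  Equiv.ofBijective (fun c => (φ.inc_mem v c).choose) (by
    constructor
    · intro c d h
      refine Subtype.ext (φ.injective ?_)
      rw [← (φ.inc_mem v c).choose_spec, ← (φ.inc_mem v d).choose_spec]
      exact congrArg Subtype.val h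
    · intro d
      obtain ⟨c, hc⟩ := φ.inc_surj v d
      exact ⟨c, Subtype.ext ((φ.inc_mem v c).choose_spec.trans hc.symm)⟩)

@[simp] theorem inc_val (φ : Emb T S) (v : T.Vert) (c : T.inc v) :
    ((φ.inc v) c).1 = φ.toFun c.1 := (φ.inc_mem v c).choose_spec

theorem inc_eq (φ : Emb T S) (v : T.Vert) (t : T.inc v ≃ S.inc (φ.vert v))
    (h : ∀ c, (t c).1 = φ.toFun c.1) : t = φ.inc v :=
  Inc.ext_val φ.toFun φ.injective (fun x => x.1) h (φ.inc_val v)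

/-- The composite of two embeddings. -/
def comp (φ : Emb T S) (ψ : Emb S R) : Emb T R where
  toFun := ψ.toFun ∘ φ.toFun
  injective := ψ.injective.comp φ.injective
  vert_mem v := ψ.vert_mem (φ.vert v)
  inc_mem v c := by
    obtain ⟨d, hd⟩ := φ.inc_mem v c
    obtain ⟨e, he⟩ := ψ.inc_mem (φ.vert v) d
    exact ⟨e, he.trans (congrArg ψ.toFun hd)⟩
  inc_surj v e := by
    obtain ⟨d, hd⟩ := ψ.inc_surj (φ.vert v) e
    obtain ⟨c, hc⟩ := φ.inc_surj v d
    exact ⟨c, hd.trans (congrArg ψ.toFun hc)⟩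

/-- The identification of equal trees. -/
def ofEq {T S : LTree A} (h : T = S) : Emb T S where
  toFun := id
  injective := Function.injective_id
  vert_mem v := h ▸ v.2
  inc_mem v c := by subst h; exact ⟨c, rfl⟩
  inc_surj v c := by subst h; exact ⟨c, rfl⟩

theorem _root_.CobarOperad.LTree.preimageEquiv_symm_ssubset (σ : A ≃ B) {c d : Set A} :
    (preimageEquiv σ).symm c ⊂ (preimageEquiv σ).symm d ↔ c ⊂ d := by
  rw [← ssubset_preimage σ]
  change (preimageEquiv σ) ((preimageEquiv σ).symm c) ⊂
    (preimageEquiv σ) ((preimageEquiv σ).symm d) ↔ _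
  simp only [Equiv.apply_symm_apply]

theorem _root_.CobarOperad.LTree.preimageEquiv_symm_mem (σ : A ≃ B) (T : LTree A) {c : Set A} :
    (preimageEquiv σ).symm c ∈ (T.relabel σ).clusters ↔ c ∈ T.clusters := by
  change (preimageEquiv σ) ((preimageEquiv σ).symm c) ∈ T.clusters ↔ _
  rw [Equiv.apply_symm_apply]

/-- The embedding given by relabelling. -/
def relabel (σ : A ≃ B) (T : LTree A) : Emb T (T.relabel σ) where
  toFun := (preimageEquiv σ).symm
  injective := (preimageEquiv σ).symm.injective
  vert_mem v := ((T.relabelVert σ).symm v).2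
  inc_mem v c := by
    refine ⟨⟨(preimageEquiv σ).symm c.1, (preimageEquiv_symm_mem σ T).mpr c.2.1,
      (preimageEquiv_symm_ssubset σ).mpr c.2.2.1, fun d hd h h' => ?_⟩, rfl⟩
    obtain ⟨d, rfl⟩ := (preimageEquiv σ).symm.surjective d
    exact c.2.2.2 d ((preimageEquiv_symm_mem σ T).mp hd) ((preimageEquiv_symm_ssubset σ).mp h)
      ((preimageEquiv_symm_ssubset σ).mp h')
  inc_surj v d := by
    obtain ⟨d, hd, hdv, hmax⟩ := d
    obtain ⟨c, rfl⟩ := (preimageEquiv σ).symm.surjective d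
    exact ⟨⟨c, (preimageEquiv_symm_mem σ T).mp hd, (preimageEquiv_symm_ssubset σ).mp hdv,
      fun e he h h' => hmax _ ((preimageEquiv_symm_mem σ T).mpr he)
        ((preimageEquiv_symm_ssubset σ).mpr h) ((preimageEquiv_symm_ssubset σ).mpr h')⟩, rfl⟩

/-- The embedding of `T` into `T ∪_a U`. -/
def graftA (T : LTree A) (a : A) (U : LTree B) : Emb T (T.graft a U) where
  toFun := liftA
  injective := liftA_injective
  vert_mem v := (T.graftVert U a (.inl v)).2
  inc_mem v c := ⟨T.graftIncA U a v c, rfl⟩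
  inc_surj v d := ⟨(T.graftIncA U a v).symm d,
    (congrArg Subtype.val ((T.graftIncA U a v).apply_symm_apply d)).symm⟩

/-- The embedding of `U` into `T ∪_a U`. -/
def graftB (T : LTree A) (a : A) (U : LTree B) : Emb U (T.graft a U) where
  toFun := liftB
  injective := liftB_injective
  vert_mem v := (T.graftVert U a (.inr v)).2
  inc_mem v c := ⟨T.graftIncB U a v c, rfl⟩
  inc_surj v d := ⟨(T.graftIncB U a v).symm d,
    (congrArg Subtype.val ((T.graftIncB U a v).apply_symm_apply d)).symm⟩

section push

variable {C : Type u} [Category.{v} C] [MonoidalCategory C] [SymmetricCategory C] {Q : NEFin → C}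
  (q : Cooperad Q)

/-- The maps from the factors of the vertices of `T` to the factors of their images. -/
noncomputable def fam (φ : Emb T S) (v : T.Vert) :
    Multi (fun w : S.Vert => Q (S.inc w)) (Q (T.inc v)) :=
  .pre (q.map (φ.inc v)) (.single _ (φ.vert v))

/-- The choice of the bijection in `fam` is immaterial. -/
theorem fam_eq (φ : Emb T S) {v : T.Vert} {w : S.Vert} (h : φ.vert v = w) (t : T.inc v ≃ S.inc w)
    (ht : ∀ c, (t c).1 = φ.toFun c.1) :
    Multi.pre (q.map t) (.single (fun w : S.Vert => Q (S.inc w)) w) = φ.fam q v := by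
  subst h
  rw [fam, φ.inc_eq v t ht]

variable (Q) in
/-- The identity of `Q(T)`. -/
noncomputable def univ (T : LTree A) : Multi (fun w : T.Vert => Q (T.inc w)) (treeObj Q T) :=
  .univ _

/-- Maps into `Q(T)` agree if they agree up to reordering of the factors. -/
theorem hom_ext {T : LTree A} {y : C} {f g : y ⟶ treeObj Q T}
    (h : Multi.pre f (univ Q T) = Multi.pre g (univ Q T)) : f = g := Multi.hom_ext h

/-- The map of tensor products given by an embedding. -/
noncomputable def push (φ : Emb T S) : Multi (fun w : S.Vert => Q (S.inc w)) (treeObj Q T) :=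
  .bind (univ Q T) (φ.fam q)

theorem fam_comp (φ : Emb T S) (ψ : Emb S R) (v : T.Vert) :
    (φ.fam q v).bind (ψ.fam q) = (φ.comp ψ).fam q v := by
  rw [fam, Multi.bind_pre, Multi.bind_single, fam, Multi.pre_pre, q.map_map, fam]
  congr 2
  exact (φ.comp ψ).inc_eq v ((φ.inc v).trans (ψ.inc (φ.vert v))) fun c =>
    (ψ.inc_val _ _).trans (congrArg ψ.toFun (φ.inc_val v c))

/-- Functoriality of `push`: substituting the maps of `ψ` for the factors of `φ.push` gives the map
of the composite. -/
theorem push_comp (φ : Emb T S) (ψ : Emb S R) :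
    (φ.push q).bind (ψ.fam q) = (φ.comp ψ).push q := by
  rw [push, Multi.bind_bind]
  simp only [fam_comp]
  rfl

theorem push_ofEq (T : LTree A) : (ofEq (rfl : T = T)).push q = univ Q T := by
  refine Eq.trans (congrArg (Multi.bind _) (funext fun v => ?_)) Multi.bind_univ_single
  exact (fam_eq q (ofEq rfl) (w := v) rfl (Equiv.refl _) fun _ => rfl).symm.trans
    (by rw [q.map_refl, Multi.pre_id])

/-- The map `treeRelabel` is the one given by the embedding `Emb.relabel`. -/
theorem pre_treeRelabel (σ : A ≃ B) (T : LTree A) :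
    Multi.pre (q.treeRelabel σ T) (univ Q (T.relabel σ)) = (relabel σ T).push q := by
  refine Multi.pre_injective (bigTensorReindex (fun v => Q (T.inc v)) (T.relabelVert σ)).symm ?_
  rw [push]
  refine Eq.trans ?_ (Multi.bind_pre _ _ _)
  refine Eq.trans ?_ (congrArg (Multi.bind · _) (Multi.pre_bigTensorReindex_inv _).symm)
  refine (Multi.pre_pre _ _ _).trans ?_
  refine (congrArg (Multi.pre · _) (Iso.inv_hom_id_assoc _ _)).trans ?_
  refine (Multi.pre_bigTensorMap _).trans ?_
  rw [Multi.bind_bind]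
  refine (congrArg (Multi.bind _) (funext fun v => ?_))
  rw [Multi.bind_single]
  have hv : (relabel σ T).vert (T.relabelVert σ v) = v := (T.relabelVert σ).symm_apply_apply v
  exact fam_eq q _ hv _ fun c => rfl

/-- The map `treeGraft` is the one given by the two embeddings into the grafted tree. -/
theorem pre_treeGraft (T : LTree A) (a : A) (U : LTree B) :
    Multi.pre (q.treeGraft T a U) (univ Q (T.graft a U)) =
      .tens ((graftA T a U).push q) ((graftB T a U).push q) := by
  refine (Multi.pre_pre _ _ _).symm.trans ?_
  have h1 : Multi.pre ((bigTensorSum fun k => Q ((T.graft a U).inc (T.graftVert U a k))).inv ≫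
      (bigTensorReindex (fun v => Q ((T.graft a U).inc v)) (T.graftVert U a)).inv)
      (Multi.univ _) = .tens
        (.bind (.univ _) fun v => .single _ (T.graftVert U a (.inl v)))
        (.bind (.univ _) fun v => .single _ (T.graftVert U a (.inr v))) := by
    rw [← Multi.pre_pre, Multi.pre_bigTensorReindex_inv, ← Multi.bind_pre,
      Multi.pre_bigTensorSum_inv, Multi.bind_tens, Multi.bind_bind, Multi.bind_bind]
    simp only [Multi.bind_single]
  refine (congrArg (Multi.pre _) h1).trans ?_
  refine (Multi.tens_pre _ _ _ _).symm.trans ?_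
  refine congrArg₂ Multi.tens ?_ ?_
  · refine (Multi.bind_pre _ _ _).symm.trans ?_
    refine (congrArg (Multi.bind · _) (Multi.pre_bigTensorMap _)).trans ?_
    refine (Multi.bind_bind _ _ _).trans (congrArg (Multi.bind _) (funext fun v => ?_))
    rw [Multi.bind_pre, Multi.bind_single]
    exact fam_eq q (graftA T a U) rfl _ fun c => rfl
  · refine (Multi.bind_pre _ _ _).symm.trans ?_
    refine (congrArg (Multi.bind · _) (Multi.pre_bigTensorMap _)).trans ?_
    refine (Multi.bind_bind _ _ _).trans (congrArg (Multi.bind _) (funext fun v => ?_))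
    rw [Multi.bind_pre, Multi.bind_single]
    exact fam_eq q (graftB T a U) rfl _ fun c => rfl

end push

end Emb

end LTree

/-! ### The map given by the collapse of an edge -/

namespace Multi

variable {C : Type u} [Category.{v} C] [MonoidalCategory C] [SymmetricCategory C]

/-- A map of tensor products that splits one factor into two and maps each of the remaining factors
to one factor, written as a substitution. -/
theorem pre_bigTensor_split {ι ι' κ : Type} [Finite ι] [Finite ι'] [Finite κ] {X : ι → C}
    {Y : ι' → C} (e : Option κ ≃ ι') (e₂ : Option (Option κ) ≃ ι)
    (f : Y (e none) ⟶ X (e₂ none) ⊗ X (e₂ (some none)))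
    (g : ∀ r, Y (e (some r)) ⟶ X (e₂ (some (some r)))) (H : ∀ i, Multi X (Y i))
    (h₀ : pre f (tens (single X (e₂ none)) (single X (e₂ (some none)))) = H (e none))
    (h₁ : ∀ r, pre (g r) (single X (e₂ (some (some r)))) = H (e (some r))) :
    pre ((bigTensorReindex Y e).hom ≫ (bigTensorOption fun k => Y (e k)).hom ≫
      (f ⊗ₘ bigTensorMap g) ≫ (α_ _ _ _).hom ≫
      (X (e₂ none) ◁ (bigTensorOption fun k => X (e₂ (some k))).inv) ≫
      (bigTensorOption fun k => X (e₂ k)).inv ≫ (bigTensorReindex X e₂).inv) (univ X) =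
    bind (univ Y) H := by
  have hX : pre ((X (e₂ none) ◁ (bigTensorOption fun k => X (e₂ (some k))).inv) ≫
      (bigTensorOption fun k => X (e₂ k)).inv ≫ (bigTensorReindex X e₂).inv) (univ X) =
      tens (single X (e₂ none)) (tens (single X (e₂ (some none)))
        (bind (univ fun r => X (e₂ (some (some r)))) fun r => single X (e₂ (some (some r))))) := by
    rw [← pre_pre, ← pre_pre, pre_bigTensorReindex_inv, ← bind_pre, pre_bigTensorOption_inv,
      bind_tens, bind_single, ← tens_pre_right, bind_bind]
    simp only [bind_single]
    rw [← bind_pre, pre_bigTensorOption_inv, bind_tens, bind_single, bind_bind]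
    simp only [bind_single]
  have hY : pre ((bigTensorOption fun k => Y (e k)).inv ≫ (bigTensorReindex Y e).inv)
      (bind (univ Y) H) = tens (H (e none))
        (bind (univ fun r => Y (e (some r))) fun r => H (e (some r))) := by
    rw [← bind_pre, ← pre_pre, pre_bigTensorReindex_inv, ← bind_pre, pre_bigTensorOption_inv,
      bind_bind, bind_tens, bind_single, bind_bind]
    simp only [bind_single]
  refine pre_injective (bigTensorReindex Y e ≪≫ bigTensorOption fun k => Y (e k)).symm ?_
  refine Eq.trans ?_ hY.symm
  rw [Iso.symm_hom, pre_pre, Iso.trans_inv]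
  simp only [Category.assoc, Iso.inv_hom_id_assoc]
  rw [← pre_pre, ← pre_pre, hX, tens_assoc, ← tens_pre, h₀, ← bind_pre, pre_bigTensorMap,
    bind_bind]
  simp only [bind_pre, bind_single, h₁]

end Multi

namespace LTree

variable {A B : NEFin}

/-- The bijection between the incoming edges of equal vertices of equal trees. -/
def incCongr {T T' : LTree A} (h : T = T') {v : T.Vert} {v' : T'.Vert} (hv : v.1 = v'.1) :
    T.inc v ≃ T'.inc v' :=
  (Equiv.refl (Set A)).subtypeEquiv fun c => by
    subst h
    rw [hv]
    rfl

/-- The edge of `T` given by an element of `i(l) ∪_c i(u)`. -/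
def incVal {T : LTree A} {l u : T.Vert} {c : T.inc l} :
    NEFin.graft (T.inc l) c (T.inc u) → Set A :=
  graftElim (fun x : T.inc l => x.1) (fun x : T.inc u => x.1)

namespace InternalEdge

variable {T T' : LTree A} (e : T'.InternalEdge)

/-- The bijection `incCollEquiv` is the identity on clusters. -/
theorem incVal_incCollEquiv (x : e.coll.inc e.collVert) :
    incVal (e.incCollEquiv x) = x.1 := by
  obtain ⟨y, rfl⟩ := e.incCollEquiv.symm.surjective x
  rw [Equiv.apply_symm_apply]
  rcases y with y | y <;> rfl

theorem vert_mem {e : T'.InternalEdge} (h : T = e.coll) (v : T.Vert) :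
    v.1 ∈ T'.clusters ∧ v.1.Nontrivial := by
  subst h
  exact ⟨v.2.1.1, v.2.2⟩

theorem vert_ne_up {e : T'.InternalEdge} (h : T = e.coll) (v : T.Vert) : v.1 ≠ e.up.1 := by
  subst h
  exact v.2.1.2

/-- The incoming edges of the lower endpoint of `e` in `T' / e`. -/
noncomputable def incLow (h : T = e.coll) {v : T.Vert} (hv : v.1 = e.low.1) :
    T.inc v ≃ NEFin.graft (T'.inc e.low) e.edge (T'.inc e.up) :=
  (incCongr h hv).trans e.incCollEquiv

theorem incVal_incLow (h : T = e.coll) {v : T.Vert} (hv : v.1 = e.low.1) (x : T.inc v) :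
    incVal (e.incLow h hv x) = x.1 :=
  e.incVal_incCollEquiv (incCongr h hv x)

/-- The incoming edges in `T' / e` of the vertices other than the lower endpoint of `e`. -/
noncomputable def incRest (h : T = e.coll) {v : T.Vert} (hv : v.1 ≠ e.low.1) :
    T.inc v ≃ T'.inc ⟨v.1, vert_mem h v⟩ :=
  (incCongr h rfl).trans (e.incRestEquiv ⟨⟨v.1, vert_mem h v⟩, hv, vert_ne_up h v⟩)

theorem incRest_val (h : T = e.coll) {v : T.Vert} (hv : v.1 ≠ e.low.1) (x : T.inc v) :
    (e.incRest h hv x).1 = x.1 := rfl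

/-- The lower endpoint of an edge is determined by the upper endpoint, as the smallest cluster
properly containing it. -/
theorem low_subset {c : Set A} (hc : c ∈ T'.clusters) (h : e.up.1 ⊂ c) : e.low.1 ⊆ c :=
  (comparable e.low.2.1 hc e.up.2.1 e.up_ssubset.1 h.1).resolve_right
    (e.edge.2.2.2 c hc h)

/-- Every cluster other than the whole set and the singletons is an internal edge; its lower
endpoint is the smallest cluster properly containing it. -/
theorem exists_up_eq (T : LTree A) {c : Set A} (hc : c ∈ T.clusters) (h : c ≠ Set.univ)
    (h' : c.Nontrivial) : ∃ e : T.InternalEdge, e.up.1 = c := by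
  obtain ⟨d, hcd, hd⟩ := (Set.toFinite {d | d ∈ T.clusters ∧ c ⊂ d}).exists_le_minimal
    (a := Set.univ) ⟨T.univ_mem, Set.ssubset_univ_iff.mpr h⟩
  exact ⟨⟨⟨d, hd.prop.1, h'.mono hd.prop.2.1⟩, ⟨c, hc, hd.prop.2, fun f hf hcf hfd =>
    hfd.2 (hd.le_of_le ⟨hf, hcf⟩ hfd.1)⟩, h'⟩, rfl⟩

section map

variable {C : Type u} [Category.{v} C] [MonoidalCategory C] [SymmetricCategory C] {Q : NEFin → C}
  (q : Cooperad Q)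

/-- The map `Q(T) ⟶ Q(T')` for `T = T' / e`. -/
noncomputable def map (h : T = e.coll) : treeObj Q T ⟶ treeObj Q T' :=
  eqToHom (congrArg (treeObj Q) h) ≫ q.collapseMap e

open Classical in
/-- The components of the map `Q(T) ⟶ Q(T')` for `T = T' / e`: a cocomposition at the lower endpoint
of `e`, and the identity, up to renaming of the incoming edges, at the other vertices. -/
noncomputable def fam (h : T = e.coll) (v : T.Vert) :
    Multi (fun w : T'.Vert => Q (T'.inc w)) (Q (T.inc v)) :=
  if hv : v.1 = e.low.1 then
    .pre (q.map (e.incLow h hv) ≫ q.cocomp _ _ e.edge) (.tens (.single _ e.low) (.single _ e.up))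
  else .pre (q.map (e.incRest h hv))
    (.single (fun w : T'.Vert => Q (T'.inc w)) (⟨v.1, vert_mem h v⟩ : T'.Vert))

/-- The component at the lower endpoint, for any names of the vertices and edges of `T'`. -/
theorem fam_low (h : T = e.coll) {v : T.Vert} (hv : v.1 = e.low.1) {l u : T'.Vert}
    {c : T'.inc l} (t : T.inc v ≃ NEFin.graft (T'.inc l) c (T'.inc u))
    (hl : l.1 = e.low.1) (hu : u.1 = e.up.1) (hc : c.1 = e.up.1)
    (ht : ∀ x, incVal (t x) = x.1) :
    Multi.pre (q.map t ≫ q.cocomp _ _ c) (.tens (.single (fun w : T'.Vert => Q (T'.inc w)) l)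
      (.single _ u)) = e.fam q h v := by
  obtain rfl : l = e.low := Subtype.ext hl
  obtain rfl : u = e.up := Subtype.ext hu
  obtain rfl : c = e.edge := Subtype.ext hc
  rw [fam, dif_pos hv, Inc.ext_val id Function.injective_id _ ht (e.incVal_incLow h hv)]

/-- The components at the other vertices, for any names of the vertices of `T'`. -/
theorem fam_rest (h : T = e.coll) {v : T.Vert} (hv : v.1 ≠ e.low.1) {w : T'.Vert}
    (t : T.inc v ≃ T'.inc w) (hw : w.1 = v.1) (ht : ∀ x, (t x).1 = x.1) :
    Multi.pre (q.map t) (.single (fun w : T'.Vert => Q (T'.inc w)) w) = e.fam q h v := by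
  obtain rfl : w = ⟨v.1, vert_mem h v⟩ := Subtype.ext hw
  rw [fam, dif_neg hv, Inc.ext_val id Function.injective_id _ ht (e.incRest_val h hv)]

theorem pre_map (h : T = e.coll) :
    Multi.pre (e.map q h) (Emb.univ Q T') = .bind (Emb.univ Q T) (e.fam q h) := by
  subst h
  refine (congrArg (Multi.pre · _) (Category.id_comp _)).trans ?_
  refine Multi.pre_bigTensor_split e.collVertEquiv e.vertEquiv _ _ _ ?_ fun r => ?_
  · exact e.fam_low q rfl (v := e.collVert) rfl e.incCollEquiv rfl rfl rfl e.incVal_incCollEquiv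
  · exact e.fam_rest q rfl (v := e.restVert r) r.2.1 (e.incRestEquiv r) rfl fun x => rfl

end map

end InternalEdge

section bind

variable {C : Type u} [Category.{v} C] [MonoidalCategory C] [SymmetricCategory C] {Q : NEFin → C}
  (q : Cooperad Q) {ι κ : Type} {I : ι → NEFin} {N : κ → NEFin}

/-- Renaming the edges after a cocomposition. -/
theorem bind_cocomp (H : ∀ i, Multi (fun k => Q (N k)) (Q (I i)))
    {G : NEFin} {l u : ι} {l' u' : κ} {c : I l} {c' : N l'}
    (t : G ≃ NEFin.graft (I l) c (I u)) (s₁ : I l ≃ N l') (s₂ : I u ≃ N u') (h : s₁ c = c')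
    (h₁ : H l = .pre (q.map s₁) (.single _ l')) (h₂ : H u = .pre (q.map s₂) (.single _ u')) :
    Multi.bind (.pre (q.map t ≫ q.cocomp _ _ c)
      (.tens (.single (fun i => Q (I i)) l) (.single _ u))) H =
    .pre (q.map (t.trans (graftEquiv s₁ s₂ h)) ≫ q.cocomp _ _ c')
      (.tens (.single _ l') (.single _ u')) := by
  rw [Multi.bind_pre, Multi.bind_tens, Multi.bind_single, Multi.bind_single, h₁, h₂, Multi.tens_pre,
    Multi.pre_pre, Category.assoc, q.cocomp_map s₁ s₂ h, q.map_map_assoc]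

/-- A cocomposition followed by another one on its lower factor. -/
theorem bind_cocomp_left (H : ∀ i, Multi (fun k => Q (N k)) (Q (I i)))
    {G : NEFin} {l u : ι} {l' m' u' : κ} {c : I l} {c' : N l'} {b : NEFin.graft (N l') c' (N m')}
    (t : G ≃ NEFin.graft (I l) c (I u)) (s₁ : I l ≃ NEFin.graft (N l') c' (N m'))
    (s₂ : I u ≃ N u') (h : s₁ c = b)
    (h₁ : H l = .pre (q.map s₁ ≫ q.cocomp _ _ c') (.tens (.single _ l') (.single _ m')))
    (h₂ : H u = .pre (q.map s₂) (.single _ u')) :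
    Multi.bind (.pre (q.map t ≫ q.cocomp _ _ c)
      (.tens (.single (fun i => Q (I i)) l) (.single _ u))) H =
    .pre (q.map (t.trans (graftEquiv s₁ s₂ h)) ≫ q.cocomp _ _ b ≫ q.cocomp _ _ c' ▷ _)
      (.tens (.tens (.single _ l') (.single _ m')) (.single _ u')) := by
  rw [Multi.bind_pre, Multi.bind_tens, Multi.bind_single, Multi.bind_single, h₁, h₂, Multi.tens_pre,
    Multi.pre_pre, Category.assoc, q.cocomp_map_left s₁ s₂ h, q.map_map_assoc]

/-- A cocomposition followed by another one on its upper factor. -/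
theorem bind_cocomp_right (H : ∀ i, Multi (fun k => Q (N k)) (Q (I i)))
    {G : NEFin} {l u : ι} {l' m' u' : κ} {c : I l} {a : N l'} {c' : N m'}
    (t : G ≃ NEFin.graft (I l) c (I u)) (s₁ : I l ≃ N l')
    (s₂ : I u ≃ NEFin.graft (N m') c' (N u')) (h : s₁ c = a)
    (h₁ : H l = .pre (q.map s₁) (.single _ l'))
    (h₂ : H u = .pre (q.map s₂ ≫ q.cocomp _ _ c') (.tens (.single _ m') (.single _ u'))) :
    Multi.bind (.pre (q.map t ≫ q.cocomp _ _ c)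
      (.tens (.single (fun i => Q (I i)) l) (.single _ u))) H =
    .pre (q.map (t.trans (graftEquiv s₁ s₂ h)) ≫ q.cocomp _ _ a ≫ _ ◁ q.cocomp _ _ c')
      (.tens (.single _ l') (.tens (.single _ m') (.single _ u'))) := by
  rw [Multi.bind_pre, Multi.bind_tens, Multi.bind_single, Multi.bind_single, h₁, h₂, Multi.tens_pre,
    Multi.pre_pre, Category.assoc, q.cocomp_map_right s₁ s₂ h, q.map_map_assoc]

variable {X : ι → C} {G A B D : NEFin} (x : Multi X (Q A)) (y : Multi X (Q B)) (z : Multi X (Q D))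

/-- Sequential coassociativity, after a bijection. -/
theorem pre_cocomp_assoc {a : A} {b : B} {s : G ≃ NEFin.graft (NEFin.graft A a B) (inB b) D}
    {t : G ≃ NEFin.graft A a (NEFin.graft B b D)} (h : s = t.trans (graftAssoc A B D a b).symm) :
    Multi.pre (q.map s ≫ q.cocomp _ _ (inB b) ≫ q.cocomp A B a ▷ Q D) (.tens (.tens x y) z) =
      .pre (q.map t ≫ q.cocomp _ _ a ≫ Q A ◁ q.cocomp B D b) (.tens x (.tens y z)) := by
  rw [h, ← q.map_map, Category.assoc, q.cocomp_assoc, ← Multi.tens_assoc, Multi.pre_pre]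
  simp only [Category.assoc, Iso.inv_hom_id, Category.comp_id]

/-- Parallel coassociativity, after a bijection. -/
theorem pre_cocomp_comm {a a' : A} (ha : a ≠ a')
    {s : G ≃ NEFin.graft (NEFin.graft A a B) (inA a' ha.symm) D}
    {t : G ≃ NEFin.graft (NEFin.graft A a' D) (inA a ha) B}
    (h : s = t.trans (graftComm A B D a a' ha).symm) :
    Multi.pre (q.map s ≫ q.cocomp _ _ (inA a' ha.symm) ≫ q.cocomp A B a ▷ Q D)
        (.tens (.tens x y) z) =
      .pre (q.map t ≫ q.cocomp _ _ (inA a ha) ≫ q.cocomp A D a' ▷ Q B) (.tens (.tens x z) y) := by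
  rw [h, ← q.map_map, Category.assoc, q.cocomp_comm, ← Multi.tens_assoc, ← Multi.tens_assoc,
    ← Multi.tens_braid z y, Multi.tens_pre_right]
  simp only [Multi.pre_pre, Category.assoc, Iso.inv_hom_id, Category.comp_id]

end bind

/-! ### Independence of the order of collapses -/

namespace InternalEdge

theorem incLow_eq {T T' : LTree A} {e : T'.InternalEdge} (h : T = e.coll) {v : T.Vert}
    (hv : v.1 = e.low.1) {x : T.inc v} {y : NEFin.graft (T'.inc e.low) e.edge (T'.inc e.up)}
    (hxy : x.1 = incVal y) : e.incLow h hv x = y := by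
  obtain ⟨x', rfl⟩ := (e.incLow h hv).surjective y
  rw [incVal_incLow] at hxy
  rw [Subtype.ext hxy]

theorem incVal_graftEquiv {B : NEFin} {T : LTree A} {S : LTree B} {l u : T.Vert} {l' u' : S.Vert}
    {c : T.inc l} {c' : S.inc l'} {n : Set A → Set B} {s₁ : T.inc l ≃ S.inc l'}
    {s₂ : T.inc u ≃ S.inc u'} (h : s₁ c = c') (h₁ : ∀ x, (s₁ x).1 = n x.1)
    (h₂ : ∀ x, (s₂ x).1 = n x.1) (y : NEFin.graft (T.inc l) c (T.inc u)) :
    incVal (graftEquiv s₁ s₂ h y) = n (incVal y) := by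
  refine (graftElim_graftEquiv _ _ _ _ _ _).trans ?_
  rcases y with y | y
  · exact h₁ _
  · exact h₂ _

section square

variable {C : Type u} [Category.{v} C] [MonoidalCategory C] [SymmetricCategory C] {Q : NEFin → C}
  (q : Cooperad Q)

variable {T₀ T₁ T : LTree A} {e : T.InternalEdge} {f₁ : T₁.InternalEdge}
  (h₁ : T₁ = e.coll) (hf : T₀ = f₁.coll) {v : T₀.Vert}

/-- A vertex at which neither of two successive collapses takes place. -/
theorem bind_fam_rest_rest (hv₁ : v.1 ≠ f₁.low.1) (hv₂ : v.1 ≠ e.low.1) {w : T.Vert}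
    (t : T₀.inc v ≃ T.inc w) (hw : w.1 = v.1) (ht : ∀ x, (t x).1 = x.1) :
    (f₁.fam q hf v).bind (e.fam q h₁) =
      Multi.pre (q.map t) (.single (fun w : T.Vert => Q (T.inc w)) w) := by
  rw [fam, dif_neg hv₁, Multi.bind_pre, Multi.bind_single,
    ← e.fam_rest q h₁ (v := ⟨v.1, vert_mem hf v⟩) hv₂ (w := w)
      ((f₁.incRest hf hv₁).symm.trans t) hw ?_, Multi.pre_pre, q.map_map]
  · rw [← Equiv.trans_assoc, Equiv.self_trans_symm, Equiv.refl_trans]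
  · intro x
    obtain ⟨x, rfl⟩ := (f₁.incRest hf hv₁).surjective x
    rw [Equiv.trans_apply, Equiv.symm_apply_apply, ht, incRest_val]

/-- A vertex at which only the collapse of `e` takes place. -/
theorem bind_fam_rest_low (hv₁ : v.1 ≠ f₁.low.1) (hv₂ : v.1 = e.low.1) {l u : T.Vert}
    {c : T.inc l} (t : T₀.inc v ≃ NEFin.graft (T.inc l) c (T.inc u))
    (hl : l.1 = e.low.1) (hu : u.1 = e.up.1) (hc : c.1 = e.up.1)
    (ht : ∀ x, incVal (t x) = x.1) :
    (f₁.fam q hf v).bind (e.fam q h₁) =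
      Multi.pre (q.map t ≫ q.cocomp _ _ c) (.tens (.single (fun w : T.Vert => Q (T.inc w)) l)
        (.single _ u)) := by
  rw [fam, dif_neg hv₁, Multi.bind_pre, Multi.bind_single,
    ← e.fam_low q h₁ (v := ⟨v.1, vert_mem hf v⟩) hv₂
      ((f₁.incRest hf hv₁).symm.trans t) hl hu hc ?_, Multi.pre_pre, q.map_map_assoc]
  · rw [← Equiv.trans_assoc, Equiv.self_trans_symm, Equiv.refl_trans]
  · intro x
    obtain ⟨x, rfl⟩ := (f₁.incRest hf hv₁).surjective x
    rw [Equiv.trans_apply, Equiv.symm_apply_apply, ht, incRest_val]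

/-- A vertex at which only the collapse of `f₁` takes place. -/
theorem bind_fam_low_rest (hv₁ : v.1 = f₁.low.1) (hv₂ : v.1 ≠ e.low.1) (hu' : f₁.up.1 ≠ e.low.1)
    {l u : T.Vert} {c : T.inc l} (t : T₀.inc v ≃ NEFin.graft (T.inc l) c (T.inc u))
    (hl : l.1 = f₁.low.1) (hu : u.1 = f₁.up.1) (hc : c.1 = f₁.up.1)
    (ht : ∀ x, incVal (t x) = x.1) :
    (f₁.fam q hf v).bind (e.fam q h₁) =
      Multi.pre (q.map t ≫ q.cocomp _ _ c) (.tens (.single (fun w : T.Vert => Q (T.inc w)) l)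
        (.single _ u)) := by
  have hl' : f₁.low.1 ≠ e.low.1 := hv₁ ▸ hv₂
  obtain rfl : l = ⟨f₁.low.1, vert_mem h₁ f₁.low⟩ := Subtype.ext hl
  obtain rfl : u = ⟨f₁.up.1, vert_mem h₁ f₁.up⟩ := Subtype.ext hu
  obtain rfl : c = e.incRest h₁ hl' f₁.edge := Subtype.ext hc
  rw [fam, dif_pos hv₁, bind_cocomp q (e.fam q h₁) (f₁.incLow hf hv₁) (e.incRest h₁ hl')
    (e.incRest h₁ hu') rfl (dif_neg hl') (dif_neg hu')]
  congr 3
  refine Inc.ext_val id Function.injective_id incVal (fun x => ?_) ht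
  exact (incVal_graftEquiv (n := id) rfl (fun _ => rfl) (fun _ => rfl) _).trans
    (f₁.incVal_incLow hf hv₁ x)

end square

end InternalEdge

end LTree

namespace LTree

variable {A B : NEFin}

namespace InternalEdge

section square

variable {C : Type u} [Category.{v} C] [MonoidalCategory C] [SymmetricCategory C] {Q : NEFin → C}
  (q : Cooperad Q)

variable {T₀ T₁ T₂ T : LTree A} {e f : T.InternalEdge} {f₁ : T₁.InternalEdge}
  {e₂ : T₂.InternalEdge} (h₁ : T₁ = e.coll) (hf : T₀ = f₁.coll) (h₂ : T₂ = f.coll)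
  (he : T₀ = e₂.coll) (hfu : f₁.up.1 = f.up.1) (heu : e₂.up.1 = e.up.1)

include h₁ hfu

/-- Unless `f` starts at the upper endpoint of `e`, collapsing `e` does not change the lower
endpoint of `f`. -/
theorem low_of_ne (h : f.low.1 ≠ e.up.1) : f₁.low.1 = f.low.1 := by
  refine (low_subset f₁ ?_ ?_).antisymm (low_subset f ?_ ?_)
  · subst h₁
    exact ⟨f.low.2.1, h⟩
  · exact hfu ▸ f.up_ssubset
  · exact (vert_mem h₁ f₁.low).1
  · exact hfu ▸ f₁.up_ssubset

/-- If `f` starts at the upper endpoint of `e`, it starts at the lower endpoint of `e` after `e` is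
collapsed. -/
theorem low_of_eq (h : f.low.1 = e.up.1) : f₁.low.1 = e.low.1 := by
  have h' : e.up.1 ⊆ f₁.low.1 :=
    h ▸ low_subset f (vert_mem h₁ f₁.low).1 (hfu ▸ f₁.up_ssubset)
  refine (low_subset f₁ ?_ ?_).antisymm (low_subset e (vert_mem h₁ f₁.low).1
    (h'.ssubset_of_ne (vert_ne_up h₁ f₁.low).symm))
  · subst h₁
    exact ⟨e.low.2.1, e.up_ssubset.ne'⟩
  · rw [hfu]
    exact f.up_ssubset.trans (h ▸ e.up_ssubset)

include h₂ heu

/-- The vertices that are not the lower endpoint of `e` or `f`. -/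
theorem bind_fam_rest (v : T₀.Vert) (hve : v.1 ≠ e.low.1) (hvf : v.1 ≠ f.low.1) :
    (f₁.fam q hf v).bind (e.fam q h₁) = (e₂.fam q he v).bind (f.fam q h₂) := by
  have h1 : v.1 ≠ f₁.low.1 := by
    by_cases h : f.low.1 = e.up.1
    · rwa [low_of_eq h₁ hfu h]
    · rwa [low_of_ne h₁ hfu h]
  have h2 : v.1 ≠ e₂.low.1 := by
    by_cases h : e.low.1 = f.up.1
    · rwa [low_of_eq h₂ heu h]
    · rwa [low_of_ne h₂ heu h]
  let t := (f₁.incRest hf h1).trans (e.incRest h₁ (v := ⟨v.1, vert_mem hf v⟩) hve)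
  exact (bind_fam_rest_rest q h₁ hf h1 hve t rfl fun _ => rfl).trans
    (bind_fam_rest_rest q h₂ he h2 hvf t rfl fun _ => rfl).symm

/-- The lower endpoint of `e`, if `e` and `f` have no common endpoint. -/
theorem bind_fam_disjoint (v : T₀.Vert) (hv : v.1 = e.low.1) (hef : e.low.1 ≠ f.low.1)
    (h : f.low.1 ≠ e.up.1) (h' : e.low.1 ≠ f.up.1) :
    (f₁.fam q hf v).bind (e.fam q h₁) = (e₂.fam q he v).bind (f.fam q h₂) := by
  have h1 : v.1 ≠ f₁.low.1 := by rwa [low_of_ne h₁ hfu h, hv]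
  have h2 : v.1 = e₂.low.1 := by rwa [low_of_ne h₂ heu h']
  have ht : ∀ x, incVal (((f₁.incRest hf h1).trans
      (e.incLow h₁ (v := ⟨v.1, vert_mem hf v⟩) hv)) x) = x.1 := fun x =>
    e.incVal_incLow h₁ (v := ⟨v.1, vert_mem hf v⟩) hv (f₁.incRest hf h1 x)
  exact (bind_fam_rest_low q h₁ hf h1 hv _ rfl rfl rfl ht).trans
    (bind_fam_low_rest q h₂ he h2 (hv ▸ hef) (heu ▸ h.symm) _ (hv ▸ h2) heu.symm heu.symm ht).symm

omit h₂ heu in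
theorem graftElim_incVal {l : T.Vert} {v : T₀.Vert}
    {b : NEFin.graft (T.inc e.low) e.edge (T.inc e.up)}
    (hv : v.1 = f₁.low.1) (hl : f₁.low.1 = e.low.1)
    (s : T₁.inc f₁.up ≃ T.inc l) (hs : ∀ x, (s x).1 = x.1) (hb : e.incLow h₁ hl f₁.edge = b)
    (x : T₀.inc v) :
    graftElim incVal (fun c : T.inc l => c.1)
      (((f₁.incLow hf hv).trans (graftEquiv (e.incLow h₁ hl) s hb)) x) = x.1 := by
  refine (graftElim_graftEquiv _ _ hb _ _ _).trans ?_
  refine Eq.trans ?_ (f₁.incVal_incLow hf hv x)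
  rw [incVal]
  congr 1
  · exact funext fun y => e.incVal_incLow h₁ hl y
  · exact funext hs

/-- The lower endpoint of `e`, if `f` starts at the upper endpoint of `e`: sequential
coassociativity. -/
theorem bind_fam_chain (v : T₀.Vert) (hv : v.1 = e.low.1) (h : f.low.1 = e.up.1) :
    (f₁.fam q hf v).bind (e.fam q h₁) = (e₂.fam q he v).bind (f.fam q h₂) := by
  obtain ⟨fl, fe, fn⟩ := f
  obtain rfl : fl = e.up := Subtype.ext h
  have hfe : fe.1 ⊂ e.up.1 := fe.2.2.1
  have hfl := low_of_eq h₁ hfu h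
  have hel := low_of_ne h₂ heu (hfe.trans e.up_ssubset).ne'
  have hv₁ : v.1 = f₁.low.1 := hv.trans hfl.symm
  have hv₂ : v.1 = e₂.low.1 := hv.trans hel.symm
  have hfu' : f₁.up.1 ≠ e.low.1 := hfu.trans_ne (hfe.trans e.up_ssubset).ne
  have hel' : e₂.low.1 ≠ e.up.1 := hel.trans_ne e.up_ssubset.ne'
  have hb : e.incLow h₁ hfl f₁.edge = inB fe := incLow_eq h₁ hfl hfu
  let s : T₁.inc f₁.up ≃ T.inc ⟨fe.1, fe.2.1, fn⟩ := (e.incRest h₁ hfu').trans (incCongr rfl hfu)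
  let s' : T₂.inc e₂.low ≃ T.inc e.low := (incRest _ h₂ hel').trans (incCongr rfl hel)
  have hs' : s' e₂.edge = e.edge := Subtype.ext heu
  let f : T.InternalEdge := ⟨e.up, fe, fn⟩
  rw [fam, dif_pos hv₁, fam, dif_pos hv₂,
    bind_cocomp_left q (e.fam q h₁) (f₁.incLow hf hv₁) (e.incLow h₁ hfl) s hb (dif_pos hfl)
      (fam_rest e q h₁ hfu' s hfu.symm fun _ => rfl).symm,
    bind_cocomp_right q (f.fam q h₂) (e₂.incLow he hv₂) s' (f.incLow h₂ heu) hs'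
      (fam_rest f q h₂ hel' s' hel.symm fun _ => rfl).symm (dif_pos heu)]
  refine pre_cocomp_assoc q _ _ _ ?_
  refine Inc.ext_val id Function.injective_id _
    (graftElim_incVal h₁ hf hfu hv₁ hfl s (fun _ => rfl) hb) fun x => ?_
  refine (graftElim_graftAssoc_symm _ _ _ _ _ _).trans ?_
  refine (graftElim_graftEquiv _ _ hs' _ _ _).trans ?_
  refine Eq.trans ?_ (e₂.incVal_incLow he hv₂ x)
  rw [incVal]
  congr 1
  exact funext fun y => f.incVal_incLow h₂ heu y

/-- The common lower endpoint of `e` and `f`: parallel coassociativity. -/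
theorem bind_fam_siblings (v : T₀.Vert) (hv : v.1 = e.low.1) (h : e.low.1 = f.low.1)
    (hne : e.up.1 ≠ f.up.1) :
    (f₁.fam q hf v).bind (e.fam q h₁) = (e₂.fam q he v).bind (f.fam q h₂) := by
  obtain ⟨fl, fe, fn⟩ := f
  obtain rfl : e.low = fl := Subtype.ext h
  let f : T.InternalEdge := ⟨e.low, fe, fn⟩
  have hfl := low_of_ne h₁ hfu e.up_ssubset.ne'
  have hel := low_of_ne h₂ heu f.up_ssubset.ne'
  have hv₁ : v.1 = f₁.low.1 := hv.trans hfl.symm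
  have hv₂ : v.1 = e₂.low.1 := hv.trans hel.symm
  have hfu' : f₁.up.1 ≠ e.low.1 := hfu.trans_ne f.up_ssubset.ne
  have heu' : e₂.up.1 ≠ e.low.1 := heu.trans_ne e.up_ssubset.ne
  have hne' : e.edge ≠ fe := fun h => hne (congrArg (fun c : T.inc e.low => c.1) h)
  have hb : e.incLow h₁ hfl f₁.edge = inA fe hne'.symm := incLow_eq h₁ hfl hfu
  have hb' : f.incLow h₂ hel e₂.edge = inA e.edge hne' := incLow_eq h₂ hel heu
  let s : T₁.inc f₁.up ≃ T.inc f.up := (e.incRest h₁ hfu').trans (incCongr rfl hfu)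
  let s' : T₂.inc e₂.up ≃ T.inc e.up := (f.incRest h₂ heu').trans (incCongr rfl heu)
  rw [fam, dif_pos hv₁, fam, dif_pos hv₂,
    bind_cocomp_left q (e.fam q h₁) (f₁.incLow hf hv₁) (e.incLow h₁ hfl) s hb (dif_pos hfl)
      (fam_rest e q h₁ hfu' s hfu.symm fun _ => rfl).symm,
    bind_cocomp_left q (f.fam q h₂) (e₂.incLow he hv₂) (f.incLow h₂ hel) s' hb' (dif_pos hel)
      (fam_rest f q h₂ heu' s' heu.symm fun _ => rfl).symm]
  refine pre_cocomp_comm q _ _ _ hne' ?_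
  refine Inc.ext_val id Function.injective_id _
    (graftElim_incVal h₁ hf hfu hv₁ hfl s (fun _ => rfl) hb) fun x => ?_
  refine (graftElim_graftComm_symm _ _ _ _ _ _ _).trans ?_
  exact graftElim_incVal (e := f) h₂ he heu hv₂ hel s' (fun _ => rfl) hb' x

/-- Collapsing two edges in either order gives the same map: this is the coassociativity of the
cooperad, in its sequential form if the edges form a path, in its parallel form if they have the
same lower endpoint. -/
theorem map_square : f₁.map q hf ≫ e.map q h₁ = e₂.map q he ≫ f.map q h₂ := by
  have hne : e.up.1 ≠ f.up.1 := fun h => vert_ne_up h₁ f₁.up (hfu.trans h.symm)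
  refine Emb.hom_ext ?_
  rw [← Multi.pre_pre, ← Multi.pre_pre, pre_map, pre_map, ← Multi.bind_pre, ← Multi.bind_pre,
    pre_map, pre_map, Multi.bind_bind, Multi.bind_bind]
  refine congrArg (Multi.bind _) (funext fun v => ?_)
  have hve : v.1 ≠ e.up.1 := heu ▸ vert_ne_up he v
  have hvf : v.1 ≠ f.up.1 := hfu ▸ vert_ne_up hf v
  by_cases h1 : v.1 = e.low.1
  · by_cases h2 : v.1 = f.low.1
    · exact bind_fam_siblings q h₁ hf h₂ he hfu heu v h1 (h1.symm.trans h2) hne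
    · by_cases h3 : f.low.1 = e.up.1
      · exact bind_fam_chain q h₁ hf h₂ he hfu heu v h1 h3
      · exact bind_fam_disjoint q h₁ hf h₂ he hfu heu v h1 (h1 ▸ h2) h3 (h1 ▸ hvf)
  · by_cases h2 : v.1 = f.low.1
    · by_cases h3 : e.low.1 = f.up.1
      · exact (bind_fam_chain q h₂ he h₁ hf heu hfu v h2 h3).symm
      · exact (bind_fam_disjoint q h₂ he h₁ hf heu hfu v h2 (h2 ▸ h1) h3 (h2 ▸ hve)).symm
    · exact bind_fam_rest q h₁ hf h₂ he hfu heu v h1 h2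

end square

end InternalEdge

end LTree

/-! ### The functor `Q_A` -/

namespace LTree

variable {A B : NEFin}

instance : Finite (LTree A) :=
  Finite.of_injective clusters fun _ _ => LTree.ext

/-- An internal edge is determined by its cluster. -/
theorem InternalEdge.eq_of_up {T : LTree A} {e f : T.InternalEdge} (h : e.up.1 = f.up.1) :
    e = f := by
  obtain ⟨el, ee, en⟩ := e
  obtain ⟨fl, fe, fn⟩ := f
  have hl : el = fl := Subtype.ext ((low_subset ⟨el, ee, en⟩ fl.2.1 (h ▸ fe.2.2.1)).antisymm
    (low_subset ⟨fl, fe, fn⟩ el.2.1 (h ▸ ee.2.2.1)))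
  subst hl
  obtain rfl : ee = fe := Subtype.ext h
  rfl

theorem exists_coll {T T' : LTree A} (h : T ≤ T') (hne : T ≠ T') :
    ∃ e : T'.InternalEdge, T ≤ e.coll := by
  have : ¬ T'.clusters ⊆ T.clusters := fun h' => hne (le_antisymm h h')
  obtain ⟨c, hc, hcT⟩ := Set.not_subset.mp this
  have hn : c.Nontrivial := by
    rcases (T'.nonempty_of_mem c hc).exists_eq_singleton_or_nontrivial with ⟨a, rfl⟩ | hn
    · exact (hcT (T.singleton_mem a)).elim
    · exact hn
  obtain ⟨e, he⟩ := InternalEdge.exists_up_eq T' hc (fun hu => hcT (hu ▸ T.univ_mem)) hn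
  exact ⟨e, fun d hd => ⟨h hd, fun hde => hcT (he ▸ Set.mem_singleton_iff.mp hde ▸ hd)⟩⟩

theorem InternalEdge.coll_lt {T : LTree A} (e : T.InternalEdge) : e.coll < T :=
  lt_of_le_of_ne e.coll_le fun h =>
    ((congrArg (e.up.1 ∈ clusters ·) h).mpr e.up.2.1 : e.up.1 ∈ e.coll.clusters).2 rfl

/-- An inequality of trees is a sequence of collapses of edges. -/
theorem coll_induction {T : LTree A} {p : ∀ T', T ≤ T' → Prop} (refl : p T le_rfl)
    (step : ∀ (T' : LTree A) (e : T'.InternalEdge) (h : T ≤ e.coll), p e.coll h →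
      p T' (h.trans e.coll_le)) (T' : LTree A) (h : T ≤ T') : p T' h := by
  induction T' using WellFoundedLT.induction with
  | ind T' ih =>
    by_cases hT : T = T'
    · subst hT
      exact refl
    · obtain ⟨e, he⟩ := exists_coll h hT
      exact step T' e he (ih _ e.coll_lt he)

/-- Two edges of a tree can be collapsed in either order. -/
theorem InternalEdge.exists_square {T : LTree A} {e f : T.InternalEdge} (h : e.up.1 ≠ f.up.1) :
    ∃ (f₁ : e.coll.InternalEdge) (e₂ : f.coll.InternalEdge),
      f₁.up.1 = f.up.1 ∧ e₂.up.1 = e.up.1 ∧ f₁.coll = e₂.coll := by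
  obtain ⟨f₁, hf⟩ := exists_up_eq e.coll (c := f.up.1) ⟨f.up.2.1, fun h' => h h'.symm⟩
    f.up_ne_univ f.nontrivial
  obtain ⟨e₂, he⟩ := exists_up_eq f.coll (c := e.up.1) ⟨e.up.2.1, fun h' => h h'⟩
    e.up_ne_univ e.nontrivial
  refine ⟨f₁, e₂, hf, he, LTree.ext ?_⟩
  change (T.clusters \ {e.up.1}) \ {f₁.up.1} = (T.clusters \ {f.up.1}) \ {e₂.up.1}
  rw [hf, he, Set.sdiff_sdiff_comm]

section functor

variable {C : Type u} [Category.{v} C] [MonoidalCategory C] [SymmetricCategory C] {Q : NEFin → C}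
  (q : Cooperad Q)

/-- The composites of maps `Q(T' / e) ⟶ Q(T')`. -/
inductive IsPath (T : LTree A) : ∀ {T' : LTree A}, (treeObj Q T ⟶ treeObj Q T') → Prop
  | refl : IsPath T (𝟙 (treeObj Q T))
  | step {T₁ T' : LTree A} (e : T'.InternalEdge) (h : T₁ = e.coll)
      {f : treeObj Q T ⟶ treeObj Q T₁} : IsPath T f → IsPath T (f ≫ e.map q h)

namespace IsPath

variable {q} {T T' T'' : LTree A}

theorem le {f : treeObj Q T ⟶ treeObj Q T'} (hf : IsPath q T f) : T ≤ T' := by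
  induction hf with
  | refl => exact le_rfl
  | step e h _ ih => exact ih.trans (h ▸ e.coll_le)

theorem trans {f : treeObj Q T ⟶ treeObj Q T'} (hf : IsPath q T f)
    {g : treeObj Q T' ⟶ treeObj Q T''} (hg : IsPath q T' g) : IsPath q T (f ≫ g) := by
  induction hg with
  | refl => rwa [Category.comp_id]
  | step e h _ ih =>
    rw [← Category.assoc]
    exact ih.step e h

theorem _root_.CobarOperad.LTree.exists_isPath (q : Cooperad Q) (h : T ≤ T') :
    ∃ f : treeObj Q T ⟶ treeObj Q T', IsPath q T f := by
  induction T', h using coll_induction with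
  | refl => exact ⟨_, .refl⟩
  | step T' e h ih =>
    obtain ⟨f, hf⟩ := ih
    exact ⟨_, hf.step e rfl⟩

/-- By the square lemma, the composite does not depend on the order of the collapses. -/
theorem unique {f g : treeObj Q T ⟶ treeObj Q T'} (hf : IsPath q T f) (hg : IsPath q T g) :
    f = g := by
  induction T' using WellFoundedLT.induction with
  | ind T' ih =>
    cases hf with
    | refl =>
      cases hg with
      | refl => rfl
      | step e h hg =>
        subst h
        exact (hg.le.trans_lt e.coll_lt).false.elim
    | step e h hf =>
      subst h
      cases hg with
      | refl => exact (hf.le.trans_lt e.coll_lt).false.elim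
      | step e' h hg =>
        subst h
        by_cases hee : e.up.1 = e'.up.1
        · obtain rfl := InternalEdge.eq_of_up hee
          rw [ih _ e.coll_lt hf hg]
        -- Both composites agree with one through the tree in which both edges are collapsed.
        · obtain ⟨f₁, e₂, h1, h2, h⟩ := InternalEdge.exists_square hee
          have hT : T ≤ f₁.coll := fun c hc => ⟨hf.le hc, fun hc' =>
            (hg.le hc).2 ((Set.mem_singleton_iff.mp hc').trans h1)⟩
          obtain ⟨k, hk⟩ := exists_isPath q hT
          rw [ih _ e.coll_lt hf (hk.step f₁ rfl), ih _ e'.coll_lt hg (hk.step e₂ h),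
            Category.assoc, Category.assoc,
            InternalEdge.map_square q rfl rfl rfl h h1 h2]

end IsPath

theorem InternalEdge.map_rfl {T : LTree A} (e : T.InternalEdge) :
    e.map q rfl = q.collapseMap e := Category.id_comp _

/-- The maps of every functor as in the definition of `TreeFunctor` are composites of the maps of
collapses. -/
theorem isPath_map (D : q.TreeFunctor A) {T T' : LTree A} (h : T ≤ T') :
    IsPath q T (D.map h) := by
  induction T', h using coll_induction with
  | refl => exact D.map_refl T ▸ .refl
  | step T' e h ih =>
    rw [D.map_trans h e.coll_le, D.map_collapse, ← e.map_rfl]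
    exact ih.step e rfl

theorem map_coll (D : q.TreeFunctor A) {T T' : LTree A} (e : T'.InternalEdge) (h : T = e.coll)
    (h' : T ≤ T') : D.map h' = e.map q h := by
  subst h
  rw [D.map_collapse, e.map_rfl]

variable (A) in
/-- The functor `Q_A`. -/
noncomputable def treeFunctor : q.TreeFunctor A where
  map h := (exists_isPath q h).choose
  map_refl T := (exists_isPath q le_rfl).choose_spec.unique .refl
  map_trans h h' := (exists_isPath q (h.trans h')).choose_spec.unique
    ((exists_isPath q h).choose_spec.trans (exists_isPath q h').choose_spec)
  map_collapse e := by
    refine ((exists_isPath q e.coll_le).choose_spec.unique (IsPath.refl.step e rfl)).trans ?_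
    rw [Category.id_comp, e.map_rfl]

variable (A) in
noncomputable instance : Unique (q.TreeFunctor A) where
  default := treeFunctor A q
  uniq D := by
    have : ∀ D' : q.TreeFunctor A, @D.map = @D'.map := fun D' => by
      funext T T' h
      exact (isPath_map q D h).unique (isPath_map q D' h)
    have h := this (treeFunctor A q)
    cases D
    cases h' : treeFunctor A q
    rw [h'] at h
    congr

end functor

/-! ### Embeddings and collapses -/

namespace Emb

section

variable {C : Type u} [Category.{v} C] [MonoidalCategory C] [SymmetricCategory C] {Q : NEFin → C}
  (q : Cooperad Q) {T T' : LTree A} {S S' : LTree B}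

/-- Compatibility of embeddings with collapses: the embedding `φ` of `T' / e` and the embedding `φ'`
of `T'` are given by the same map of clusters, and `e'` is the image of `e`. -/
theorem bind_push_fam {φ : Emb T S} {φ' : Emb T' S'} (hφ : φ.toFun = φ'.toFun)
    {e : T'.InternalEdge} (h : T = e.coll) {e' : S'.InternalEdge} (h' : S = e'.coll)
    (hlow : e'.low.1 = φ'.toFun e.low.1) (hup : e'.up.1 = φ'.toFun e.up.1) :
    (φ.push q).bind (e'.fam q h') = Multi.pre (e.map q h) (φ'.push q) := by
  rw [push, push, ← Multi.bind_pre, e.pre_map, Multi.bind_bind, Multi.bind_bind]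
  refine congrArg (Multi.bind _) (funext fun v => ?_)
  rw [fam, Multi.bind_pre, Multi.bind_single]
  by_cases hv : v.1 = e.low.1
  · have hv' : (φ.vert v).1 = e'.low.1 := by
      rw [hlow, ← hφ, ← hv]
      rfl
    let s₁ : T'.inc e.low ≃ S'.inc e'.low := (φ'.inc e.low).trans (incCongr rfl hlow.symm)
    let s₂ : T'.inc e.up ≃ S'.inc e'.up := (φ'.inc e.up).trans (incCongr rfl hup.symm)
    have hs₁ : ∀ x, (s₁ x).1 = φ'.toFun x.1 := fun x => φ'.inc_val _ x
    have hs₂ : ∀ x, (s₂ x).1 = φ'.toFun x.1 := fun x => φ'.inc_val _ x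
    have hs : s₁ e.edge = e'.edge := Subtype.ext ((hs₁ _).trans hup.symm)
    rw [InternalEdge.fam, dif_pos hv', InternalEdge.fam, dif_pos hv,
      bind_cocomp q (φ'.fam q) _ s₁ s₂ hs
        (φ'.fam_eq q (v := e.low) (Subtype.ext hlow.symm) s₁ hs₁).symm
        (φ'.fam_eq q (v := e.up) (Subtype.ext hup.symm) s₂ hs₂).symm,
      Multi.pre_pre, q.map_map_assoc]
    congr 3
    refine Inc.ext_val φ'.toFun φ'.injective incVal (fun x => ?_) fun x => ?_
    · refine (e'.incVal_incLow h' hv' _).trans ((φ.inc_val v x).trans ?_)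
      rw [hφ]
    · exact (InternalEdge.incVal_graftEquiv hs hs₁ hs₂ _).trans
        (congrArg _ (e.incVal_incLow h hv x))
  · have hv' : (φ.vert v).1 ≠ e'.low.1 := by
      rw [hlow, ← hφ]
      exact fun h => hv (φ.injective h)
    rw [← e'.fam_rest q h' hv' (w := φ'.vert ⟨v.1, InternalEdge.vert_mem h v⟩)
      ((φ.inc v).symm.trans ((e.incRest h hv).trans (φ'.inc _)))
      (congrFun hφ v.1).symm ?_, Multi.pre_pre, q.map_map, InternalEdge.fam, dif_neg hv,
      Multi.bind_pre, Multi.bind_single, fam, Multi.pre_pre, q.map_map, ← Equiv.trans_assoc,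
      Equiv.self_trans_symm, Equiv.refl_trans]
    intro x
    obtain ⟨x, rfl⟩ := (φ.inc v).surjective x
    rw [Equiv.trans_apply, Equiv.symm_apply_apply, φ.inc_val, hφ]
    exact φ'.inc_val _ _

/-- Collapses of edges whose lower endpoint is not in the image of an embedding have no effect. -/
theorem bind_push_fam_rest {φ : Emb T S} {φ' : Emb T S'} (hφ : φ.toFun = φ'.toFun)
    {e' : S'.InternalEdge} (h' : S = e'.coll) (hlow : ∀ v : T.Vert, φ.toFun v.1 ≠ e'.low.1) :
    (φ.push q).bind (e'.fam q h') = φ'.push q := by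
  rw [push, push, Multi.bind_bind]
  refine congrArg (Multi.bind _) (funext fun v => ?_)
  rw [fam, Multi.bind_pre, Multi.bind_single]
  rw [← e'.fam_rest q h' (v := φ.vert v) (hlow v) (w := φ'.vert v)
    ((φ.inc v).symm.trans (φ'.inc v)) (congrFun hφ v.1).symm ?_, Multi.pre_pre, q.map_map, fam,
    ← Equiv.trans_assoc, Equiv.self_trans_symm, Equiv.refl_trans]
  intro x
  obtain ⟨x, rfl⟩ := (φ.inc v).surjective x
  rw [Equiv.trans_apply, Equiv.symm_apply_apply, φ.inc_val, hφ]
  exact φ'.inc_val _ _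

end

/-- The image of an internal edge. -/
noncomputable def edge {T : LTree A} {S : LTree B} (φ : Emb T S) (e : T.InternalEdge) :
    S.InternalEdge :=
  ⟨φ.vert e.low, φ.inc e.low e.edge, φ.inc_val e.low e.edge ▸ (φ.vert_mem e.up).2⟩

theorem edge_low {T : LTree A} {S : LTree B} (φ : Emb T S) (e : T.InternalEdge) :
    (φ.edge e).low.1 = φ.toFun e.low.1 := rfl

theorem edge_up {T : LTree A} {S : LTree B} (φ : Emb T S) (e : T.InternalEdge) :
    (φ.edge e).up.1 = φ.toFun e.up.1 := φ.inc_val e.low e.edge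

theorem mem_coll {T : LTree A} {S : LTree B} (φ : Emb T S) (e : T.InternalEdge) {c : Set B} :
    c ∈ (φ.edge e).coll.clusters ↔ c ∈ S.clusters ∧ c ≠ φ.toFun e.up.1 := by
  rw [← φ.edge_up e]
  rfl

end Emb

theorem relabel_mono (σ : A ≃ B) {T T' : LTree A} (h : T ≤ T') : T.relabel σ ≤ T'.relabel σ :=
  fun _ hc => h hc

theorem graft_mono (a : A) {T T' : LTree A} {U U' : LTree B} (h : T ≤ T') (h' : U ≤ U') :
    T.graft a U ≤ T'.graft a U' :=
  Set.union_subset_union (Set.image_mono h) (Set.image_mono h')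

theorem relabel_coll (σ : A ≃ B) {T : LTree A} (e : T.InternalEdge) :
    e.coll.relabel σ = ((Emb.relabel σ T).edge e).coll := by
  ext c
  rw [Emb.mem_coll]
  refine and_congr Iff.rfl (not_congr ?_)
  exact (Equiv.eq_symm_apply (preimageEquiv σ)).symm

/-- The cluster `{a}` of the lower tree and the root edge of the upper tree are identified, and no
others. -/
theorem liftA_ne_liftB {a : A} {c : Set A} (hc : c.Nontrivial) (d : Set B) :
    (liftA c : Set (NEFin.graft A a B)) ≠ liftB d := fun h => by
  obtain ⟨h1, -⟩ := liftA_subset_liftB hc.nonempty h.subset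
  exact Set.not_nontrivial_singleton (h1 ▸ hc)

theorem graft_coll_left (a : A) {T : LTree A} (U : LTree B) (e : T.InternalEdge) :
    e.coll.graft a U = ((Emb.graftA T a U).edge e).coll := by
  ext c
  rw [Emb.mem_coll]
  constructor
  · rintro (⟨c, ⟨hc, hce⟩, rfl⟩ | ⟨c, hc, rfl⟩)
    · exact ⟨.inl ⟨c, hc, rfl⟩, fun h => hce (liftA_injective h)⟩
    · exact ⟨.inr ⟨c, hc, rfl⟩, (liftA_ne_liftB e.nontrivial c).symm⟩
  · rintro ⟨⟨c, hc, rfl⟩ | ⟨c, hc, rfl⟩, hne⟩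
    · exact .inl ⟨c, ⟨hc, fun h => hne (congrArg liftA h)⟩, rfl⟩
    · exact .inr ⟨c, hc, rfl⟩

theorem graft_coll_right (a : A) (T : LTree A) {U : LTree B} (e : U.InternalEdge) :
    T.graft a e.coll = ((Emb.graftB T a U).edge e).coll := by
  ext c
  rw [Emb.mem_coll]
  constructor
  · rintro (⟨c, hc, rfl⟩ | ⟨c, ⟨hc, hce⟩, rfl⟩)
    · refine ⟨.inl ⟨c, hc, rfl⟩, fun h => e.up_ne_univ ?_⟩
      exact (liftA_subset_liftB (T.nonempty_of_mem c hc) h.subset).2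
    · exact ⟨.inr ⟨c, hc, rfl⟩, fun h => hce (liftB_injective h)⟩
  · rintro ⟨⟨c, hc, rfl⟩ | ⟨c, hc, rfl⟩, hne⟩
    · exact .inl ⟨c, hc, rfl⟩
    · exact .inr ⟨c, ⟨hc, fun h => hne (congrArg liftB h)⟩, rfl⟩

section

variable {C : Type u} [Category.{v} C] [MonoidalCategory C] [SymmetricCategory C] {Q : NEFin → C}
  {q : Cooperad Q}

/-- Naturality of relabelling. -/
theorem map_treeRelabel (DA : q.TreeFunctor A) (DB : q.TreeFunctor B) (σ : A ≃ B)
    {T T' : LTree A} (h : T ≤ T') :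
    DA.map h ≫ q.treeRelabel σ T' = q.treeRelabel σ T ≫ DB.map (relabel_mono σ h) := by
  induction T', h using coll_induction with
  | refl => rw [DA.map_refl, DB.map_refl, Category.id_comp, Category.comp_id]
  | step T' e h ih =>
    rw [DA.map_trans h e.coll_le,
      DB.map_trans (relabel_mono σ h) (relabel_mono σ e.coll_le), ← Category.assoc, ← ih,
      Category.assoc, Category.assoc]
    congr 1
    rw [map_coll q DA e rfl, map_coll q DB _ (relabel_coll σ e)]
    refine Emb.hom_ext ?_
    rw [← Multi.pre_pre, ← Multi.pre_pre, Emb.pre_treeRelabel, InternalEdge.pre_map,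
      ← Multi.bind_pre, Emb.pre_treeRelabel]
    exact (Emb.bind_push_fam q (φ := Emb.relabel σ e.coll) (φ' := Emb.relabel σ T') rfl rfl
      (relabel_coll σ e) rfl (Emb.edge_up _ e)).symm

theorem map_treeGraft_left (DA : q.TreeFunctor A) (a : A) (D : q.TreeFunctor (NEFin.graft A a B))
    {T T' : LTree A} (h : T ≤ T') (U : LTree B) :
    DA.map h ▷ treeObj Q U ≫ q.treeGraft T' a U =
      q.treeGraft T a U ≫ D.map (graft_mono a h le_rfl) := by
  induction T', h using coll_induction with
  | refl => rw [DA.map_refl, D.map_refl, id_whiskerRight, Category.id_comp, Category.comp_id]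
  | step T' e h ih =>
    rw [DA.map_trans h e.coll_le, D.map_trans (graft_mono a h le_rfl)
      (graft_mono a e.coll_le le_rfl), ← Category.assoc, ← ih, comp_whiskerRight,
      Category.assoc, Category.assoc]
    congr 1
    rw [map_coll q DA e rfl, map_coll q D _ (graft_coll_left a U e)]
    refine Emb.hom_ext ?_
    rw [← Multi.pre_pre, ← Multi.pre_pre, Emb.pre_treeGraft, InternalEdge.pre_map,
      ← Multi.bind_pre, Emb.pre_treeGraft, Multi.bind_tens, ← Multi.tens_pre_left]
    refine congrArg₂ Multi.tens (Emb.bind_push_fam q (φ := Emb.graftA e.coll a U)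
      (φ' := Emb.graftA T' a U) rfl rfl _ rfl (Emb.edge_up _ e)).symm ?_
    exact (Emb.bind_push_fam_rest q (φ := Emb.graftB e.coll a U) (φ' := Emb.graftB T' a U) rfl _
      fun v h => liftA_ne_liftB e.low.2.2 v.1 h.symm).symm

theorem map_treeGraft_right (DB : q.TreeFunctor B) (a : A) (D : q.TreeFunctor (NEFin.graft A a B))
    (T : LTree A) {U U' : LTree B} (h : U ≤ U') :
    treeObj Q T ◁ DB.map h ≫ q.treeGraft T a U' =
      q.treeGraft T a U ≫ D.map (graft_mono a le_rfl h) := by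
  induction U', h using coll_induction with
  | refl => rw [DB.map_refl, D.map_refl, MonoidalCategory.whiskerLeft_id, Category.id_comp,
      Category.comp_id]
  | step U' e h ih =>
    rw [DB.map_trans h e.coll_le, D.map_trans (graft_mono a le_rfl h)
      (graft_mono a le_rfl e.coll_le), ← Category.assoc, ← ih, MonoidalCategory.whiskerLeft_comp,
      Category.assoc, Category.assoc]
    congr 1
    rw [map_coll q DB e rfl, map_coll q D _ (graft_coll_right a T e)]
    refine Emb.hom_ext ?_
    rw [← Multi.pre_pre, ← Multi.pre_pre, Emb.pre_treeGraft, InternalEdge.pre_map,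
      ← Multi.bind_pre, Emb.pre_treeGraft, Multi.bind_tens, ← Multi.tens_pre_right]
    refine congrArg₂ Multi.tens ?_ (Emb.bind_push_fam q (φ := Emb.graftB T a e.coll)
      (φ' := Emb.graftB T a U') rfl rfl _ rfl (Emb.edge_up _ e)).symm
    exact (Emb.bind_push_fam_rest q (φ := Emb.graftA T a e.coll) (φ' := Emb.graftA T a U') rfl _
      fun v h => liftA_ne_liftB v.2.2 e.low.1 (h.trans (Emb.edge_low _ e))).symm

/-- Naturality of grafting. -/
theorem map_treeGraft (DA : q.TreeFunctor A) (DB : q.TreeFunctor B) (a : A)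
    (D : q.TreeFunctor (NEFin.graft A a B)) {T T' : LTree A} (h : T ≤ T') {U U' : LTree B}
    (h' : U ≤ U') :
    (DA.map h ⊗ₘ DB.map h') ≫ q.treeGraft T' a U' =
      q.treeGraft T a U ≫ D.map (graft_mono a h h') := by
  rw [MonoidalCategory.tensorHom_def', Category.assoc, map_treeGraft_left DA a D,
    ← Category.assoc, map_treeGraft_right DB a D, Category.assoc, ← D.map_trans]

end

end LTree

namespace LTree

variable {A A' B B' D : NEFin}

/-! ### Grafted trees -/

section Graft

variable {a : A}

theorem mem_liftB (z : NEFin.graft A a B) (d : Set B) :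
    z ∈ liftB d ↔ Sum.elim (fun _ => False) (fun y => y ∈ d) z := by
  rcases z with x | y
  · exact iff_false_intro fun ⟨_, _, h⟩ => Sum.inr_ne_inl h
  · exact inB_injective.mem_set_image

theorem liftA_mem_graft {T : LTree A} {U : LTree B} {c : Set A} :
    liftA c ∈ (T.graft a U).clusters ↔ c ∈ T.clusters := by
  refine ⟨?_, liftA_mem T U⟩
  rintro (⟨c', hc, h⟩ | ⟨d, hd, h⟩)
  · exact liftA_injective h ▸ hc
  · have hc : c.Nonempty := by
      obtain ⟨b, hb⟩ := U.nonempty_of_mem d hd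
      exact ⟨a, (h.subset ⟨b, hb, rfl⟩ : _)⟩
    rw [(liftA_subset_liftB hc h.symm.subset).1]
    exact T.singleton_mem a

theorem liftB_mem_graft {T : LTree A} {U : LTree B} {d : Set B} :
    liftB d ∈ (T.graft a U).clusters ↔ d ∈ U.clusters := by
  refine ⟨?_, liftB_mem T U⟩
  rintro (⟨c, hc, h⟩ | ⟨d', hd, h⟩)
  · rw [(liftA_subset_liftB (T.nonempty_of_mem c hc) h.subset).2]
    exact U.univ_mem
  · exact liftB_injective h ▸ hd

theorem graft_le_iff {T T' : LTree A} {U U' : LTree B} :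
    T.graft a U ≤ T'.graft a U' ↔ T ≤ T' ∧ U ≤ U' :=
  ⟨fun h => ⟨fun _ hc => liftA_mem_graft.mp (h (liftA_mem T U hc)),
    fun _ hd => liftB_mem_graft.mp (h (liftB_mem T U hd))⟩, fun h => graft_mono a h.1 h.2⟩

variable (a) in
/-- Grafting, as an embedding of partial orders. -/
def graftEmb : LTree A × LTree B ↪o LTree (NEFin.graft A a B) :=
  OrderEmbedding.ofMapLEIff (fun p => p.1.graft a p.2) fun _ _ => graft_le_iff

/-- A tree arises by grafting if and only if it has an edge below exactly the leaves in `B`. -/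
theorem exists_graft {V : LTree (NEFin.graft A a B)} (hV : liftB Set.univ ∈ V.clusters) :
    ∃ (T : LTree A) (U : LTree B), T.graft a U = V := by
  let T : LTree A :=
    { clusters := {c | liftA c ∈ V.clusters}
      nonempty_of_mem := fun c hc => by
        obtain ⟨x, hx⟩ := V.nonempty_of_mem _ hc
        exact ⟨_, hx⟩
      univ_mem := V.univ_mem
      singleton_mem := fun x => by
        by_cases hx : x = a
        · subst hx
          exact (congrArg (· ∈ V.clusters) liftB_univ).mp hV
        · refine (congrArg (· ∈ V.clusters) (?_ : liftA {x} = {inA x hx})).mpr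
            (V.singleton_mem (inA x hx))
          ext (⟨y, hy⟩ | b)
          · exact ⟨fun h => congrArg Sum.inl (Subtype.ext h),
              fun h => congrArg Subtype.val (Sum.inl_injective h)⟩
          · exact iff_of_false (fun h => hx (Eq.symm h)) Sum.inr_ne_inl
      laminar := fun c hc d hd => by
        have := V.laminar _ hc _ hd
        rwa [liftA_subset, liftA_subset, liftA, liftA,
          Set.disjoint_preimage_iff proj_surjective] at this }
  let U : LTree B :=
    { clusters := {d | liftB d ∈ V.clusters}
      nonempty_of_mem := fun d hd => Set.image_nonempty.mp (V.nonempty_of_mem _ hd)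
      univ_mem := hV
      singleton_mem := fun b => by
        have : (liftB {b} : Set (NEFin.graft A a B)) = {inB b} := Set.image_singleton
        exact (congrArg (· ∈ V.clusters) this).mpr (V.singleton_mem _)
      laminar := fun c hc d hd => by
        have := V.laminar _ hc _ hd
        rwa [liftB_subset, liftB_subset, liftB, liftB,
          Set.disjoint_image_iff inB_injective] at this }
  refine ⟨T, U, LTree.ext (Set.Subset.antisymm ?_ fun c hc => ?_)⟩
  · rintro _ (⟨c, hc, rfl⟩ | ⟨d, hd, rfl⟩)
    · exact hc
    · exact hd
  -- By laminarity, a cluster is contained in `liftB univ`, and comes from `U`, or contains it or is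
  -- disjoint from it, and comes from `T`.
  · by_cases hcB : c ⊆ liftB Set.univ
    · right
      have : liftB (inB ⁻¹' c) = c := by
        ext z
        rw [mem_liftB]
        rcases z with x | y
        · exact (iff_false_intro fun h => (mem_liftB (Sum.inl x) _).mp (hcB h)).symm
        · rfl
      exact ⟨inB ⁻¹' c, (congrArg (· ∈ V.clusters) this).mpr hc, this⟩
    · left
      have : liftA (proj '' c) = c := by
        refine Set.Subset.antisymm (fun z hz => ?_) (Set.subset_preimage_image _ _)
        obtain ⟨w, hw, hwz⟩ := hz
        rcases z with z | z
        · rcases w with w | w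
          · rwa [show z = w from Subtype.ext hwz.symm]
          · exact (z.2 hwz.symm).elim
        · rcases w with w | w
          · exact (w.2 hwz).elim
          · rcases V.laminar c hc _ hV with h | h | h
            · exact (hcB h).elim
            · exact h ((mem_liftB (Sum.inr z) _).mpr trivial)
            · exact (Set.disjoint_left.mp h hw ((mem_liftB (Sum.inr w) _).mpr trivial)).elim
      exact ⟨proj '' c, (congrArg (· ∈ V.clusters) this).mpr hc, this⟩

/-- The trees of the form `T ∪_a U` are an upward closed family. -/
theorem mem_range_graftEmb {V : LTree (NEFin.graft A a B)} :
    V ∈ Set.range (graftEmb (B := B) a) ↔ liftB Set.univ ∈ V.clusters := by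
  constructor
  · rintro ⟨⟨T, U⟩, rfl⟩
    exact liftB_mem T U U.univ_mem
  · intro h
    obtain ⟨T, U, h⟩ := exists_graft h
    exact ⟨(T, U), h⟩

end Graft

/-! ### Relabelling of grafted trees -/

theorem clusters_relabel (σ : A ≃ B) (T : LTree A) :
    (T.relabel σ).clusters = (preimageEquiv σ).symm '' T.clusters :=
  ((preimageEquiv σ).image_symm_eq_preimage _).symm

/-- Relabelling, as an isomorphism of partial orders. -/
def relabelIso (σ : A ≃ B) : LTree A ≃o LTree B where
  toFun := relabel σ
  invFun := relabel σ.symm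
  left_inv T := LTree.ext (by
    rw [clusters_relabel, clusters_relabel, Set.image_image]
    exact (Set.image_congr fun c _ => (preimageEquiv σ).apply_symm_apply c).trans
      (Set.image_id _))
  right_inv T := LTree.ext (by
    rw [clusters_relabel, clusters_relabel, Set.image_image]
    exact (Set.image_congr fun c _ => (preimageEquiv σ.symm).apply_symm_apply c).trans
      (Set.image_id _))
  map_rel_iff' {T T'} := by
    change (T.relabel σ).clusters ⊆ (T'.relabel σ).clusters ↔ _
    rw [clusters_relabel, clusters_relabel,
      Set.image_subset_image_iff (preimageEquiv σ).symm.injective]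
    rfl

section

variable (a : A) (σ : A ≃ A') (τ : B ≃ B')

theorem graftCongr_liftA (c : Set A) : (preimageEquiv (graftCongr σ τ a)).symm (liftA c) =
    liftA ((preimageEquiv σ).symm c) := by
  ext (x | y)
  · rfl
  · refine Eq.to_iff (congrArg (· ∈ c) ?_)
    exact (σ.symm_apply_apply a).symm

theorem graftCongr_liftB (d : Set B) : (preimageEquiv (graftCongr σ τ a)).symm (liftB d) =
    liftB ((preimageEquiv τ).symm d) := by
  ext z
  refine (mem_liftB ((graftCongr σ τ a).symm z) d).trans (Iff.trans ?_ (mem_liftB z _).symm)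
  rcases z with x | y <;> rfl

theorem relabel_graft (T : LTree A) (U : LTree B) :
    (T.graft a U).relabel (graftCongr σ τ a) = (T.relabel σ).graft (σ a) (U.relabel τ) := by
  refine LTree.ext ?_
  change _ = liftA '' (T.relabel σ).clusters ∪ liftB '' (U.relabel τ).clusters
  rw [clusters_relabel, clusters_relabel, clusters_relabel]
  change _ '' (liftA '' T.clusters ∪ liftB '' U.clusters) = _
  simp only [Set.image_union, Set.image_image, graftCongr_liftA, graftCongr_liftB]

end

section

variable (a : A) (b : B)

theorem graftAssoc_liftA_liftA (c : Set A) :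
    (preimageEquiv (graftAssoc A B D a b)).symm (liftA (liftA c)) = liftA c := by
  ext (x | x | x) <;> rfl

theorem graftAssoc_liftA_liftB (c : Set B) :
    (preimageEquiv (graftAssoc A B D a b)).symm (liftA (liftB c)) = liftB (liftA c) := by
  ext z
  refine (mem_liftB (proj ((graftAssoc A B D a b).symm z)) c).trans
    (Iff.trans ?_ (mem_liftB z _).symm)
  rcases z with x | x | x <;> rfl

theorem graftAssoc_liftB (c : Set D) :
    (preimageEquiv (graftAssoc A B D a b)).symm (liftB c) = liftB (liftB c) := by
  ext z
  refine (mem_liftB ((graftAssoc A B D a b).symm z) c).trans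
    (Iff.trans ?_ (mem_liftB z _).symm)
  rcases z with x | z
  · rfl
  · refine Iff.trans ?_ (mem_liftB z c).symm
    rcases z with x | x <;> rfl

theorem relabel_graftAssoc (T : LTree A) (U : LTree B) (R : LTree D) :
    ((T.graft a U).graft (inB b) R).relabel (graftAssoc A B D a b) = T.graft a (U.graft b R) := by
  refine LTree.ext ?_
  rw [clusters_relabel]
  change _ '' (liftA '' (liftA '' T.clusters ∪ liftB '' U.clusters) ∪ liftB '' R.clusters) =
    liftA '' T.clusters ∪ liftB '' (liftA '' U.clusters ∪ liftB '' R.clusters)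
  simp only [Set.image_union, Set.image_image, graftAssoc_liftA_liftA, graftAssoc_liftA_liftB,
    graftAssoc_liftB, Set.union_assoc]

end

section

variable {a a' : A} (h : a ≠ a')

theorem graftComm_liftA_liftA (c : Set A) :
    (preimageEquiv (graftComm A B D a a' h)).symm (liftA (liftA c)) = liftA (liftA c) := by
  ext (⟨x | x, hx⟩ | x) <;> rfl

theorem graftComm_liftA_liftB (c : Set B) :
    (preimageEquiv (graftComm A B D a a' h)).symm (liftA (liftB c)) = liftB c := by
  ext z
  refine (mem_liftB (proj ((graftComm A B D a a' h).symm z)) c).trans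
    (Iff.trans ?_ (mem_liftB z _).symm)
  rcases z with ⟨x | x, hx⟩ | x <;> rfl

theorem graftComm_liftB (c : Set D) :
    (preimageEquiv (graftComm A B D a a' h)).symm (liftB c) = liftA (liftB c) := by
  ext z
  refine (mem_liftB ((graftComm A B D a a' h).symm z) c).trans
    (Iff.trans ?_ (mem_liftB (proj z) c).symm)
  rcases z with ⟨x | x, hx⟩ | x <;> rfl

theorem relabel_graftComm (T : LTree A) (U : LTree B) (R : LTree D) :
    ((T.graft a U).graft (inA a' h.symm) R).relabel (graftComm A B D a a' h) =
      (T.graft a' R).graft (inA a h) U := by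
  refine LTree.ext ?_
  rw [clusters_relabel]
  change _ '' (liftA '' (liftA '' T.clusters ∪ liftB '' U.clusters) ∪ liftB '' R.clusters) =
    liftA '' (liftA '' T.clusters ∪ liftB '' R.clusters) ∪ liftB '' U.clusters
  simp only [Set.image_union, Set.image_image, graftComm_liftA_liftA, graftComm_liftA_liftB,
    graftComm_liftB]
  exact Set.union_right_comm _ _ _

end

theorem clusters_one (I : LTree NEFin.one) : I.clusters = {Set.univ} := by
  ext c
  refine ⟨fun hc => eq_univ_of_one (I.nonempty_of_mem c hc), fun hc => ?_⟩
  rw [Set.mem_singleton_iff.mp hc]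
  exact I.univ_mem

theorem graftOneLeft_liftB (c : Set A) :
    (preimageEquiv (graftOneLeft A)).symm (liftB c) = c := by
  ext x
  exact mem_liftB (Sum.inr x) c

theorem relabel_graftOneLeft (I : LTree NEFin.one) (T : LTree A) :
    (I.graft () T).relabel (graftOneLeft A) = T := by
  refine LTree.ext ?_
  rw [clusters_relabel]
  change _ '' (liftA '' I.clusters ∪ liftB '' T.clusters) = _
  rw [clusters_one, Set.image_union, Set.image_image, Set.image_image]
  simp only [graftOneLeft_liftB, Set.image_id']
  refine Set.union_eq_right.mpr ?_
  rintro _ ⟨c, rfl, rfl⟩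
  exact T.univ_mem

theorem graftOneRight_liftA (a : A) (c : Set A) :
    (preimageEquiv (graftOneRight A a)).symm c = liftA c := by
  ext (x | x) <;> rfl

theorem relabel_graftOneRight (a : A) (T : LTree A) (I : LTree NEFin.one) :
    T.relabel (graftOneRight A a) = T.graft a I := by
  refine LTree.ext ?_
  rw [clusters_relabel]
  change _ = liftA '' T.clusters ∪ liftB '' I.clusters
  rw [clusters_one, Set.image_singleton, liftB_univ]
  simp only [graftOneRight_liftA]
  refine (Set.union_eq_left.mpr ?_).symm
  rintro _ rfl
  exact ⟨{a}, T.singleton_mem a, rfl⟩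

end LTree

namespace LTree

variable {A A' B B' D : NEFin}

/-! ### Weightings -/

open Classical in
/-- The length of the edge `c` for the weighting `x`, where sets that are not edges get length
`0`. -/
noncomputable def len {T : LTree A} (x : T.Weighting) (c : Set A) : unitInterval :=
  if h : c ∈ T.clusters then x.1 ⟨c, h⟩ else 0

theorem len_val {T : LTree A} (x : T.Weighting) (c : T.Edge) : len x c.1 = x.1 c := dif_pos c.2

theorem len_of_notMem {T : LTree A} (x : T.Weighting) {c : Set A} (h : c ∉ T.clusters) :
    len x c = 0 := dif_neg h

theorem len_ext {T : LTree A} {x y : T.Weighting} (h : ∀ c, len x c = len y c) : x = y :=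
  Subtype.ext (funext fun c => by rw [← len_val, ← len_val, h])

theorem len_extend {T T' : LTree A} (h : T ≤ T') (x : T.Weighting) (c : Set A) :
    len (extend h x) c = len x c := by
  by_cases hc : c ∈ T'.clusters
  · exact dif_pos hc
  · rw [len_of_notMem _ hc, len_of_notMem _ fun h' => hc (h h')]

theorem len_unrelabel (σ : A ≃ B) {T : LTree A} (x : (T.relabel σ).Weighting) (c : Set A) :
    len (unrelabel σ T x) c = len x ((preimageEquiv σ).symm c) := by
  by_cases hc : c ∈ T.clusters
  · exact (dif_pos hc).trans (len_val x ⟨_, (preimageEquiv_symm_mem σ T).mpr hc⟩).symm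
  · rw [len_of_notMem _ hc, len_of_notMem _ fun h => hc ((preimageEquiv_symm_mem σ T).mp h)]

/-- The relation `IsUngrafting` in terms of lengths of arbitrary sets, which avoids membership
proofs. -/
theorem isUngrafting_iff {T : LTree A} {a : A} {U : LTree B} {x : (T.graft a U).Weighting}
    {t : T.Weighting} {u : U.Weighting} : IsUngrafting T a U x t u ↔
      (∀ c, c ≠ {a} → len t c = len x (liftA c)) ∧
        ∀ d, len x (liftB d) = len t {a} * len u d := by
  have ha : len t {a} = t.1 (T.leafEdge a) := len_val t (T.leafEdge a)
  constructor
  · refine fun h => ⟨fun c hc => ?_, fun d => ?_⟩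
    · by_cases hcT : c ∈ T.clusters
      · exact (dif_pos hcT).trans ((h.1 ⟨c, hcT⟩ hc).trans
          (len_val x ⟨_, liftA_mem T U hcT⟩).symm)
      · rw [len_of_notMem _ hcT, len_of_notMem _ fun h => hcT (liftA_mem_graft.mp h)]
    · by_cases hd : d ∈ U.clusters
      · rw [ha]
        refine (len_val x ⟨_, liftB_mem T U hd⟩).trans ((h.2 ⟨d, hd⟩).trans ?_)
        rw [len, dif_pos hd]
      · rw [len_of_notMem u hd, len_of_notMem x fun h => hd (liftB_mem_graft.mp h), mul_zero]
  · refine fun h => ⟨fun c hc => ?_, fun d => ?_⟩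
    · rw [← len_val, h.1 _ hc]
      exact len_val x ⟨liftA c.1, liftA_mem T U c.2⟩
    · rw [← ha, ← len_val u, ← h.2]
      exact (len_val x ⟨liftB d.1, liftB_mem T U d.2⟩).symm

/-- Weightings can be grafted, by scaling the lengths of the edges of the upper tree. -/
theorem exists_isUngrafting_of_weightings {T : LTree A} {a : A} {U : LTree B} (t : T.Weighting)
    (u : U.Weighting) : ∃ x, IsUngrafting T a U x t u := by
  classical
  let f : (T.graft a U).Edge → unitInterval := fun e =>
    Sum.elim (fun c => t.1 c.1) (fun d => t.1 (T.leafEdge a) * u.1 d) (graftEdge.symm e)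
  have hf : ∀ c, f (graftEdge (.inl c)) = t.1 c.1 := fun c =>
    congrArg (Sum.elim _ _) (graftEdge.symm_apply_apply (.inl c))
  have hf' : ∀ d, f (graftEdge (.inr d)) = t.1 (T.leafEdge a) * u.1 d := fun d =>
    congrArg (Sum.elim _ _) (graftEdge.symm_apply_apply (.inr d))
  refine ⟨⟨f, ?_⟩, fun c hc => (hf ⟨c, hc⟩).symm, hf'⟩
  rintro (⟨y, hy⟩ | b)
  · refine (dist_graft_inA f y hy).trans ?_
    rw [← t.2 y, dist_eq (a := a), if_neg hy, add_zero]
    exact Finset.sum_congr rfl fun c _ => if_congr Iff.rfl (congrArg _ (hf c)) rfl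
  · refine (dist_graft_inB f b).trans ?_
    rw [← t.2 a, dist_eq (a := a) t.1 a, if_pos rfl]
    refine congrArg₂ (· + ·)
      (Finset.sum_congr rfl fun c _ => if_congr Iff.rfl (congrArg _ (hf c)) rfl) ?_
    refine Eq.trans ?_ ((congrArg (_ * ·) (u.2 b)).trans (mul_one _))
    unfold dist
    rw [Finset.mul_sum]
    refine Finset.sum_congr rfl fun d _ => ?_
    split_ifs
    · exact congrArg Subtype.val (hf' d)
    · exact (mul_zero _).symm

/-- The map `wbar T ⟶ wbar T'` for `T ≤ T'`. -/
noncomputable abbrev wbarMap {T T' : LTree A} (h : T ≤ T') : T.wbar ⟶ T'.wbar :=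
  (wbarFunctor A).map (homOfLE h)

theorem wbarMap_wmk {T T' : LTree A} (h : T ≤ T') (x : T.Weighting) :
    wbarMap h (wmk x) = wmk (extend h x) := rfl

theorem wbarRelabel_wmk (σ : A ≃ B) (T : LTree A) (x : (T.relabel σ).Weighting) :
    wbarRelabel σ T (wmk x) = wmk (unrelabel σ T x) := rfl

theorem wbarMap_refl (T : LTree A) : wbarMap (le_refl T) = 𝟙 T.wbar := (wbarFunctor A).map_id T

theorem wbarMap_wbarRelabel (σ : A ≃ B) {T T' : LTree A} (h : T ≤ T') :
    wbarMap (relabel_mono σ h) ≫ wbarRelabel σ T' = wbarRelabel σ T ≫ wbarMap h := by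
  refine wbar_hom_ext fun x => ?_
  change wmk (unrelabel σ T' (extend _ x)) = wmk (extend h (unrelabel σ T x))
  congr 1
  refine len_ext fun c => ?_
  rw [len_unrelabel, len_extend, len_extend, len_unrelabel]

theorem wbarRelabel_refl (T : LTree A) : wbarRelabel (Equiv.refl A) T = 𝟙 T.wbar :=
  wbar_hom_ext fun _ => rfl

theorem wbarRelabel_trans (σ : A ≃ B) (τ : B ≃ D) (T : LTree A) :
    wbarRelabel (σ.trans τ) T = wbarRelabel τ (T.relabel σ) ≫ wbarRelabel σ T :=
  wbar_hom_ext fun _ => rfl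

/-- Naturality of ungrafting in the trees. -/
theorem wbarMap_wbarUngraft (a : A) {T T' : LTree A} (h : T ≤ T') {U U' : LTree B} (h' : U ≤ U') :
    wbarMap (graft_mono a h h') ≫ wbarUngraft T' a U' =
      wbarUngraft T a U ≫ (wbarMap h ⊗ₘ wbarMap h') := by
  refine wbar_hom_ext fun x => ?_
  obtain ⟨t, u, hx⟩ := exists_isUngrafting x
  rw [BasedTop.comp_app, wbarMap_wmk, BasedTop.comp_app, wbarUngraft_wmk _ _ _ hx]
  refine wbarUngraft_wmk _ _ _ (t := extend h t) (u := extend h' u) ?_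
  rw [isUngrafting_iff] at hx ⊢
  simp only [len_extend]
  exact hx

/-- On weightings of a tree `S ≤ T ∪_a U` without the grafted edge, ungrafting is constant: the
product of the lengths of the leaf `a` of `T` and of the root of `U` is `0`, so that one of the two
weightings represents the basepoint. -/
theorem wbarMap_wbarUngraft_of_notMem {a : A} {T : LTree A} {U : LTree B}
    {S : LTree (NEFin.graft A a B)} (h : S ≤ T.graft a U) (hS : liftB Set.univ ∉ S.clusters) :
    wbarMap h ≫ wbarUngraft T a U = BasedTop.const _ _ := by
  refine wbar_hom_ext fun x => ?_
  obtain ⟨t, u, hx⟩ := exists_isUngrafting (extend h x)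
  rw [BasedTop.comp_app, wbarMap_wmk, wbarUngraft_wmk _ _ _ hx]
  have h0 := (isUngrafting_iff.mp hx).2 Set.univ
  rw [len_extend, len_of_notMem x hS] at h0
  rcases mul_eq_zero.mp (congrArg Subtype.val h0.symm) with h1 | h1
  · rw [wmk_eq_pt (.inr ⟨a, (len_val t (T.leafEdge a)).symm.trans (Subtype.ext h1)⟩)]
    exact BasedTop.smk_pt_left _
  · rw [wmk_eq_pt (x := u) (.inl ((len_val u U.rootEdge).symm.trans (Subtype.ext h1)))]
    exact BasedTop.smk_pt_right _

theorem symm_singleton (σ : A ≃ B) (a : A) : (preimageEquiv σ).symm {a} = {σ a} := by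
  ext x
  exact σ.symm_apply_eq

/-- Naturality of ungrafting in bijections of the sets of leaves. -/
theorem wbarUngraft_relabel (σ : A ≃ A') (τ : B ≃ B') (T : LTree A) (a : A) (U : LTree B) :
    wbarMap (relabel_graft a σ τ T U).ge ≫ wbarRelabel (graftCongr σ τ a) (T.graft a U) ≫
        wbarUngraft T a U =
      wbarUngraft (T.relabel σ) (σ a) (U.relabel τ) ≫ (wbarRelabel σ T ⊗ₘ wbarRelabel τ U) := by
  refine wbar_hom_ext fun x => ?_
  obtain ⟨t, u, hx⟩ := exists_isUngrafting x
  rw [BasedTop.comp_app, BasedTop.comp_app, wbarMap_wmk, wbarRelabel_wmk, BasedTop.comp_app,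
    wbarUngraft_wmk _ _ _ hx]
  refine wbarUngraft_wmk _ _ _ (t := unrelabel σ T t) (u := unrelabel τ U u) ?_
  rw [isUngrafting_iff] at hx ⊢
  simp only [len_unrelabel, len_extend, graftCongr_liftA, graftCongr_liftB, symm_singleton]
  exact ⟨fun c hc => hx.1 _ fun h => hc ((preimageEquiv σ).symm.injective
    (h.trans (symm_singleton σ a).symm)), fun d => hx.2 _⟩

theorem liftA_singleton {a : A} (x : A) (hx : x ≠ a) :
    (liftA {x} : Set (NEFin.graft A a B)) = {inA x hx} := by
  ext (y | y)
  · exact ⟨fun h => congrArg Sum.inl (Subtype.ext h),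
      fun h => congrArg Subtype.val (Sum.inl_injective h)⟩
  · exact iff_of_false (fun h => hx (Eq.symm h)) Sum.inr_ne_inl

theorem liftB_singleton {a : A} (b : B) : (liftB {b} : Set (NEFin.graft A a B)) = {inB b} :=
  Set.image_singleton

/-- Coassociativity of ungrafting: lengths on the uppermost tree are scaled by the product of the
two lengths of the grafted edges in either case. -/
theorem wbarUngraft_assoc (T : LTree A) (a : A) (U : LTree B) (b : B) (R : LTree D) :
    wbarMap (relabel_graftAssoc a b T U R).ge ≫
        wbarRelabel (graftAssoc A B D a b) ((T.graft a U).graft (inB b) R) ≫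
        wbarUngraft (T.graft a U) (inB b) R ≫ wbarUngraft T a U ▷ R.wbar =
      wbarUngraft T a (U.graft b R) ≫ T.wbar ◁ wbarUngraft U b R ≫ (α_ _ _ _).inv := by
  refine wbar_hom_ext fun x => ?_
  obtain ⟨t, z, hx⟩ := exists_isUngrafting x
  obtain ⟨u, r, hz⟩ := exists_isUngrafting z
  obtain ⟨s, hs⟩ := exists_isUngrafting_of_weightings (a := a) t u
  have hy : IsUngrafting (T.graft a U) (inB b) R
      (unrelabel (graftAssoc A B D a b) _ (extend (relabel_graftAssoc a b T U R).ge x)) s r := by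
    rw [isUngrafting_iff] at hx hz hs ⊢
    simp only [len_unrelabel, len_extend, graftAssoc_liftB, ← liftB_singleton]
    refine ⟨fun c hc => ?_, fun d => ?_⟩
    · by_cases hcS : c ∈ (T.graft a U).clusters
      · rcases hcS with ⟨c, hcT, rfl⟩ | ⟨c, hcU, rfl⟩
        · rw [graftAssoc_liftA_liftA]
          by_cases hca : c = {a}
          -- The cluster `{a}` of `T` is the root edge of `U`.
          · subst hca
            rw [← liftB_univ] at hc ⊢
            rw [← liftB_univ, hx.2, hs.2]
            have := hz.1 Set.univ fun h => hc (congrArg liftB h)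
            rw [this]
            rfl
          · rw [← hx.1 c hca, ← hs.1 c hca]
        · rw [graftAssoc_liftA_liftB, hs.2, hx.2, hz.1 c fun h => hc (congrArg liftB h)]
      · rw [len_of_notMem _ hcS, len_of_notMem]
        intro h
        refine hcS (liftA_mem_graft (a := inB b) (U := R).mp ?_)
        rw [← relabel_graftAssoc a b T U R, preimageEquiv_symm_mem] at h
        exact h
    · rw [hx.2, hz.2, hs.2, mul_assoc]
  simp only [BasedTop.comp_app]
  rw [wbarMap_wmk, wbarRelabel_wmk, wbarUngraft_wmk _ _ _ hy, wbarUngraft_wmk _ _ _ hx]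
  change BasedTop.smk (wbarUngraft T a U (wmk s)) (wmk r) =
    BasedTop.smashAssocInv _ _ _ (BasedTop.smk (wmk t) (wbarUngraft U b R (wmk z)))
  rw [wbarUngraft_wmk _ _ _ hs, wbarUngraft_wmk _ _ _ hz]
  rfl

/-- Trees at different leaves can be ungrafted in either order. -/
theorem wbarUngraft_comm (T : LTree A) {a a' : A} (h : a ≠ a') (U : LTree B) (R : LTree D) :
    wbarMap (relabel_graftComm h T U R).ge ≫
        wbarRelabel (graftComm A B D a a' h) ((T.graft a U).graft (inA a' h.symm) R) ≫
        wbarUngraft (T.graft a U) (inA a' h.symm) R ≫ wbarUngraft T a U ▷ R.wbar =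
      wbarUngraft (T.graft a' R) (inA a h) U ≫ wbarUngraft T a' R ▷ U.wbar ≫ (α_ _ _ _).hom ≫
        T.wbar ◁ (β_ _ _).hom ≫ (α_ _ _ _).inv := by
  refine wbar_hom_ext fun x => ?_
  obtain ⟨z, u, hx⟩ := exists_isUngrafting x
  obtain ⟨t, r, hz⟩ := exists_isUngrafting z
  obtain ⟨s, hs⟩ := exists_isUngrafting_of_weightings (a := a) t u
  have hy : IsUngrafting (T.graft a U) (inA a' h.symm) R
      (unrelabel (graftComm A B D a a' h) _ (extend (relabel_graftComm h T U R).ge x)) s r := by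
    rw [isUngrafting_iff] at hx hz hs ⊢
    simp only [len_unrelabel, len_extend, graftComm_liftB, ← liftA_singleton] at hx ⊢
    have ha : len z (liftA {a}) = len t {a} :=
      (hz.1 {a} fun e => h (Set.singleton_injective e)).symm
    have ha' : len s (liftA {a'}) = len t {a'} :=
      (hs.1 {a'} fun e => h (Set.singleton_injective e).symm).symm
    have hBA : ∀ d : Set D, (liftB d : Set (NEFin.graft A a' D)) ≠ liftA {a} := fun d hd => by
      have := (mem_liftB _ d).mp (hd.symm.subset (show inA a h ∈ liftA {a} from rfl))
      exact this
    refine ⟨fun c hc => ?_, fun d => ?_⟩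
    · by_cases hcS : c ∈ (T.graft a U).clusters
      · rcases hcS with ⟨c, hcT, rfl⟩ | ⟨c, hcU, rfl⟩
        · rw [graftComm_liftA_liftA]
          by_cases hca : c = {a}
          -- The cluster `{a}` of `T` is the root edge of `U`.
          · subst hca
            have h2 := hx.2 Set.univ
            have h1 := hs.2 Set.univ
            rw [liftB_univ] at h1 h2
            rw [h1, ← ha, ← h2, ← liftA_singleton]
          · rw [← hx.1 (liftA c) fun e => hca (liftA_injective e), ← hs.1 c hca,
              hz.1 c fun e => hc (congrArg liftA e)]
        · rw [graftComm_liftA_liftB, hs.2, hx.2, ha]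
      · rw [len_of_notMem _ hcS, len_of_notMem]
        intro h'
        refine hcS (liftA_mem_graft (a := inA a' h.symm) (U := R).mp ?_)
        rw [← relabel_graftComm h T U R, preimageEquiv_symm_mem] at h'
        exact h'
    · rw [← hx.1 _ (hBA d), hz.2, ha']
  simp only [BasedTop.comp_app]
  rw [wbarMap_wmk, wbarRelabel_wmk, wbarUngraft_wmk _ _ _ hy, wbarUngraft_wmk _ _ _ hx]
  change BasedTop.smk (wbarUngraft T a U (wmk s)) (wmk r) =
    BasedTop.smashAssocInv _ _ _ (BasedTop.smashMap (𝟙 _) (BasedTop.smashSwap _ _)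
      (BasedTop.smashAssoc _ _ _ (BasedTop.smk (wbarUngraft T a' R (wmk z)) (wmk u))))
  rw [wbarUngraft_wmk _ _ _ hs, wbarUngraft_wmk _ _ _ hz]
  rfl

/-- The only edge of a tree with one leaf has length `1`. -/
theorem len_one {I : LTree NEFin.one} (x : I.Weighting) : len x Set.univ = 1 := by
  classical
  have h := x.2 ()
  unfold dist at h
  have : Unique I.Edge := ⟨⟨I.rootEdge⟩, fun e =>
    Subtype.ext (eq_univ_of_one (I.nonempty_of_mem _ e.2))⟩
  rw [Fintype.sum_unique] at h
  have hd : (default : I.Edge) = I.rootEdge := Subsingleton.elim _ _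
  rw [hd] at h
  exact (len_val x I.rootEdge).trans (Subtype.ext ((if_pos (Set.mem_univ _)).symm.trans h))

theorem wbarUngraft_one_left (I : LTree NEFin.one) (T : LTree A) :
    wbarMap (relabel_graftOneLeft I T).ge ≫ wbarRelabel (graftOneLeft A) (I.graft () T) ≫
      wbarUngraft I () T ≫ wbarOne I ▷ T.wbar = (λ_ _).inv := by
  refine wbar_hom_ext fun x => ?_
  obtain ⟨i, -⟩ := exists_weighting I
  have hy : IsUngrafting I () T (unrelabel (graftOneLeft A) _
      (extend (relabel_graftOneLeft I T).ge x)) i x := by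
    refine isUngrafting_iff.mpr ?_
    simp only [len_unrelabel, len_extend, graftOneLeft_liftB]
    refine ⟨fun c hc => ?_, fun d => ?_⟩
    · have hcI : c ∉ I.clusters := fun h => hc ((eq_univ_of_one (I.nonempty_of_mem c h)).trans
        (eq_univ_of_one (Set.singleton_nonempty ())).symm)
      have hce : c = ∅ := by
        by_contra h
        rw [clusters_one] at hcI
        exact hcI (eq_univ_of_one (Set.nonempty_iff_ne_empty.mpr h))
      rw [len_of_notMem _ hcI, len_of_notMem]
      intro h
      obtain ⟨y, hy⟩ := T.nonempty_of_mem _ h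
      subst hce
      exact hy
    · have hi : len i {(() : NEFin.one)} = 1 :=
        (congrArg (len i) (eq_univ_of_one (Set.singleton_nonempty _))).trans (len_one i)
      exact ((congrArg (· * len x d) hi).trans (one_mul _)).symm
  simp only [BasedTop.comp_app]
  rw [wbarMap_wmk, wbarRelabel_wmk, wbarUngraft_wmk _ _ _ hy]
  rfl

theorem wbarUngraft_one_right (a : A) (T : LTree A) (I : LTree NEFin.one) :
    wbarUngraft T a I ≫ T.wbar ◁ wbarOne I =
      wbarMap (relabel_graftOneRight a T I).ge ≫ wbarRelabel (graftOneRight A a) T ≫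
        (ρ_ _).inv := by
  refine wbar_hom_ext fun x => ?_
  obtain ⟨i, -⟩ := exists_weighting I
  have hy : IsUngrafting T a I x (unrelabel (graftOneRight A a) _
      (extend (relabel_graftOneRight a T I).ge x)) i := by
    refine isUngrafting_iff.mpr ?_
    simp only [len_unrelabel, len_extend, graftOneRight_liftA]
    refine ⟨fun c hc => trivial, fun d => ?_⟩
    by_cases hd : d ∈ I.clusters
    · have hd := eq_univ_of_one (I.nonempty_of_mem d hd)
      subst hd
      rw [len_one, mul_one, liftB_univ]
    · rw [len_of_notMem i hd, len_of_notMem x fun h => hd (liftB_mem_graft.mp h), mul_zero]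
  simp only [BasedTop.comp_app]
  rw [wbarMap_wmk, wbarRelabel_wmk, wbarUngraft_wmk _ _ _ hy]
  rfl

end LTree

/-! ### Coherence of relabelling and grafting -/

namespace LTree

section

variable {C : Type u} [Category.{v} C] [MonoidalCategory C] [SymmetricCategory C] {Q : NEFin → C}

variable (q : Cooperad Q) {A A' B B' D : NEFin}

namespace Emb

variable {T : LTree A} {S : LTree B} {R : LTree D}

/-- Composing a map given by an embedding with an embedding. By this, an identity between composites
of relabellings and graftings is reduced to an identity between maps of clusters. -/
theorem pre_push {f : treeObj Q T ⟶ treeObj Q S} {φ : Emb T S}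
    (h : Multi.pre f (univ Q S) = φ.push q) (ψ : Emb S R) :
    Multi.pre f (ψ.push q) = (φ.comp ψ).push q := by
  rw [← push_comp, ← h, Multi.bind_pre, push]

theorem pre_treeRelabel_push (σ : A ≃ B) (T : LTree A) (ψ : Emb (T.relabel σ) R) :
    Multi.pre (q.treeRelabel σ T) (ψ.push q) = ((relabel σ T).comp ψ).push q :=
  pre_push q (pre_treeRelabel q σ T) ψ

theorem pre_treeGraft_push (T : LTree A) (a : A) (U : LTree B) (ψ : Emb (T.graft a U) R) :
    Multi.pre (q.treeGraft T a U) (ψ.push q) =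
      .tens (((graftA T a U).comp ψ).push q) (((graftB T a U).comp ψ).push q) := by
  rw [push, ← Multi.bind_pre, pre_treeGraft, Multi.bind_tens, push_comp, push_comp]

/-- The map `Q(T) ⟶ Q(S)` for equal trees is the identity on all factors. -/
theorem pre_map_of_eq (DA : q.TreeFunctor A) {T S : LTree A} (h : T = S) :
    Multi.pre (DA.map h.le) (univ Q S) = (ofEq h).push q := by
  subst h
  rw [DA.map_refl, Multi.pre_id, push_ofEq]

theorem push_eq_univ {T : LTree A} (φ : Emb T T) (h : ∀ c, φ.toFun c = c) :
    φ.push q = univ Q T := by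
  rw [← push_ofEq q T]
  exact congrArg (push q) (Emb.ext (funext h))

end Emb

variable (Q) in
/-- The identification of the unit object with `Q(I)` for the tree `I` without vertices. -/
noncomputable abbrev treeUnit (I : LTree NEFin.one) : 𝟙_ C ⟶ treeObj Q I :=
  (bigTensorEmpty fun v : I.Vert => Q (I.inc v)).inv

theorem pre_treeUnit_push {I : LTree NEFin.one} {S : LTree A} (φ : Emb I S) :
    Multi.pre (treeUnit Q I) (φ.push q) = .nil _ := by
  rw [Emb.push, ← Multi.bind_pre]
  exact (congrArg (Multi.bind · _) (Multi.pre_bigTensorEmpty_inv _)).trans (Multi.bind_nil _)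

theorem treeRelabel_refl (T : LTree A) : q.treeRelabel (Equiv.refl A) T = 𝟙 _ := by
  refine Emb.hom_ext ?_
  refine (Emb.pre_treeRelabel q _ T).trans ((Emb.push_eq_univ q (T := T)
    (Emb.relabel (Equiv.refl A) T) fun _ => rfl).trans (Multi.pre_id _).symm)

theorem treeRelabel_trans (σ : A ≃ B) (τ : B ≃ D) (T : LTree A) :
    q.treeRelabel (σ.trans τ) T = q.treeRelabel σ T ≫ q.treeRelabel τ (T.relabel σ) := by
  have h : (Emb.relabel (σ.trans τ) T : Emb T ((T.relabel σ).relabel τ)) =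
      (Emb.relabel σ T).comp (Emb.relabel τ (T.relabel σ)) := Emb.ext rfl
  refine Emb.hom_ext (T := (T.relabel σ).relabel τ) ?_
  rw [← Multi.pre_pre, Emb.pre_treeRelabel, Emb.pre_treeRelabel_push, ← h]
  exact Emb.pre_treeRelabel q (σ.trans τ) T

/-- Naturality of grafting in bijections of the sets of leaves. -/
theorem treeGraft_relabel {σ : A ≃ A'} {a : A} (E : q.TreeFunctor (NEFin.graft A' (σ a) B'))
    (τ : B ≃ B') (T : LTree A) (U : LTree B) :
    q.treeGraft T a U ≫ q.treeRelabel (graftCongr σ τ a) (T.graft a U) ≫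
        E.map (relabel_graft a σ τ T U).le =
      (q.treeRelabel σ T ⊗ₘ q.treeRelabel τ U) ≫
        q.treeGraft (T.relabel σ) (σ a) (U.relabel τ) := by
  refine Emb.hom_ext ?_
  rw [← Multi.pre_pre, ← Multi.pre_pre, ← Multi.pre_pre,
    Emb.pre_map_of_eq q E (relabel_graft a σ τ T U), Emb.pre_treeRelabel_push,
    Emb.pre_treeGraft_push, Emb.pre_treeGraft, ← Multi.tens_pre,
    Emb.pre_treeRelabel_push, Emb.pre_treeRelabel_push]
  exact congrArg₂ Multi.tens
    (congrArg (Emb.push q) (Emb.ext (funext (graftCongr_liftA a σ τ))))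
    (congrArg (Emb.push q) (Emb.ext (funext (graftCongr_liftB a σ τ))))

/-- Grafting on an upper tree. -/
theorem treeGraft_assoc (T : LTree A) {a : A} (U : LTree B) {b : B} (R : LTree D)
    (E : q.TreeFunctor (NEFin.graft A a (NEFin.graft B b D))) :
    q.treeGraft T a U ▷ treeObj Q R ≫ q.treeGraft (T.graft a U) (inB b) R ≫
        q.treeRelabel (graftAssoc A B D a b) _ ≫ E.map (relabel_graftAssoc a b T U R).le =
      (α_ _ _ _).hom ≫ treeObj Q T ◁ q.treeGraft U b R ≫ q.treeGraft T a (U.graft b R) := by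
  refine Emb.hom_ext ?_
  simp only [← Multi.pre_pre]
  rw [Emb.pre_map_of_eq q E (relabel_graftAssoc a b T U R), Emb.pre_treeRelabel_push,
    Emb.pre_treeGraft_push, Emb.pre_treeGraft, ← Multi.tens_pre_left, ← Multi.tens_pre_right,
    Emb.pre_treeGraft_push, Emb.pre_treeGraft_push, Multi.tens_assoc]
  exact congrArg₂ Multi.tens (congrArg₂ Multi.tens
    (congrArg (Emb.push q) (Emb.ext (funext (graftAssoc_liftA_liftA a b))))
    (congrArg (Emb.push q) (Emb.ext (funext (graftAssoc_liftA_liftB a b)))))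
    (congrArg (Emb.push q) (Emb.ext (funext (graftAssoc_liftB a b))))

/-- Grafting at two different leaves in either order. -/
theorem treeGraft_comm (T : LTree A) {a a' : A} (h : a ≠ a') (U : LTree B) (R : LTree D)
    (E : q.TreeFunctor (NEFin.graft (NEFin.graft A a' D) (inA a h) B)) :
    q.treeGraft T a U ▷ treeObj Q R ≫ q.treeGraft (T.graft a U) (inA a' h.symm) R ≫
        q.treeRelabel (graftComm A B D a a' h) _ ≫ E.map (relabel_graftComm h T U R).le =
      (α_ _ _ _).hom ≫ treeObj Q T ◁ (β_ (treeObj Q U) (treeObj Q R)).hom ≫ (α_ _ _ _).inv ≫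
        q.treeGraft T a' R ▷ treeObj Q U ≫ q.treeGraft (T.graft a' R) (inA a h) U := by
  refine Emb.hom_ext ?_
  simp only [← Multi.pre_pre]
  rw [Emb.pre_map_of_eq q E (relabel_graftComm h T U R), Emb.pre_treeRelabel_push,
    Emb.pre_treeGraft_push, Emb.pre_treeGraft, ← Multi.tens_pre_left, ← Multi.tens_pre_left,
    Emb.pre_treeGraft_push, Emb.pre_treeGraft_push, Multi.tens_assoc', ← Multi.tens_pre_right,
    Multi.tens_braid,
    Multi.tens_assoc]
  exact congrArg₂ Multi.tens (congrArg₂ Multi.tens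
    (congrArg (Emb.push q) (Emb.ext (funext (graftComm_liftA_liftA h))))
    (congrArg (Emb.push q) (Emb.ext (funext (graftComm_liftA_liftB h)))))
    (congrArg (Emb.push q) (Emb.ext (funext (graftComm_liftB h))))

theorem treeUnit_treeGraft (I : LTree NEFin.one) (T : LTree A) (E : q.TreeFunctor A) :
    treeUnit Q I ▷ treeObj Q T ≫ q.treeGraft I () T ≫ q.treeRelabel (graftOneLeft A) _ ≫
      E.map (relabel_graftOneLeft I T).le = (λ_ _).hom := by
  refine Emb.hom_ext ?_
  simp only [← Multi.pre_pre]
  rw [Emb.pre_map_of_eq q E (relabel_graftOneLeft I T), Emb.pre_treeRelabel_push]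
  refine (congrArg (Multi.pre _) (Emb.pre_treeGraft_push q I () T _)).trans ?_
  rw [← Multi.tens_pre_left, pre_treeUnit_push, Emb.push_eq_univ q _ graftOneLeft_liftB]
  refine Multi.pre_injective (λ_ _).symm ?_
  refine (Multi.nil_tens _).trans ?_
  rw [Multi.pre_pre, Iso.symm_hom, Iso.inv_hom_id, Multi.pre_id]

theorem treeGraft_treeUnit (a : A) (T : LTree A) (I : LTree NEFin.one)
    (E : q.TreeFunctor (NEFin.graft A a NEFin.one)) :
    treeObj Q T ◁ treeUnit Q I ≫ q.treeGraft T a I =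
      (ρ_ _).hom ≫ q.treeRelabel (graftOneRight A a) T ≫
        E.map (relabel_graftOneRight a T I).le := by
  refine Emb.hom_ext ?_
  simp only [← Multi.pre_pre]
  rw [Emb.pre_map_of_eq q E (relabel_graftOneRight a T I), Emb.pre_treeRelabel_push,
    Emb.pre_treeGraft, ← Multi.tens_pre_right, pre_treeUnit_push]
  refine Multi.pre_injective (ρ_ _).symm ?_
  refine (Multi.tens_nil _).trans ?_
  rw [Multi.pre_pre, Iso.symm_hom, Iso.inv_hom_id, Multi.pre_id]
  exact congrArg (Emb.push q) (Emb.ext (funext fun c => (graftOneRight_liftA a c).symm))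

end

end LTree

/-! ### Maps into the cobar construction -/

section Cobar

variable {C : Type u} [Category.{v} C] [MonoidalCategory C] [SymmetricCategory C] {Q : NEFin → C}
  [EnrichedOrdinaryCategory BasedTop C] [SymmetricMonoidalVCategory BasedTop C]

theorem cotMap_id_left (X : BasedTop) {E F : C} (g : E ⟶ F) :
    cotMap (𝟙 X) g = (Cotensored.cot.obj (.op X)).map g := by simp [cotMap]

theorem cotMap_id_right {X Y : BasedTop} (f : X ⟶ Y) (E : C) :
    cotMap f (𝟙 E) = (Cotensored.cot.map f.op).app E := by simp [cotMap]

theorem dCot_assoc_inv (X Y Z : BasedTop) (E F G : C) :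
    cotObj X E ◁ dCot Y Z F G ≫ dCot X (Y ⊗ Z) E (F ⊗ G) ≫ cotMap (α_ X Y Z).hom (α_ E F G).inv =
      (α_ _ _ _).inv ≫ dCot X Y E F ▷ cotObj Z G ≫ dCot (X ⊗ Y) Z (E ⊗ F) G := by
  rw [Iso.eq_inv_comp, ← reassoc_of% (dCot_assoc X Y Z E F G), cotMap_comp, Iso.hom_inv_id,
    Iso.hom_inv_id, cotMap_id, Category.comp_id]

/-- The compatibility of the maps `d^∨` with the interchange of two factors. -/
theorem dCot_swap (X Y Z : BasedTop) (E F G : C) :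
    dCot X Y E F ▷ cotObj Z G ≫ dCot (X ⊗ Y) Z (E ⊗ F) G ≫
        cotMap ((α_ X Z Y).hom ≫ X ◁ (β_ Z Y).hom ≫ (α_ X Y Z).inv)
          ((α_ E F G).hom ≫ E ◁ (β_ F G).hom ≫ (α_ E G F).inv) =
      (α_ _ _ _).hom ≫ cotObj X E ◁ (β_ _ _).hom ≫ (α_ _ _ _).inv ≫
        dCot X Z E G ▷ cotObj Y F ≫ dCot (X ⊗ Z) Y (E ⊗ G) F := by
  have h := dCot_natural (𝟙 X) (β_ Z Y).hom (𝟙 E) (β_ F G).hom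
  simp only [id_tensorHom, cotMap_id] at h
  rw [← dCot_assoc_inv, ← whiskerLeft_comp_assoc, dCot_symm, whiskerLeft_comp_assoc,
    reassoc_of% h, ← reassoc_of% (dCot_assoc X Y Z E F G), cotMap_comp, cotMap_comp]
  simp only [Category.assoc]

variable [HasLimitsOfSize.{0, 0} C] {q : Cooperad Q} (D : ∀ A, q.TreeFunctor A)
  {A A' B B' E : NEFin}

/-- The defining relation of the end. -/
theorem cobarProj_condition {T T' : LTree A} (h : T ≤ T') :
    cobarProj D T ≫ cotMap (𝟙 T.wbar) ((D A).map h) =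
      cobarProj D T' ≫ cotMap (LTree.wbarMap h) (𝟙 (treeObj Q T')) := by
  rw [cotMap_id_left, cotMap_id_right]
  exact end_.condition (cobarBifunctor (D A)) (homOfLE h)

/-- Transport of components along an equality of trees. -/
theorem cobarProj_of_eq {T S : LTree A} (h : T = S) :
    cobarProj D S = cobarProj D T ≫ cotMap (LTree.wbarMap h.ge) ((D A).map h.le) := by
  subst h
  rw [LTree.wbarMap_refl, (D A).map_refl, cotMap_id, Category.comp_id]

theorem cobar_hom_ext {X : C} {f g : X ⟶ cobar D A}
    (h : ∀ T, f ≫ cobarProj D T = g ≫ cobarProj D T) : f = g :=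
  end_.hom_ext h

theorem exists_cobar_lift {X : C} (w : ∀ T : LTree A, X ⟶ cotObj T.wbar (treeObj Q T))
    (hw : ∀ {T T' : LTree A} (h : T ≤ T'), w T ≫ cotMap (𝟙 T.wbar) ((D A).map h) =
      w T' ≫ cotMap (LTree.wbarMap h) (𝟙 (treeObj Q T'))) :
    ∃ f : X ⟶ cobar D A, ∀ T, f ≫ cobarProj D T = w T := by
  refine ⟨end_.lift (F := cobarBifunctor (D A)) w fun T T' f => ?_, fun T => end_.lift_π _ _ _⟩
  have := hw (leOfHom f)
  rw [cotMap_id_left, cotMap_id_right] at this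
  exact this

/-- Extension by zero: a compatible family of maps on an upward closed family of trees is extended
by zero maps to all trees. This is a map into the end if the given maps vanish after restriction to
smaller trees outside of the family. -/
theorem exists_cobar_lift_of_embedding {X : C} {J : Type} {e : J → LTree A}
    (he : Function.Injective e) (hup : ∀ {j S}, e j ≤ S → S ∈ Set.range e)
    (w : ∀ j, X ⟶ cotObj (e j).wbar (treeObj Q (e j)))
    (hw : ∀ {j j'} (h : e j ≤ e j'), w j ≫ cotMap (𝟙 _) ((D A).map h) =
      w j' ≫ cotMap (LTree.wbarMap h) (𝟙 _))
    (hw0 : ∀ {S j} (h : S ≤ e j), S ∉ Set.range e →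
      w j ≫ cotMap (LTree.wbarMap h) (𝟙 _) = zeroHom _ _) :
    ∃ f : X ⟶ cobar D A, (∀ j, f ≫ cobarProj D (e j) = w j) ∧
      ∀ S ∉ Set.range e, f ≫ cobarProj D S = zeroHom _ _ := by
  -- The embedding `e` is only known to have a preimage of `S` up to equality, so that the component
  -- at `S` is characterised instead of being defined by cases.
  have key : ∀ S, ∃ k : X ⟶ cotObj S.wbar (treeObj Q S),
      (∀ j (h : e j = S), k = w j ≫ cotMap (LTree.wbarMap h.ge) ((D A).map h.le)) ∧
        (S ∉ Set.range e → k = zeroHom _ _) := by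
    intro S
    by_cases hS : S ∈ Set.range e
    · obtain ⟨j, rfl⟩ := hS
      refine ⟨w j, fun j' h => ?_, fun h => (h ⟨j, rfl⟩).elim⟩
      obtain rfl := he h
      rw [LTree.wbarMap_refl, (D A).map_refl, cotMap_id, Category.comp_id]
    · exact ⟨zeroHom _ _, fun j h => (hS ⟨j, h⟩).elim, fun _ => rfl⟩
  choose k hk hk0 using key
  have hk' : ∀ j, k (e j) = w j := fun j => by
    rw [hk (e j) j rfl, LTree.wbarMap_refl, (D A).map_refl, cotMap_id, Category.comp_id]
  obtain ⟨f, hf⟩ := exists_cobar_lift D k fun {S S'} h => by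
    by_cases hS : S ∈ Set.range e
    · obtain ⟨j, rfl⟩ := hS
      obtain ⟨j', rfl⟩ := hup h
      rw [hk', hk', hw]
    · rw [hk0 S hS, zeroHom_comp]
      by_cases hS' : S' ∈ Set.range e
      · obtain ⟨j', rfl⟩ := hS'
        rw [hk', hw0 h hS]
      · rw [hk0 S' hS', zeroHom_comp]
  exact ⟨f, fun j => (hf _).trans (hk' j), fun S hS => (hf S).trans (hk0 S hS)⟩

theorem cobarProj_relabel_condition (σ : A ≃ B) {T T' : LTree A} (h : T ≤ T') :
    (cobarProj D T ≫ cotMap (LTree.wbarRelabel σ T) (q.treeRelabel σ T)) ≫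
        cotMap (𝟙 (T.relabel σ).wbar) ((D B).map (LTree.relabel_mono σ h)) =
      (cobarProj D T' ≫ cotMap (LTree.wbarRelabel σ T') (q.treeRelabel σ T')) ≫
        cotMap (LTree.wbarMap (LTree.relabel_mono σ h)) (𝟙 (treeObj Q (T'.relabel σ))) := by
  rw [Category.assoc, Category.assoc, cotMap_comp, cotMap_comp, Category.id_comp,
    Category.comp_id, ← LTree.map_treeRelabel (D A) (D B) σ h, LTree.wbarMap_wbarRelabel σ h,
    ← Category.comp_id (LTree.wbarRelabel σ T), ← cotMap_comp,
    reassoc_of% (cobarProj_condition D h), cotMap_comp, Category.comp_id, Category.id_comp]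

/-- The action of a bijection. All trees are relabelled trees. -/
theorem exists_cobarMap (σ : A ≃ B) : ∃ f : cobar D A ⟶ cobar D B, ∀ T : LTree A,
    f ≫ cobarProj D (T.relabel σ) =
      cobarProj D T ≫ cotMap (LTree.wbarRelabel σ T) (q.treeRelabel σ T) := by
  have hs : Function.Surjective (LTree.relabelIso σ) := (LTree.relabelIso σ).surjective
  exact (exists_cobar_lift_of_embedding D (X := cobar D A)
    (e := LTree.relabelIso σ) (LTree.relabelIso σ).injective
    (fun {_ S} _ => hs S)
    (fun T => cobarProj D T ≫ cotMap (LTree.wbarRelabel σ T) (q.treeRelabel σ T))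
    (fun h => cobarProj_relabel_condition D σ ((LTree.relabelIso σ).le_iff_le.mp h))
    (fun {S _} _ hS => (hS (hs S)).elim)).imp fun _ hf => hf.1

/-- The component of `∘_a` at a tree of the form `T ∪_a U`. -/
noncomputable def cobarCompGraft (T : LTree A) (a : A) (U : LTree B) :
    cobar D A ⊗ cobar D B ⟶ cotObj (T.graft a U).wbar (treeObj Q (T.graft a U)) :=
  (cobarProj D T ⊗ₘ cobarProj D U) ≫ dCot T.wbar U.wbar (treeObj Q T) (treeObj Q U) ≫
    cotMap (LTree.wbarUngraft T a U) (q.treeGraft T a U)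

/-- The components of `∘_a` at the trees of the form `T ∪_a U` are compatible. -/
theorem cobarCompGraft_condition (a : A) {T T' : LTree A} (hT : T ≤ T') {U U' : LTree B}
    (hU : U ≤ U') :
    cobarCompGraft D T a U ≫
        cotMap (𝟙 (T.graft a U).wbar) ((D (graft A a B)).map (LTree.graft_mono a hT hU)) =
      cobarCompGraft D T' a U' ≫
        cotMap (LTree.wbarMap (LTree.graft_mono a hT hU)) (𝟙 (treeObj Q (T'.graft a U'))) := by
  rw [cobarCompGraft, cobarCompGraft, Category.assoc, Category.assoc, Category.assoc,
    Category.assoc, cotMap_comp, cotMap_comp, Category.id_comp, Category.comp_id,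
    ← LTree.map_treeGraft (D A) (D B) a (D _) hT hU, LTree.wbarMap_wbarUngraft a hT hU,
    ← Category.comp_id (LTree.wbarUngraft T a U), ← cotMap_comp,
    ← Category.id_comp (q.treeGraft T' a U'), ← cotMap_comp, ← id_tensorHom_id,
    ← id_tensorHom_id, ← reassoc_of% (dCot_natural (𝟙 T.wbar) (𝟙 U.wbar)),
    ← reassoc_of% (dCot_natural (LTree.wbarMap hT) (LTree.wbarMap hU)),
    tensorHom_comp_tensorHom_assoc, tensorHom_comp_tensorHom_assoc, cobarProj_condition,
    cobarProj_condition, id_tensorHom_id, id_tensorHom_id, Category.comp_id, Category.id_comp]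

/-- The components of `∘_a` are compatible with zero maps at the trees that are not of the form
`T ∪_a U`. -/
theorem cobarCompGraft_zero {a : A} {T : LTree A} {U : LTree B} {S : LTree (graft A a B)}
    (h : S ≤ T.graft a U) (hS : LTree.liftB Set.univ ∉ S.clusters) :
    cobarCompGraft D T a U ≫ cotMap (LTree.wbarMap h) (𝟙 (treeObj Q (T.graft a U))) =
      zeroHom _ _ := by
  rw [cobarCompGraft, Category.assoc, Category.assoc, cotMap_comp,
    LTree.wbarMap_wbarUngraft_of_notMem h hS, ← Category.assoc, comp_cotMap_const]

theorem exists_cobarComp (A B : NEFin) (a : A) :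
    ∃ f : cobar D A ⊗ cobar D B ⟶ cobar D (graft A a B),
      (∀ (T : LTree A) (U : LTree B),
        f ≫ cobarProj D (T.graft a U) = cobarCompGraft D T a U) ∧
      ∀ V, (∀ (T : LTree A) (U : LTree B), V ≠ T.graft a U) →
        f ≫ cobarProj D V = zeroHom _ _ :=
  (exists_cobar_lift_of_embedding D (X := cobar D A ⊗ cobar D B)
    (e := LTree.graftEmb (B := B) a) (LTree.graftEmb a).injective
    (fun {j _} h => LTree.mem_range_graftEmb.mpr (h (LTree.mem_range_graftEmb.mp ⟨j, rfl⟩)))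
    (fun j => cobarCompGraft D j.1 a j.2)
    (fun h => cobarCompGraft_condition D a (LTree.graft_le_iff.mp h).1 (LTree.graft_le_iff.mp h).2)
    (fun h hS => cobarCompGraft_zero D h
      fun h' => hS (LTree.mem_range_graftEmb.mpr h'))).imp fun _ hf =>
      ⟨fun T U => hf.1 (T, U), fun V hV => hf.2 V fun ⟨j, hj⟩ => hV j.1 j.2 hj.symm⟩

end Cobar

/-! ### Compositions in the cobar construction -/

section Cobar

variable {C : Type u} [Category.{v} C] [MonoidalCategory C] [SymmetricCategory C] {Q : NEFin → C}
  [EnrichedOrdinaryCategory BasedTop C] [SymmetricMonoidalVCategory BasedTop C]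
  [HasLimitsOfSize.{0, 0} C] {q : Cooperad Q} (D : ∀ A, q.TreeFunctor A)
  {A A' B B' E : NEFin}

/-- The action of a bijection on `Ω(Q)`. -/
noncomputable def cobarMap (σ : A ≃ B) : cobar D A ⟶ cobar D B := (exists_cobarMap D σ).choose

theorem cobarMap_proj (σ : A ≃ B) (T : LTree A) :
    cobarMap D σ ≫ cobarProj D (T.relabel σ) =
      cobarProj D T ≫ cotMap (LTree.wbarRelabel σ T) (q.treeRelabel σ T) :=
  (exists_cobarMap D σ).choose_spec T

theorem cobarMap_proj_of_eq {σ : A ≃ B} {T : LTree A} {S : LTree B} (h : T.relabel σ = S) :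
    cobarMap D σ ≫ cobarProj D S =
      cobarProj D T ≫ cotMap (LTree.wbarMap h.ge ≫ LTree.wbarRelabel σ T)
        (q.treeRelabel σ T ≫ (D B).map h.le) := by
  rw [cobarProj_of_eq D h, reassoc_of% (cobarMap_proj D σ T), cotMap_comp]

/-- The partial compositions of `Ω(Q)`. -/
noncomputable def cobarComp (A B : NEFin) (a : A) :
    cobar D A ⊗ cobar D B ⟶ cobar D (graft A a B) := (exists_cobarComp D A B a).choose

theorem cobarComp_proj_graft (T : LTree A) (a : A) (U : LTree B) :
    cobarComp D A B a ≫ cobarProj D (T.graft a U) =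
      (cobarProj D T ⊗ₘ cobarProj D U) ≫ dCot T.wbar U.wbar (treeObj Q T) (treeObj Q U) ≫
        cotMap (LTree.wbarUngraft T a U) (q.treeGraft T a U) :=
  (exists_cobarComp D A B a).choose_spec.1 T U

theorem cobarComp_proj_zero (a : A) (V : LTree (graft A a B))
    (h : ∀ (T : LTree A) (U : LTree B), V ≠ T.graft a U) :
    cobarComp D A B a ≫ cobarProj D V = zeroHom _ _ :=
  (exists_cobarComp D A B a).choose_spec.2 V h

theorem tensor_cobarComp_proj_graft {X Y : C} (f : X ⟶ cobar D A) (g : Y ⟶ cobar D B)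
    (T : LTree A) (a : A) (U : LTree B) :
    (f ⊗ₘ g) ≫ cobarComp D A B a ≫ cobarProj D (T.graft a U) =
      ((f ≫ cobarProj D T) ⊗ₘ (g ≫ cobarProj D U)) ≫
        dCot T.wbar U.wbar (treeObj Q T) (treeObj Q U) ≫
          cotMap (LTree.wbarUngraft T a U) (q.treeGraft T a U) := by
  rw [cobarComp_proj_graft, tensorHom_comp_tensorHom_assoc]

/-- The component of a composite is zero at trees that do not arise by grafting, and at a tree
`T ∪_a U` if one of the factors has zero component at `T` or `U`. -/
theorem tensor_cobarComp_proj_zero {X Y : C} (f : X ⟶ cobar D A) (g : Y ⟶ cobar D B)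
    {a : A} {V : LTree (graft A a B)}
    (h : ∀ (T : LTree A) (U : LTree B), V = T.graft a U →
      f ≫ cobarProj D T = zeroHom _ _ ∨ g ≫ cobarProj D U = zeroHom _ _) :
    (f ⊗ₘ g) ≫ cobarComp D A B a ≫ cobarProj D V = zeroHom _ _ := by
  by_cases hV : ∃ (T : LTree A) (U : LTree B), V = T.graft a U
  · obtain ⟨T, U, rfl⟩ := hV
    rw [tensor_cobarComp_proj_graft]
    rcases h T U rfl with h | h
    · rw [h, ← Category.assoc, zeroHom_tensor_dCot, zeroHom_comp]
    · rw [h, ← Category.assoc, tensor_zeroHom_dCot, zeroHom_comp]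
  · rw [cobarComp_proj_zero D a V fun T U h => hV ⟨T, U, h⟩, comp_zeroHom]

theorem cobarMap_refl (A : NEFin) : cobarMap D (Equiv.refl A) = 𝟙 _ := by
  refine cobar_hom_ext D fun T => ?_
  refine (cobarMap_proj D (Equiv.refl A) T).trans ?_
  rw [LTree.wbarRelabel_refl, LTree.treeRelabel_refl, Category.id_comp]
  exact (congrArg (_ ≫ ·) (cotMap_id _ _)).trans (Category.comp_id _)

theorem cobarMap_trans (σ : A ≃ B) (τ : B ≃ E) :
    cobarMap D (σ.trans τ) = cobarMap D σ ≫ cobarMap D τ := by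
  refine cobar_hom_ext D fun S => ?_
  obtain ⟨T, rfl⟩ := (LTree.relabelIso (σ.trans τ)).surjective S
  refine (cobarMap_proj D (σ.trans τ) T).trans ?_
  rw [LTree.wbarRelabel_trans, LTree.treeRelabel_trans]
  refine Eq.trans ?_ (Category.assoc _ _ _).symm
  refine Eq.trans ?_ (congrArg (cobarMap D σ ≫ ·) (cobarMap_proj D τ (T.relabel σ))).symm
  rw [reassoc_of% (cobarMap_proj D σ T), cotMap_comp]
  rfl

theorem cobarComp_natural (σ : A ≃ A') (τ : B ≃ B') (a : A) :
    cobarComp D A B a ≫ cobarMap D (graftCongr σ τ a) =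
      (cobarMap D σ ⊗ₘ cobarMap D τ) ≫ cobarComp D A' B' (σ a) := by
  refine cobar_hom_ext D fun S => ?_
  rw [Category.assoc, Category.assoc]
  by_cases hS : ∃ (T : LTree A) (U : LTree B), S = (T.relabel σ).graft (σ a) (U.relabel τ)
  · obtain ⟨T, U, rfl⟩ := hS
    rw [cobarMap_proj_of_eq D (LTree.relabel_graft a σ τ T U),
      reassoc_of% (cobarComp_proj_graft D T a U), cotMap_comp, Category.assoc,
      LTree.wbarUngraft_relabel, LTree.treeGraft_relabel, ← cotMap_comp,
      ← reassoc_of% (dCot_natural (LTree.wbarRelabel σ T) (LTree.wbarRelabel τ U)),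
      tensor_cobarComp_proj_graft, cobarMap_proj, cobarMap_proj, tensorHom_comp_tensorHom_assoc]
  · obtain ⟨V, rfl⟩ := (LTree.relabelIso (graftCongr σ τ a)).surjective S
    refine (congrArg (_ ≫ ·) (cobarMap_proj D (graftCongr σ τ a) V)).trans ?_
    rw [← Category.assoc, cobarComp_proj_zero D a V, zeroHom_comp, tensor_cobarComp_proj_zero]
    · rfl
    · intro T' U' h
      obtain ⟨T, rfl⟩ := (LTree.relabelIso σ).surjective T'
      obtain ⟨U, rfl⟩ := (LTree.relabelIso τ).surjective U'
      exact (hS ⟨T, U, h⟩).elim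
    · rintro T U rfl
      exact hS ⟨T, U, LTree.relabel_graft a σ τ T U⟩

/-- The component of `(x ∘_a y) ∘_z w` at a tree `(T ∪_a U) ∪_z R`. -/
theorem cobarComp_cobarComp_proj (T : LTree A) (a : A) (U : LTree B) (z : graft A a B)
    (R : LTree E) :
    cobarComp D A B a ▷ cobar D E ≫ cobarComp D (graft A a B) E z ≫
        cobarProj D ((T.graft a U).graft z R) =
      ((cobarProj D T ⊗ₘ cobarProj D U) ⊗ₘ cobarProj D R) ≫
        dCot T.wbar U.wbar (treeObj Q T) (treeObj Q U) ▷ _ ≫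
          dCot (T.wbar ⊗ U.wbar) R.wbar (treeObj Q T ⊗ treeObj Q U) (treeObj Q R) ≫
            cotMap (LTree.wbarUngraft (T.graft a U) z R ≫ LTree.wbarUngraft T a U ▷ R.wbar)
              (q.treeGraft T a U ▷ treeObj Q R ≫ q.treeGraft (T.graft a U) z R) := by
  have h := dCot_natural (LTree.wbarUngraft T a U) (𝟙 R.wbar) (q.treeGraft T a U)
    (𝟙 (treeObj Q R))
  rw [cotMap_id] at h
  rw [← tensorHom_id, tensor_cobarComp_proj_graft, Category.id_comp, cobarComp_proj_graft,
    ← cotMap_comp, ← tensorHom_id, ← tensorHom_id, ← tensorHom_id, ← reassoc_of% h,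
    tensorHom_comp_tensorHom_assoc, tensorHom_comp_tensorHom_assoc]
  simp only [Category.comp_id, Category.assoc]

/-- The component of `x ∘_a (y ∘_b z)` at a tree `T ∪_a (U ∪_b R)`. -/
theorem cobarComp_whiskerLeft_proj (T : LTree A) (a : A) (U : LTree B) (b : B) (R : LTree E) :
    cobar D A ◁ cobarComp D B E b ≫ cobarComp D A (graft B b E) a ≫
        cobarProj D (T.graft a (U.graft b R)) =
      (cobarProj D T ⊗ₘ (cobarProj D U ⊗ₘ cobarProj D R)) ≫
        _ ◁ dCot U.wbar R.wbar (treeObj Q U) (treeObj Q R) ≫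
          dCot T.wbar (U.wbar ⊗ R.wbar) (treeObj Q T) (treeObj Q U ⊗ treeObj Q R) ≫
            cotMap (LTree.wbarUngraft T a (U.graft b R) ≫ T.wbar ◁ LTree.wbarUngraft U b R)
              (treeObj Q T ◁ q.treeGraft U b R ≫ q.treeGraft T a (U.graft b R)) := by
  have h := dCot_natural (𝟙 T.wbar) (LTree.wbarUngraft U b R) (𝟙 (treeObj Q T))
    (q.treeGraft U b R)
  rw [cotMap_id] at h
  rw [← id_tensorHom, tensor_cobarComp_proj_graft, Category.id_comp, cobarComp_proj_graft,
    ← cotMap_comp, ← id_tensorHom, ← id_tensorHom, ← id_tensorHom, ← reassoc_of% h,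
    tensorHom_comp_tensorHom_assoc, tensorHom_comp_tensorHom_assoc]
  simp only [Category.comp_id, Category.assoc]

theorem cobarComp_cobarComp_zero {a : A} {z : graft A a B} {V : LTree (graft (graft A a B) z E)}
    (h : ∀ (T : LTree A) (U : LTree B) (R : LTree E), V ≠ (T.graft a U).graft z R) :
    cobarComp D A B a ▷ cobar D E ≫ cobarComp D (graft A a B) E z ≫ cobarProj D V =
      zeroHom _ _ := by
  rw [← tensorHom_id, tensor_cobarComp_proj_zero]
  rintro S R rfl
  exact .inl (cobarComp_proj_zero D a S fun T U hS => h T U R (by rw [hS]))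

theorem cobarComp_whiskerLeft_zero {a : A} {b : B} {V : LTree (graft A a (graft B b E))}
    (h : ∀ (T : LTree A) (U : LTree B) (R : LTree E), V ≠ T.graft a (U.graft b R)) :
    cobar D A ◁ cobarComp D B E b ≫ cobarComp D A (graft B b E) a ≫ cobarProj D V =
      zeroHom _ _ := by
  rw [← id_tensorHom, tensor_cobarComp_proj_zero]
  rintro T S rfl
  exact .inr (cobarComp_proj_zero D b S fun U R hS => h T U R (by rw [hS]))

theorem cobarComp_assoc (A B E : NEFin) (a : A) (b : B) :
    cobarComp D A B a ▷ cobar D E ≫ cobarComp D (graft A a B) E (inB b) ≫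
        cobarMap D (graftAssoc A B E a b) =
      (α_ _ _ _).hom ≫ cobar D A ◁ cobarComp D B E b ≫ cobarComp D A (graft B b E) a := by
  refine cobar_hom_ext D fun S => ?_
  simp only [Category.assoc]
  -- Both sides are zero at trees that are not of the form `T ∪_a (U ∪_b R)`.
  by_cases hS : ∃ (T : LTree A) (U : LTree B) (R : LTree E), S = T.graft a (U.graft b R)
  · obtain ⟨T, U, R, rfl⟩ := hS
    rw [cobarComp_whiskerLeft_proj, cobarMap_proj_of_eq D (LTree.relabel_graftAssoc a b T U R),
      reassoc_of% (cobarComp_cobarComp_proj D T a U (inB b) R), cotMap_comp]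
    simp only [Category.assoc]
    rw [LTree.wbarUngraft_assoc, LTree.treeGraft_assoc, ← associator_naturality_assoc,
      ← reassoc_of% (dCot_assoc T.wbar U.wbar R.wbar (treeObj Q T) (treeObj Q U) (treeObj Q R)),
      cotMap_comp, Category.assoc]
  · obtain ⟨V, rfl⟩ := (LTree.relabelIso (graftAssoc A B E a b)).surjective S
    rw [cobarComp_whiskerLeft_zero D fun T U R h => hS ⟨T, U, R, h⟩, comp_zeroHom]
    refine (congrArg (_ ≫ _ ≫ ·) (cobarMap_proj D (graftAssoc A B E a b) V)).trans ?_
    rw [reassoc_of% (cobarComp_cobarComp_zero D (V := V) fun T U R h => hS ⟨T, U, R, by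
      rw [h]; exact LTree.relabel_graftAssoc a b T U R⟩), zeroHom_comp]
    rfl

theorem cobarComp_comm (A B E : NEFin) (a a' : A) (h : a ≠ a') :
    cobarComp D A B a ▷ cobar D E ≫ cobarComp D (graft A a B) E (inA a' h.symm) ≫
        cobarMap D (graftComm A B E a a' h) =
      (α_ _ _ _).hom ≫ cobar D A ◁ (β_ (cobar D B) (cobar D E)).hom ≫ (α_ _ _ _).inv ≫
        cobarComp D A E a' ▷ cobar D B ≫ cobarComp D (graft A a' E) B (inA a h) := by
  refine cobar_hom_ext D fun S => ?_
  simp only [Category.assoc]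
  by_cases hS : ∃ (T : LTree A) (U : LTree B) (R : LTree E), S = (T.graft a' R).graft (inA a h) U
  · obtain ⟨T, U, R, rfl⟩ := hS
    rw [cobarComp_cobarComp_proj, cobarMap_proj_of_eq D (LTree.relabel_graftComm h T U R),
      reassoc_of% (cobarComp_cobarComp_proj D T a U (inA a' h.symm) R), cotMap_comp]
    simp only [Category.assoc]
    have h1 : (α_ _ _ _).hom ≫ cobar D A ◁ (β_ (cobar D B) (cobar D E)).hom ≫ (α_ _ _ _).inv ≫
        ((cobarProj D T ⊗ₘ cobarProj D R) ⊗ₘ cobarProj D U) =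
        ((cobarProj D T ⊗ₘ cobarProj D U) ⊗ₘ cobarProj D R) ≫ (α_ _ _ _).hom ≫
          _ ◁ (β_ _ _).hom ≫ (α_ _ _ _).inv := by
      rw [associator_naturality_assoc, ← associator_inv_naturality, ← id_tensorHom,
        ← id_tensorHom, tensorHom_comp_tensorHom_assoc, tensorHom_comp_tensorHom_assoc,
        BraidedCategory.braiding_naturality, Category.id_comp, Category.comp_id]
    rw [LTree.wbarUngraft_comm, LTree.treeGraft_comm, reassoc_of% h1,
      ← reassoc_of% (dCot_swap T.wbar U.wbar R.wbar (treeObj Q T) (treeObj Q U) (treeObj Q R)),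
      cotMap_comp]
    simp only [Category.assoc]
  · obtain ⟨V, rfl⟩ := (LTree.relabelIso (graftComm A B E a a' h)).surjective S
    rw [cobarComp_cobarComp_zero D fun T R U h => hS ⟨T, U, R, h⟩, comp_zeroHom, comp_zeroHom,
      comp_zeroHom]
    refine (congrArg (_ ≫ _ ≫ ·) (cobarMap_proj D (graftComm A B E a a' h) V)).trans ?_
    rw [reassoc_of% (cobarComp_cobarComp_zero D (V := V) fun T U R h' => hS ⟨T, U, R, by
      rw [h']; exact LTree.relabel_graftComm h T U R⟩), zeroHom_comp]
    rfl

end Cobar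

/-! ### The unit, and uniqueness of the operad structure -/

namespace LTree

/-- There is exactly one tree with one leaf. -/
instance : Unique (LTree NEFin.one) where
  default :=
    { clusters := {Set.univ}
      nonempty_of_mem := by
        rintro _ rfl
        exact Set.univ_nonempty
      univ_mem := rfl
      singleton_mem a := eq_univ_of_one (Set.singleton_nonempty a)
      laminar := by
        rintro _ rfl _ rfl
        exact .inl subset_rfl }
  uniq T := LTree.ext (clusters_one T)

/-- The tree with one leaf has exactly one weighting, and this is not the basepoint. -/
instance (I : LTree NEFin.one) : IsIso (wbarOne I) := by
  obtain ⟨x, -⟩ := exists_weighting I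
  let g : 𝟙_ BasedTop ⟶ I.wbar :=
    ⟨fun b : Bool => if b then wmk x else I.wbar.pt,
      continuous_of_discreteTopology (α := Bool), rfl⟩
  refine ⟨g, wbar_hom_ext fun y => ?_, BasedTop.hom_ext ?_⟩
  · have hxy : x = y := len_ext fun c => by
      by_cases hc : c ∈ I.clusters
      · obtain rfl := eq_univ_of_one (I.nonempty_of_mem c hc)
        rw [len_one, len_one]
      · rw [len_of_notMem x hc, len_of_notMem y hc]
    exact congrArg wmk hxy
  · rintro (_ | _)
    · exact BasedTop.map_pt (wbarOne I)
    · rfl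

end LTree

section Cobar

variable {C : Type u} [Category.{v} C] [MonoidalCategory C] [SymmetricCategory C] {Q : NEFin → C}
  [EnrichedOrdinaryCategory BasedTop C] [SymmetricMonoidalVCategory BasedTop C]
  [HasLimitsOfSize.{0, 0} C] {q : Cooperad Q} (D : ∀ A, q.TreeFunctor A)
  {A B : NEFin}

theorem exists_cobarUnit : ∃ f : 𝟙_ C ⟶ cobar D NEFin.one, ∀ I : LTree NEFin.one,
    f ≫ cobarProj D I =
      cotUnit BasedTop (𝟙_ C) ≫ cotMap (LTree.wbarOne I) (LTree.treeUnit Q I) := by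
  refine exists_cobar_lift D _ fun {I I'} h => ?_
  obtain rfl := Subsingleton.elim I I'
  rw [LTree.wbarMap_refl, (D _).map_refl]

/-- The unit of `Ω(Q)`. -/
noncomputable def cobarUnit : 𝟙_ C ⟶ cobar D NEFin.one := (exists_cobarUnit D).choose

theorem cobarUnit_proj (I : LTree NEFin.one) :
    cobarUnit D ≫ cobarProj D I =
      cotUnit BasedTop (𝟙_ C) ≫ cotMap (LTree.wbarOne I) (LTree.treeUnit Q I) :=
  (exists_cobarUnit D).choose_spec I

theorem cobarUnit_comp (A : NEFin) :
    (λ_ (cobar D A)).inv ≫ cobarUnit D ▷ cobar D A ≫ cobarComp D NEFin.one A () ≫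
      cobarMap D (graftOneLeft A) = 𝟙 (cobar D A) := by
  refine cobar_hom_ext D fun T => ?_
  let I : LTree NEFin.one := default
  have h := dCot_natural (LTree.wbarOne I) (𝟙 T.wbar) (LTree.treeUnit Q I) (𝟙 (treeObj Q T))
  rw [cotMap_id] at h
  have h1 : (cobarUnit D ⊗ₘ 𝟙 _) ≫ cobarComp D NEFin.one A () ≫ cobarProj D (I.graft () T) = _ :=
    tensor_cobarComp_proj_graft D (cobarUnit D) (𝟙 _) I () T
  have h2 : (cotUnit BasedTop (𝟙_ C) ≫ cotMap (LTree.wbarOne I) (LTree.treeUnit Q I)) ⊗ₘ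
      cobarProj D T = (𝟙 _ ⊗ₘ cobarProj D T) ≫ (cotUnit BasedTop (𝟙_ C) ▷ _) ≫
        (cotMap (LTree.wbarOne I) (LTree.treeUnit Q I) ⊗ₘ 𝟙 _) := by
    rw [← tensorHom_id, tensorHom_comp_tensorHom, tensorHom_comp_tensorHom]
    simp only [Category.id_comp, Category.comp_id]
  simp only [Category.assoc, Category.id_comp]
  rw [cobarMap_proj_of_eq D (LTree.relabel_graftOneLeft I T), ← tensorHom_id]
  refine (congrArg (_ ≫ ·)
    (by simpa only [Category.assoc] using congrArg (· ≫ cotMap _ _) h1)).trans ?_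
  rw [cobarUnit_proj, Category.id_comp, h2]
  simp only [Category.assoc]
  rw [reassoc_of% h, cotMap_comp, cotMap_comp, tensorHom_id, tensorHom_id]
  simp only [Category.assoc]
  refine (congrArg₂ (fun k l => (λ_ _).inv ≫ (𝟙 _ ⊗ₘ cobarProj D T) ≫
    cotUnit BasedTop (𝟙_ C) ▷ _ ≫ dCot _ _ _ _ ≫ cotMap k l)
      (LTree.wbarUngraft_one_left I T) (LTree.treeUnit_treeGraft q I T (D A))).trans ?_
  rw [id_tensorHom, ← leftUnitor_inv_naturality_assoc, dCot_unit_left, Category.comp_id]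

theorem cobarComp_unit (A : NEFin) (a : A) :
    (ρ_ (cobar D A)).inv ≫ cobar D A ◁ cobarUnit D ≫ cobarComp D A NEFin.one a =
      cobarMap D (graftOneRight A a) := by
  refine cobar_hom_ext D fun S => ?_
  obtain ⟨T, rfl⟩ := (LTree.relabelIso (graftOneRight A a)).surjective S
  let I : LTree NEFin.one := default
  change _ ≫ cobarProj D (T.relabel (graftOneRight A a)) =
    _ ≫ cobarProj D (T.relabel (graftOneRight A a))
  rw [LTree.relabel_graftOneRight a T I,
    cobarMap_proj_of_eq D (LTree.relabel_graftOneRight a T I)]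
  have h := dCot_natural (𝟙 T.wbar) (LTree.wbarOne I) (𝟙 (treeObj Q T)) (LTree.treeUnit Q I)
  rw [cotMap_id] at h
  have h2 : cobarProj D T ⊗ₘ
      (cotUnit BasedTop (𝟙_ C) ≫ cotMap (LTree.wbarOne I) (LTree.treeUnit Q I)) =
      (cobarProj D T ⊗ₘ 𝟙 _) ≫ (_ ◁ cotUnit BasedTop (𝟙_ C)) ≫
        (𝟙 _ ⊗ₘ cotMap (LTree.wbarOne I) (LTree.treeUnit Q I)) := by
    rw [← id_tensorHom, tensorHom_comp_tensorHom, tensorHom_comp_tensorHom]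
    simp only [Category.id_comp, Category.comp_id]
  simp only [Category.assoc]
  rw [← id_tensorHom, tensor_cobarComp_proj_graft, cobarUnit_proj, Category.id_comp, h2]
  simp only [Category.assoc]
  rw [reassoc_of% h, cotMap_comp, id_tensorHom, id_tensorHom, LTree.wbarUngraft_one_right,
    LTree.treeGraft_treeUnit q a T I (D _), tensorHom_id, ← rightUnitor_inv_naturality_assoc,
    ← Category.assoc (LTree.wbarMap _), ← cotMap_comp, reassoc_of% (dCot_unit T.wbar (treeObj Q T))]

/-- The operad `Ω(Q)`. -/
noncomputable def cobarOperad : Operad (cobar D) where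
  map := cobarMap D
  map_refl := cobarMap_refl D
  map_trans := cobarMap_trans D
  comp := cobarComp D
  unit := cobarUnit D
  comp_natural := cobarComp_natural D
  comp_assoc := cobarComp_assoc D
  comp_comm := cobarComp_comm D
  unit_comp := cobarUnit_comp D
  comp_unit := cobarComp_unit D

theorem isCobarStructure_cobarOperad : IsCobarStructure D (cobarOperad D) where
  map := cobarMap_proj D
  comp_graft := cobarComp_proj_graft D
  comp_zero := cobarComp_proj_zero D
  unit I := (cobarUnit_proj D I).trans (tensCotEquiv_tensUnit _ _).symm

/-- The end over the single tree with one leaf is the value at this tree. -/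
instance (I : LTree NEFin.one) : IsIso (cobarProj D I) := by
  obtain ⟨f, hf⟩ := exists_cobar_lift D (X := cotObj I.wbar (treeObj Q I))
    (fun I' => eqToHom (by rw [Subsingleton.elim I I'])) fun {I₁ I₂} h => by
      obtain rfl := Subsingleton.elim I₁ I₂
      rw [LTree.wbarMap_refl, (D _).map_refl]
  have h : f ≫ cobarProj D I = 𝟙 _ := hf I
  refine ⟨f, cobar_hom_ext D fun I' => ?_, h⟩
  obtain rfl := Subsingleton.elim I I'
  rw [Category.assoc, h, Category.comp_id, Category.id_comp]

/-- The component of the unit at the tree `I` with one leaf is an isomorphism, since `wbar I` is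
`S⁰` and `Q(I)` is the empty product, the unit object. -/
theorem isReduced_cobarOperad : (cobarOperad D).IsReduced := by
  let I : LTree NEFin.one := default
  have h1 : IsIso (cotMap (LTree.wbarOne I) (LTree.treeUnit Q I)) := by
    have : IsIso (LTree.treeUnit Q I) :=
      inferInstanceAs (IsIso (bigTensorEmpty fun v : I.Vert => Q (I.inc v)).inv)
    rw [cotMap]
    infer_instance
  have h2 := isIso_cotUnit (V := BasedTop) (𝟙_ C)
  have h3 : IsIso (cobarUnit D ≫ cobarProj D I) := by
    rw [cobarUnit_proj]
    infer_instance
  exact IsIso.of_isIso_comp_right (cobarUnit D) (cobarProj D I)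

/-- A cobar structure prescribes all components of all structure maps. -/
theorem IsCobarStructure.eq {o o' : Operad (cobar D)} (h : IsCobarStructure D o)
    (h' : IsCobarStructure D o') : o = o' := by
  refine Operad.ext ?_ ?_ ?_
  · funext A B σ
    refine cobar_hom_ext D fun S => ?_
    obtain ⟨T, rfl⟩ := (LTree.relabelIso σ).surjective S
    exact (h.map σ T).trans (h'.map σ T).symm
  · funext A B a
    refine cobar_hom_ext D fun V => ?_
    by_cases hV : ∃ (T : LTree A) (U : LTree B), V = T.graft a U
    · obtain ⟨T, U, rfl⟩ := hV
      exact (h.comp_graft T a U).trans (h'.comp_graft T a U).symm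
    · have hV' : ∀ (T : LTree A) (U : LTree B), V ≠ T.graft a U := fun T U e => hV ⟨T, U, e⟩
      exact (h.comp_zero a V hV').trans (h'.comp_zero a V hV').symm
  · exact cobar_hom_ext D fun I => (h.unit I).trans (h'.unit I).symm

end Cobar

end CobarOperad

theorem mainTheorem2 {C : Type u} [Category.{v} C] [MonoidalCategory C]
    [SymmetricCategory C] [EnrichedOrdinaryCategory BasedTop C]
    [SymmetricMonoidalVCategory BasedTop C] [HasLimitsOfSize.{0, 0} C]
    (Q : NEFin → C) (q : Cooperad Q) (hq : q.IsReduced) :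
    (∀ A, Nonempty (Unique (q.TreeFunctor A))) ∧
      ∀ D : ∀ A, q.TreeFunctor A, ∃ o : Operad (cobar D), IsCobarStructure D o ∧ o.IsReduced ∧
        ∀ o' : Operad (cobar D), IsCobarStructure D o' → o' = o := by
  exact ⟨fun A => ⟨inferInstance⟩, fun D => ⟨cobarOperad D, isCobarStructure_cobarOperad D,
    isReduced_cobarOperad D, fun _ h => h.eq D (isCobarStructure_cobarOperad D)⟩⟩
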